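/- Let $m,k\ge 1$ and consider the cellular automaton $\mathcal R_{m,k}$ on a lattice of $L\ge 1$ sites with periodic boundary conditions, each site being $0$ (empty) or $1$ (car): at each time step every maximal match of $1^x0^y$ is replaced by $1^{x-a}0^b1^a0^{y-b}$, where $a=\min\{k,x\}$ and $b=\min\{m,y\}$ (a state in which all sites are equal does not change). A group is a $0$-block together with the $1$-block following it; $\rho$ is the density of cars; the flow in a time step is the total displacement of the cars divided by $L$; a state is cyclic if it recurs. Write $\star_{a,b}$, $0_{a,b}$, $1_{a,b}$, $\Diamond_{a,b}$ for a group $0^{a+m}1^{b+k}$ with $a\le 0,b\le 0$; $a>0,b\le 0$; $a\le 0,b>0$; and $a>0,b>0$, respectively, and $?_{a,b}$ for whichever of these symbols the integer indices $a,b$ determine. A state is represented by the circular string of the symbols of its groups. On circular strings of symbols consider the replacement rules $$\Diamond_{a,b}\to\ ?_{a-m,b-k}\ (\Delta g=+1),\quad \star_{a,b}\star_{c,d}\to\star_{a+c,b+d},\quad 0_{a,b}\star_{c,d}\to\ ?_{a+c,b+d},\quad \star_{a,b}1_{c,d}\to\ ?_{a+c,b+d},\quad 0_{a,b}1_{c,d}\to\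 ?_{a+c,b+d}\ (\Delta g=0).$$ A maximal application of the rules is a finite sequence of replacements ending in a string to which no rule applies. Then the following hold. 1. For every initial state there is no infinite sequence of replacements starting from its string of symbols, the evolution reaches a cyclic state, and for every maximal application of the rules to that string, in whatever order, every cyclic state reached has exactly $N_G = (\text{initial number of symbols}) + (\text{sum of the } \Delta g)$ groups. Hence the flow averaged over the cycle is $$\phi=\min\Bigl\{m\rho,\ \frac{\rho(1-\rho)}{N_G/L},\ k(1-\rho)\Bigr\}$$ (the middle term is read as $0$ when $N_G=0$, i.e. when $\rho\in\{0,1\}$). 2. There are a single stack program (finitely many integer registers and stacks; additions, subtractions, sign tests, pushes, pops, and a single left-to-right reading of the sites, each counted as one operation) and a constant $C$ such that for all $m,k,L\ge1$ and all initial states the program, given $m$, $k$ and the sites, halts after at most $CL$ operations, computing only integers of absolute value at most $CL(m+k)$, and outputs the final string and the number $N_G$ of some maximal application of the rules. 3. For all $m,k\ge1$ there are $c>0$ and $L_0$ such that for every $L\ge L_0$ there is an initial state of length $L$ whose direct simulation until a cyclic state is reached takes time at least $cL^2$, where each time step of the simulation costs $L$ site updates. -/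

import Mathlib

namespace TrafficRule

/-! ### The road and the rule with speed bound `m` and block bound `k` -/

/-- A state of a lattice of length `L` with periodic boundary conditions:
`true` is a car (a one), `false` is an empty site (a zero). -/
abbrev Road (L : ℕ) := ZMod L → Bool

/-- The number of consecutive sites `i, i+1, i+2, …` with value `v` (at most `L`). -/
def run {L : ℕ} (s : Road L) (v : Bool) (i : ZMod L) : ℕ :=
  ((List.range L).takeWhile fun j => s (i + (j : ZMod L)) == v).length

/-- How far site `i` sends its car in one time step. If `i` carries a car, let `x` be the number
of cars from `i` to the front of its block. If `x ≤ k`, the car is among the first `k` cars of the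
block and it advances `m` sites or up to the next block of cars, whichever is less; all other cars
stay. This is the replacement `1^x 0^y → 1^(x-a) 0^b 1^a 0^(y-b)`, with `a = min k x` and
`b = min m y`, of every maximal match of `1^x 0^y`. -/
def displacement (m k : ℕ) {L : ℕ} (s : Road L) (i : ZMod L) : ℕ :=
  if s i = true ∧ run s true i ≤ k then
    min m (run s false (i + (run s true i : ZMod L)))
  else 0

/-- One time step of the cellular automaton. -/
def step (m k : ℕ) {L : ℕ} [NeZero L] (s : Road L) : Road L := fun j =>
  decide (∃ i : ZMod L, s i = true ∧ i + (displacement m k s i : ZMod L) = j)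

/-- The density `ρ` of cars. -/
noncomputable def density {L : ℕ} [NeZero L] (s : Road L) : ℝ :=
  (Finset.univ.filter fun i : ZMod L => s i = true).card / (L : ℝ)

/-- The number of groups (a group is a `0`-block together with the `1`-block that follows it). -/
def groups {L : ℕ} [NeZero L] (s : Road L) : ℕ :=
  (Finset.univ.filter fun i : ZMod L => s i = false ∧ s (i + 1) = true).card

/-- The momentary flow: density times mean velocity, that is, the total displacement of the cars
in one time step divided by `L`. -/
noncomputable def flow (m k : ℕ) {L : ℕ} [NeZero L] (s : Road L) : ℝ :=
  (∑ i : ZMod L, (displacement m k s i : ℝ)) / (L : ℝ)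

/-- The state recurs under the rule. -/
def IsCyclicState (m k : ℕ) {L : ℕ} [NeZero L] (s : Road L) : Prop :=
  s ∈ Function.periodicPts (step m k : Road L → Road L)

/-- The time average of the flow over the cycle of a cyclic state. -/
noncomputable def cycleFlow (m k : ℕ) {L : ℕ} [NeZero L] (s : Road L) : ℝ :=
  (∑ t ∈ Finset.range (Function.minimalPeriod (step m k) s), flow m k ((step m k)^[t] s)) /
    (Function.minimalPeriod (step m k) s : ℝ)

/-- The number of time steps after which the evolution from `s` first is in a cyclic state. -/
noncomputable def transientTime (m k : ℕ) {L : ℕ} [NeZero L] (s : Road L) : ℕ :=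
  sInf {T : ℕ | IsCyclicState m k ((step m k)^[T] s)}

/-- The time of the direct simulation of the automaton from `s` until a cyclic state is reached:
every time step updates each of the `L` sites. -/
noncomputable def directSimulationTime (m k : ℕ) {L : ℕ} [NeZero L] (s : Road L) : ℕ :=
  L * transientTime m k s

/-! ### Symbols and replacement rules -/

/-- The symbol with indices `(a, b)` stands for the group `0^(a+m) 1^(b+k)`. -/
abbrev Symbol := ℤ × ℤ

/-- The four kinds of symbols: `⋆`, `0`, `1` and `◇`. -/
inductive Kind
  | star
  | zero
  | one
  | diamond
  deriving DecidableEq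

/-- The kind of a symbol is determined by the signs of its indices. -/
def kind (p : Symbol) : Kind :=
  if p.1 ≤ 0 then (if p.2 ≤ 0 then Kind.star else Kind.one)
  else (if p.2 ≤ 0 then Kind.zero else Kind.diamond)

/-- The circular string of symbols that represents a state: going around the road, every
`0`-block (of length `x`) and the following `1`-block (of length `y`) give the symbol
`(x - m, y - k)`. It is empty if all sites have the same value. -/
def initialString (m k : ℕ) {L : ℕ} (s : Road L) : Cycle Symbol :=
  (((List.range L).filterMap fun j =>
    if s ((j : ZMod L) - 1) = true ∧ s (j : ZMod L) = false then
      some ((run s false (j : ZMod L) : ℤ) - (m : ℤ),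
        (run s true ((j : ZMod L) + (run s false (j : ZMod L) : ZMod L)) : ℤ) - (k : ℤ))
    else none : List Symbol) : Cycle Symbol)

/-- `Replace m k w d w'`: one application of a replacement rule somewhere in the circular string
`w` gives `w'` and creates `d` new groups. (As the string is circular, the place where the rule is
applied may be rotated to the front.) -/
inductive Replace (m k : ℕ) : Cycle Symbol → ℕ → Cycle Symbol → Prop
  | diamond (p : Symbol) (u : List Symbol) : kind p = Kind.diamond →
      Replace m k ((p :: u : List Symbol) : Cycle Symbol) 1
        (((p.1 - (m : ℤ), p.2 - (k : ℤ)) :: u : List Symbol) : Cycle Symbol)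
  | star_star (p q : Symbol) (u : List Symbol) : kind p = Kind.star → kind q = Kind.star →
      Replace m k ((p :: q :: u : List Symbol) : Cycle Symbol) 0
        (((p.1 + q.1, p.2 + q.2) :: u : List Symbol) : Cycle Symbol)
  | zero_star (p q : Symbol) (u : List Symbol) : kind p = Kind.zero → kind q = Kind.star →
      Replace m k ((p :: q :: u : List Symbol) : Cycle Symbol) 0
        (((p.1 + q.1, p.2 + q.2) :: u : List Symbol) : Cycle Symbol)
  | star_one (p q : Symbol) (u : List Symbol) : kind p = Kind.star → kind q = Kind.one →
      Replace m k ((p :: q :: u : List Symbol) : Cycle Symbol) 0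
        (((p.1 + q.1, p.2 + q.2) :: u : List Symbol) : Cycle Symbol)
  | zero_one (p q : Symbol) (u : List Symbol) : kind p = Kind.zero → kind q = Kind.one →
      Replace m k ((p :: q :: u : List Symbol) : Cycle Symbol) 0
        (((p.1 + q.1, p.2 + q.2) :: u : List Symbol) : Cycle Symbol)

/-- A finite sequence of replacements that creates `g` new groups in total. -/
inductive Replaces (m k : ℕ) : Cycle Symbol → ℕ → Cycle Symbol → Prop
  | refl (w : Cycle Symbol) : Replaces m k w 0 w
  | tail {w w' w'' : Cycle Symbol} {g d : ℕ} :
      Replaces m k w g w' → Replace m k w' d w'' → Replaces m k w (g + d) w''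

/-- A maximal application of the rules: a sequence of replacements from `w` to a string `w'` to
which no rule applies, creating `g` new groups in total. -/
def MaximalApplication (m k : ℕ) (w : Cycle Symbol) (g : ℕ) (w' : Cycle Symbol) : Prop :=
  Replaces m k w g w' ∧ ∀ d w'', ¬ Replace m k w' d w''

/-! ### Stack programs and their running time -/

/-- Programs of a machine with finitely many integer registers and stacks (those that the program
mentions) and an input of lattice sites that is read once from left to right. -/
inductive Program
  /-- `r := z` -/
  | const (r : ℕ) (z : ℤ)
  /-- `r := p + q` -/
  | add (r p q : ℕ)
  /-- `r := p - q` -/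
  | sub (r p q : ℕ)
  /-- read the next site into `r`: `1` for a car, `0` for an empty site, `-1` at the end -/
  | read (r : ℕ)
  /-- push register `r` on stack `i` -/
  | push (i r : ℕ)
  /-- pop the top of stack `i`, which must not be empty, into `r` -/
  | pop (i r : ℕ)
  | seq (c d : Program)
  /-- if `r > 0` then `c` else `d` -/
  | ifPos (r : ℕ) (c d : Program)
  /-- while `r > 0` do `c` -/
  | whilePos (r : ℕ) (c : Program)

/-- The contents of the registers, the stacks (top first) and the unread part of the input. -/
structure Store where
  reg : ℕ → ℤ
  stack : ℕ → List ℤ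
  input : List Bool

def Store.set (σ : Store) (r : ℕ) (z : ℤ) : Store :=
  { σ with reg := Function.update σ.reg r z }

def Store.setStack (σ : Store) (i : ℕ) (l : List ℤ) : Store :=
  { σ with stack := Function.update σ.stack i l }

/-- `Exec W P σ t σ'`: on a machine whose integers are at most `W` in absolute value, the program
`P` started in `σ` halts in `σ'` after `t` elementary operations. Each assignment, addition,
subtraction, reading of a site, push, pop and test of a sign is one operation. -/
inductive Exec (W : ℤ) : Program → Store → ℕ → Store → Prop
  | const (σ : Store) (r : ℕ) (z : ℤ) : |z| ≤ W → Exec W (.const r z) σ 1 (σ.set r z)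
  | add (σ : Store) (r p q : ℕ) : |σ.reg p + σ.reg q| ≤ W →
      Exec W (.add r p q) σ 1 (σ.set r (σ.reg p + σ.reg q))
  | sub (σ : Store) (r p q : ℕ) : |σ.reg p - σ.reg q| ≤ W →
      Exec W (.sub r p q) σ 1 (σ.set r (σ.reg p - σ.reg q))
  | read_site (σ : Store) (r : ℕ) (v : Bool) (l : List Bool) : σ.input = v :: l →
      Exec W (.read r) σ 1 { σ.set r (if v then 1 else 0) with input := l }
  | read_end (σ : Store) (r : ℕ) : σ.input = [] → Exec W (.read r) σ 1 (σ.set r (-1))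
  | push (σ : Store) (i r : ℕ) :
      Exec W (.push i r) σ 1 (σ.setStack i (σ.reg r :: σ.stack i))
  | pop (σ : Store) (i r : ℕ) (z : ℤ) (l : List ℤ) : σ.stack i = z :: l →
      Exec W (.pop i r) σ 1 ((σ.set r z).setStack i l)
  | seq {c d : Program} {σ σ' σ'' : Store} {t t' : ℕ} :
      Exec W c σ t σ' → Exec W d σ' t' σ'' → Exec W (.seq c d) σ (t + t') σ''
  | if_pos {r : ℕ} {c d : Program} {σ σ' : Store} {t : ℕ} :
      0 < σ.reg r → Exec W c σ t σ' → Exec W (.ifPos r c d) σ (t + 1) σ'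
  | if_not {r : ℕ} {c d : Program} {σ σ' : Store} {t : ℕ} :
      ¬ 0 < σ.reg r → Exec W d σ t σ' → Exec W (.ifPos r c d) σ (t + 1) σ'
  | while_pos {r : ℕ} {c : Program} {σ σ' σ'' : Store} {t t' : ℕ} :
      0 < σ.reg r → Exec W c σ t σ' → Exec W (.whilePos r c) σ' t' σ'' →
      Exec W (.whilePos r c) σ (t + t' + 1) σ''
  | while_not {r : ℕ} {c : Program} {σ : Store} :
      ¬ 0 < σ.reg r → Exec W (.whilePos r c) σ 1 σ

/-- The start of the machine: `m` and `k` in registers `0` and `1`, all other registers zero, all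
stacks empty, and the sites `0, 1, …, L - 1` of the road as input. -/
def startStore (m k : ℕ) {L : ℕ} (s : Road L) : Store where
  reg := fun r => if r = 0 then (m : ℤ) else if r = 1 then (k : ℤ) else 0
  stack := fun _ => []
  input := (List.range L).map fun j => s (j : ZMod L)

/-- A string of symbols as stack contents, two integers for each symbol. -/
def encode (u : List Symbol) : List ℤ := u.flatMap fun p => [p.1, p.2]

end TrafficRule

open TrafficRule

namespace TrafficRule

/-! ### Confluence and termination of the replacement rules -/

/-! Confluence. The four joining rules are one rule, `p q → p + q` whenever `p.2 ≤ 0` and `q.1 ≤ 0`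
(`replace_iff`). A `◇` has both indices positive and takes part in no join, and two overlapping
joins in `p q r` both lead to `p + q + r`. So different replacements commute
(`replace_diamond_property`). The sum of `max p.1 0 + 1` over the symbols falls with every
replacement, so the total `Δg` of a maximal application is a function `newGroups` of the string.

Link with the automaton. A time step is itself a combination of rules, some of them read backwards.
Every symbol splits into a left part, a core and a right part: a `◇` is divided, a `⋆` is un-joined
into its two deficits, and neutral symbols `(0, 0)` are inserted where needed, which does not change
`newGroups` (`newGroups_insert`). Then the right part of each symbol is joined with the left part of
the next. Hence one step lowers `newGroups` by the number of `◇` (`newGroups_stepString`). It raises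
the number of groups by the same number, so their sum is conserved. That `stepString` describes the
road is `Presents.step`.

Cyclic states. The number of groups never decreases, so a cycle contains no `◇`. The total surpluses
`∑ max p.1 0` and `∑ max p.2 0` do not increase either, so they too are constant on a cycle. Since
surpluses and deficits move relative to each other, they would meet and cancel. Only three regimes
survive (`CyclicProfile.cases`): surplus empty sites only, surplus cars only, or no surplus at all.
In each of them `newGroups` is zero, so the conserved sum is the final number of groups. The three
regimes give the three terms of the minimum (`CyclicProfile.cycleFlow_eq`); in the last regime every
block of cars meets every block of empty sites once in `N` steps, which yields the product term.

Program. The road is scanned from back to front and the irreducible linear string of the part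
already read is kept on two stacks, `1`-symbols with possibly a final `⋆` on the one and `0`-symbols
on the other. Every iteration of the reduction loop but the last one lowers the potential, which is
at most `L` at the start, so the work is linear. Closing the circle means inserting the `0`-symbols
once more in front and then the last symbol. A weight that no replacement increases bounds all
indices by a multiple of `L (m + k)`.

Lower bound. A single group with about `L / 2` empty sites and `L / 2` cars sheds one group per step
for a number of steps proportional to `L`, and no cyclic state sheds groups. -/

theorem kind_eq_diamond {p : Symbol} : kind p = Kind.diamond ↔ 0 < p.1 ∧ 0 < p.2 := by
  unfold kind; split_ifs <;> simp <;> omega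

theorem kind_eq_star {p : Symbol} : kind p = Kind.star ↔ p.1 ≤ 0 ∧ p.2 ≤ 0 := by
  unfold kind; split_ifs <;> simp <;> omega

theorem kind_eq_zero {p : Symbol} : kind p = Kind.zero ↔ 0 < p.1 ∧ p.2 ≤ 0 := by
  unfold kind; split_ifs <;> simp <;> omega

theorem kind_eq_one {p : Symbol} : kind p = Kind.one ↔ p.1 ≤ 0 ∧ 0 < p.2 := by
  unfold kind; split_ifs <;> simp <;> omega

/-- The symbol of a group without `m` of its empty sites and `k` of its cars. -/
def shrink (m k : ℕ) (p : Symbol) : Symbol := (p.1 - (m : ℤ), p.2 - (k : ℤ))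

/-- The four rules that join two symbols are one: `p q → p + q` if `p.2 ≤ 0` and `q.1 ≤ 0`. -/
theorem replace_iff {m k : ℕ} {w w' : Cycle Symbol} {d : ℕ} : Replace m k w d w' ↔
    (∃ (p : Symbol) (u : List Symbol), 0 < p.1 ∧ 0 < p.2 ∧ w = ((p :: u : List Symbol) : Cycle Symbol)
      ∧ d = 1 ∧ w' = ((shrink m k p :: u : List Symbol) : Cycle Symbol)) ∨
    ∃ (p q : Symbol) (u : List Symbol), p.2 ≤ 0 ∧ q.1 ≤ 0 ∧
      w = ((p :: q :: u : List Symbol) : Cycle Symbol) ∧ d = 0 ∧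
      w' = (((p + q) :: u : List Symbol) : Cycle Symbol) := by
  constructor
  · rintro (⟨p, u, h⟩ | ⟨p, q, u, h, h'⟩ | ⟨p, q, u, h, h'⟩ | ⟨p, q, u, h, h'⟩ | ⟨p, q, u, h, h'⟩)
    · rw [kind_eq_diamond] at h
      exact Or.inl ⟨p, u, h.1, h.2, rfl, rfl, rfl⟩
    all_goals
      simp only [kind_eq_star, kind_eq_zero, kind_eq_one] at h h'
      exact Or.inr ⟨p, q, u, h.2, h'.1, rfl, rfl, rfl⟩
  · rintro (⟨p, u, h, h', rfl, rfl, rfl⟩ | ⟨p, q, u, h, h', rfl, rfl, rfl⟩)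
    · exact Replace.diamond p u (kind_eq_diamond.2 ⟨h, h'⟩)
    · rcases le_or_gt p.1 0 with hp | hp <;> rcases le_or_gt q.2 0 with hq | hq
      · exact Replace.star_star p q u (kind_eq_star.2 ⟨hp, h⟩) (kind_eq_star.2 ⟨h', hq⟩)
      · exact Replace.star_one p q u (kind_eq_star.2 ⟨hp, h⟩) (kind_eq_one.2 ⟨h', hq⟩)
      · exact Replace.zero_star p q u (kind_eq_zero.2 ⟨hp, h⟩) (kind_eq_star.2 ⟨h', hq⟩)
      · exact Replace.zero_one p q u (kind_eq_zero.2 ⟨hp, h⟩) (kind_eq_one.2 ⟨h', hq⟩)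

theorem coe_append_comm {α : Type*} (u v : List α) : ((u ++ v : List α) : Cycle α) = (v ++ u : List α) :=
  Cycle.coe_eq_coe.2 List.isRotated_append

/-- A replacement inside of a linear string. -/
inductive LinearReplace (m k : ℕ) : List Symbol → ℕ → List Symbol → Prop
  | diamond (u v : List Symbol) (p : Symbol) : 0 < p.1 → 0 < p.2 →
      LinearReplace m k (u ++ p :: v) 1 (u ++ shrink m k p :: v)
  | merge (u v : List Symbol) (p q : Symbol) : p.2 ≤ 0 → q.1 ≤ 0 →
      LinearReplace m k (u ++ p :: q :: v) 0 (u ++ (p + q) :: v)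

theorem LinearReplace.append {m k d : ℕ} {u u' : List Symbol} (h : LinearReplace m k u d u')
    (x y : List Symbol) : LinearReplace m k (x ++ u ++ y) d (x ++ u' ++ y) := by
  cases h with
  | diamond u v p h h' => simpa using LinearReplace.diamond (m := m) (k := k) (x ++ u) (v ++ y) p h h'
  | merge u v p q h h' => simpa using LinearReplace.merge (m := m) (k := k) (x ++ u) (v ++ y) p q h h'

theorem LinearReplace.replace {m k d : ℕ} {u u' : List Symbol} (h : LinearReplace m k u d u') :
    Replace m k (u : Cycle Symbol) d (u' : Cycle Symbol) := by
  rw [replace_iff]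
  cases h with
  | diamond u v p h h' =>
    exact Or.inl ⟨p, v ++ u, h, h', by rw [coe_append_comm]; rfl, rfl, by rw [coe_append_comm]; rfl⟩
  | merge u v p q h h' =>
    exact Or.inr ⟨p, q, v ++ u, h, h', by rw [coe_append_comm]; rfl, rfl, by rw [coe_append_comm]; rfl⟩

/-- Two lists with the same circular string are `α ++ β` and `β ++ α`. -/
theorem exists_append_of_coe_eq {α : Type*} {u v : List α} (h : (u : Cycle α) = (v : Cycle α)) :
    ∃ x y : List α, u = x ++ y ∧ v = y ++ x := by
  obtain ⟨n, hn, rfl⟩ := List.isRotated_iff_mod.1 (Cycle.coe_eq_coe.1 h)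
  exact ⟨u.take n, u.drop n, (List.take_append_drop n u).symm, List.rotate_eq_drop_append_take hn⟩

/-- Different replacements in the same circular string commute. -/
theorem replace_diamond_property {m k d₁ d₂ : ℕ} {w w₁ w₂ : Cycle Symbol}
    (h₁ : Replace m k w d₁ w₁) (h₂ : Replace m k w d₂ w₂) :
    (d₁ = d₂ ∧ w₁ = w₂) ∨ ∃ w₃, Replace m k w₁ d₂ w₃ ∧ Replace m k w₂ d₁ w₃ := by
  rw [replace_iff] at h₁ h₂
  -- It suffices to cut each of the two results open at some place such that one linear replacement
  -- leads from both to the same list.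
  have key : ∀ {a b c : List Symbol} {d d' : ℕ}, LinearReplace m k a d c →
      LinearReplace m k b d' c → ∀ {w w' : Cycle Symbol}, w = a → w' = b →
      ∃ w₃, Replace m k w d w₃ ∧ Replace m k w' d' w₃ := by
    rintro a b c d d' h h' _ _ rfl rfl
    exact ⟨c, h.replace, h'.replace⟩
  -- A division and a join never share a symbol: the signs exclude `p = p'` and `p = q'`. Only
  -- disjoint positions remain.
  have dm : ∀ (p p' q' : Symbol) (u u' : List Symbol), 0 < p.1 → 0 < p.2 → p'.2 ≤ 0 → q'.1 ≤ 0 →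
      ((p :: u : List Symbol) : Cycle Symbol) = (p' :: q' :: u' : List Symbol) →
      ∃ w₃, Replace m k (shrink m k p :: u : List Symbol) 0 w₃ ∧
        Replace m k ((p' + q') :: u' : List Symbol) 1 w₃ := by
    intro p p' q' u u' hp hp' hq hq' h
    obtain ⟨x, y, hx, hy⟩ := exists_append_of_coe_eq h
    rcases x with _ | ⟨x₀, x⟩
    · simp only [List.nil_append] at hx
      simp only [← hx, List.append_nil, List.cons.injEq] at hy
      exact absurd (hy.1 ▸ hq) (by omega)
    rcases y with _ | ⟨y₀, _ | ⟨y₁, y⟩⟩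
    · simp only [List.nil_append, List.cons.injEq] at hy
      simp only [List.cons_append, List.cons.injEq] at hx
      exact absurd ((hx.1.trans hy.1.symm) ▸ hp') (by omega)
    · simp only [List.cons_append, List.nil_append, List.cons.injEq] at hx hy
      exact absurd ((hx.1.trans hy.2.1.symm) ▸ hp) (by omega)
    · simp only [List.cons_append, List.cons.injEq] at hx hy
      obtain ⟨rfl, rfl⟩ := hx
      obtain ⟨rfl, rfl, rfl⟩ := hy
      refine key (c := shrink m k p :: (x ++ (p' + q') :: y)) (d := 0) (d' := 1)
        (LinearReplace.merge (shrink m k p :: x) y p' q' hq hq')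
        (b := p :: (x ++ (p' + q') :: y)) (LinearReplace.diamond [] _ p hp hp') rfl ?_
      exact coe_append_comm ((p' + q') :: y) (p :: x)
  rcases h₁ with ⟨p, u, hp, hp', rfl, rfl, rfl⟩ | ⟨p, q, u, hp, hp', rfl, rfl, rfl⟩ <;>
  rcases h₂ with ⟨p', u', hq, hq', h, rfl, rfl⟩ | ⟨p', q', u', hq, hq', h, rfl, rfl⟩
  · obtain ⟨x, y, hx, hy⟩ := exists_append_of_coe_eq h
    rcases x with _ | ⟨x₀, x⟩
    · simp only [List.nil_append] at hx
      simp only [← hx, List.append_nil, List.cons.injEq] at hy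
      obtain ⟨rfl, rfl⟩ := hy
      exact Or.inl ⟨rfl, rfl⟩
    rcases y with _ | ⟨y₀, y⟩
    · simp only [List.nil_append, List.append_nil] at hx hy
      rw [← hx, List.cons.injEq] at hy
      obtain ⟨rfl, rfl⟩ := hy
      exact Or.inl ⟨rfl, rfl⟩
    simp only [List.cons_append, List.cons.injEq] at hx hy
    obtain ⟨rfl, rfl⟩ := hx
    obtain ⟨rfl, rfl⟩ := hy
    refine Or.inr (key (c := shrink m k p :: (x ++ shrink m k p' :: y))
      (LinearReplace.diamond (shrink m k p :: x) y p' hq hq')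
      (b := p :: (x ++ shrink m k p' :: y)) (LinearReplace.diamond [] _ p hp hp') rfl ?_)
    exact coe_append_comm (shrink m k p' :: y) (p :: x)
  · exact Or.inr (dm p p' q' u u' hp hp' hq hq' h)
  · obtain ⟨w₃, h₁, h₂⟩ := dm p' p q u' u hq hq' hp hp' h.symm
    exact Or.inr ⟨w₃, h₂, h₁⟩
  · obtain ⟨x, y, hx, hy⟩ := exists_append_of_coe_eq h
    rcases x with _ | ⟨x₀, _ | ⟨x₁, x⟩⟩
    · simp only [List.nil_append] at hx
      simp only [← hx, List.append_nil, List.cons.injEq] at hy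
      obtain ⟨rfl, rfl, rfl⟩ := hy
      exact Or.inl ⟨rfl, rfl⟩
    -- Here the second join starts at `q`, so `p' = q`. If the circle has only two symbols, both
    -- joins use the same pair in opposite order and agree by commutativity of addition. Otherwise
    -- the joins overlap in `p p' q'`, and both results can be joined to `p + p' + q'` because the
    -- signs add up.
    · rcases y with _ | ⟨y₀, _ | ⟨y₁, y⟩⟩
      · simp at hx
      · simp only [List.cons_append, List.nil_append, List.cons.injEq] at hx hy
        obtain ⟨rfl, rfl, rfl⟩ := hx
        obtain ⟨rfl, rfl, rfl⟩ := hy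
        exact Or.inl ⟨rfl, by rw [add_comm]⟩
      · simp only [List.cons_append, List.nil_append, List.cons.injEq] at hx hy
        obtain ⟨rfl, rfl, rfl⟩ := hx
        obtain ⟨rfl, rfl, rfl⟩ := hy
        refine Or.inr (key (c := (p + p' + q') :: y)
          (LinearReplace.merge [] _ (p + p') q' (by simpa using add_nonpos hp hq) hq')
          (b := p :: (p' + q') :: y) ?_ rfl (coe_append_comm ((p' + q') :: y) [p]))
        rw [add_assoc]
        exact LinearReplace.merge [] y p (p' + q') hp (by simpa using add_nonpos hp' hq')
    · rcases y with _ | ⟨y₀, _ | ⟨y₁, y⟩⟩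
      · simp only [List.nil_append, List.append_nil] at hx hy
        simp only [← hx, List.cons.injEq] at hy
        obtain ⟨rfl, rfl, rfl⟩ := hy
        exact Or.inl ⟨rfl, rfl⟩
      · simp only [List.cons_append, List.nil_append, List.cons.injEq] at hx hy
        obtain ⟨rfl, rfl, rfl⟩ := hx
        obtain ⟨rfl, rfl, rfl⟩ := hy
        refine Or.inr (key (a := p' :: (q' + q) :: x) (c := (p' + (q' + q)) :: x)
          (LinearReplace.merge [] x p' (q' + q) hq (by simpa using add_nonpos hq' hp'))
          (b := (p' + q') :: q :: x) ?_ (coe_append_comm ((q' + q) :: x) [p']) rfl)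
        rw [← add_assoc]
        exact LinearReplace.merge [] x (p' + q') q (by simpa using add_nonpos hq hp) hp'
      · simp only [List.cons_append, List.cons.injEq] at hx hy
        obtain ⟨rfl, rfl, rfl⟩ := hx
        obtain ⟨rfl, rfl, rfl⟩ := hy
        refine Or.inr (key (c := (p + q) :: (x ++ (p' + q') :: y))
          (LinearReplace.merge ((p + q) :: x) y p' q' hq hq')
          (b := p :: q :: (x ++ (p' + q') :: y)) (LinearReplace.merge [] _ p q hp hp') rfl ?_)
        exact coe_append_comm ((p' + q') :: y) (p :: q :: x)

/-! ### Termination -/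

/-- The potential of a symbol: every replacement lowers the sum of the potentials. -/
def symbolPotential (p : Symbol) : ℕ := p.1.toNat + 1

def potential (u : List Symbol) : ℕ := (u.map symbolPotential).sum

@[simp] theorem potential_nil : potential [] = 0 := rfl

@[simp] theorem potential_cons (p : Symbol) (u : List Symbol) :
    potential (p :: u) = symbolPotential p + potential u := by simp [potential]

@[simp] theorem potential_append (u v : List Symbol) :
    potential (u ++ v) = potential u + potential v := by simp [potential]

def cyclePotential (w : Cycle Symbol) : ℕ := (w.toMultiset.map symbolPotential).sum

@[simp] theorem cyclePotential_coe (u : List Symbol) :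
    cyclePotential (u : Cycle Symbol) = potential u := by
  simp [cyclePotential, potential]

/-- A division takes `m ≥ 1` off a positive first index. A join does not increase the sum of the
positive parts, as these are subadditive, and it loses one summand `1`. -/
theorem Replace.potential_lt {m k d : ℕ} (hm : 1 ≤ m) {w w' : Cycle Symbol}
    (h : Replace m k w d w') : cyclePotential w' < cyclePotential w := by
  rw [replace_iff] at h
  rcases h with ⟨p, u, h, h', rfl, rfl, rfl⟩ | ⟨p, q, u, h, h', rfl, rfl, rfl⟩
  · simp only [cyclePotential_coe, potential_cons, symbolPotential, shrink]; omega
  · simp only [cyclePotential_coe, potential_cons, symbolPotential, Prod.fst_add]; omega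

theorem no_infinite_replacement {m k : ℕ} (hm : 1 ≤ m) (f : ℕ → Cycle Symbol) :
    ¬ ∀ n, ∃ d, Replace m k (f n) d (f (n + 1)) := by
  intro h
  have : StrictAnti fun n => cyclePotential (f n) :=
    strictAnti_nat_of_succ_lt fun n => (h n).choose_spec.potential_lt hm
  exact not_strictAnti_of_wellFoundedLT _ this

theorem Replaces.head {m k d g : ℕ} {w w' w'' : Cycle Symbol} (h : Replace m k w d w')
    (h' : Replaces m k w' g w'') : Replaces m k w (d + g) w'' := by
  induction h' with
  | refl => simpa using (Replaces.refl w).tail h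
  | tail _ hr ih => rw [← add_assoc]; exact ih.tail hr

theorem Replaces.cases_head {m k g : ℕ} {w w' : Cycle Symbol} (h : Replaces m k w g w') :
    (g = 0 ∧ w = w') ∨ ∃ d g' w₁, g = d + g' ∧ Replace m k w d w₁ ∧ Replaces m k w₁ g' w' := by
  induction h with
  | refl => exact Or.inl ⟨rfl, rfl⟩
  | @tail w₂ w₃ g d h hr ih =>
    right
    rcases ih with ⟨rfl, rfl⟩ | ⟨d', g', w₁, rfl, h₁, h₂⟩
    · exact ⟨d, 0, w₃, by simp, hr, Replaces.refl _⟩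
    · exact ⟨d', g' + d, w₁, by omega, h₁, h₂.tail hr⟩

theorem Replaces.trans {m k g g' : ℕ} {w w' w'' : Cycle Symbol} (h : Replaces m k w g w')
    (h' : Replaces m k w' g' w'') : Replaces m k w (g + g') w'' := by
  induction h' with
  | refl => exact h
  | tail _ hr ih => rw [← add_assoc]; exact ih.tail hr

theorem exists_maximalApplication {m : ℕ} (hm : 1 ≤ m) (k : ℕ) (w : Cycle Symbol) :
    ∃ g w', MaximalApplication m k w g w' := by
  induction hn : cyclePotential w using Nat.strong_induction_on generalizing w with
  | _ n ih =>
    subst hn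
    by_cases h : ∃ d w₁, Replace m k w d w₁
    · obtain ⟨d, w₁, h⟩ := h
      obtain ⟨g, w', h', hi⟩ := ih _ (h.potential_lt hm) w₁ rfl
      exact ⟨d + g, w', h'.head h, hi⟩
    · exact ⟨0, w, Replaces.refl w, fun d w₁ h' => h ⟨d, w₁, h'⟩⟩

/-- Any possible first step can be moved to the front of a given maximal application. If it differs
from the actual first step, the diamond property closes the square, and the induction hypothesis
moves the other side of the square to the front of the remaining sequence. -/
theorem maximalApplication_of_replace {m k d g : ℕ} (hm : 1 ≤ m) {w w₁ w' : Cycle Symbol}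
    (h : MaximalApplication m k w g w') (h₁ : Replace m k w d w₁) :
    ∃ g₁, g = d + g₁ ∧ MaximalApplication m k w₁ g₁ w' := by
  induction hn : cyclePotential w using Nat.strong_induction_on generalizing w g d w₁ with
  | _ n ih =>
    subst hn
    obtain ⟨h, hi⟩ := h
    rcases h.cases_head with ⟨rfl, rfl⟩ | ⟨d₂, g₂, w₂, rfl, h₂, h₂'⟩
    · exact absurd h₁ (hi _ _)
    · rcases replace_diamond_property h₁ h₂ with ⟨rfl, rfl⟩ | ⟨w₃, h₃, h₄⟩
      · exact ⟨g₂, rfl, h₂', hi⟩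
      · obtain ⟨g₁, rfl, h₅, _⟩ := ih _ (h₂.potential_lt hm) ⟨h₂', hi⟩ h₄ rfl
        exact ⟨d₂ + g₁, by omega, h₅.head h₃, hi⟩

theorem maximalApplication_unique {m k g g' : ℕ} (hm : 1 ≤ m) {w w₁ w₂ : Cycle Symbol}
    (h : MaximalApplication m k w g w₁) (h' : MaximalApplication m k w g' w₂) : g = g' := by
  induction hn : cyclePotential w using Nat.strong_induction_on generalizing w g g' with
  | _ n ih =>
    subst hn
    rcases h.1.cases_head with ⟨rfl, rfl⟩ | ⟨d, g₂, w₃, rfl, h₂, h₃⟩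
    · rcases h'.1.cases_head with ⟨rfl, rfl⟩ | ⟨d, g₂, w₃, rfl, h₂, h₃⟩
      · rfl
      · exact absurd h₂ (h.2 _ _)
    · obtain ⟨g₁, rfl, h₄⟩ := maximalApplication_of_replace hm h' h₂
      rw [ih _ (h₂.potential_lt hm) ⟨h₃, h.2⟩ h₄ rfl]

/-! ### The number of new groups as an invariant -/

open Classical in
/-- The number of new groups that every maximal application of the rules creates. -/
noncomputable def newGroups (m k : ℕ) (w : Cycle Symbol) : ℕ :=
  if h : ∃ g w', MaximalApplication m k w g w' then h.choose else 0

theorem newGroups_eq {m k g : ℕ} (hm : 1 ≤ m) {w w' : Cycle Symbol}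
    (h : MaximalApplication m k w g w') : newGroups m k w = g := by
  have h₁ : ∃ g w', MaximalApplication m k w g w' := ⟨g, w', h⟩
  rw [newGroups, dif_pos h₁]
  obtain ⟨w₂, h₂⟩ := h₁.choose_spec
  exact maximalApplication_unique hm h₂ h

/-- This allows the rules to be used in both directions: strings connected by replacements and
inverse replacements have comparable `newGroups`, although only forward sequences were defined. -/
theorem newGroups_of_replace {m k d : ℕ} (hm : 1 ≤ m) {w w' : Cycle Symbol}
    (h : Replace m k w d w') : newGroups m k w = d + newGroups m k w' := by
  obtain ⟨g, w₁, h'⟩ := exists_maximalApplication hm k w'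
  rw [newGroups_eq hm h', newGroups_eq hm ⟨h'.1.head h, h'.2⟩]

theorem newGroups_of_linear {m k d : ℕ} (hm : 1 ≤ m) {u u' : List Symbol}
    (h : LinearReplace m k u d u') :
    newGroups m k (u : Cycle Symbol) = d + newGroups m k (u' : Cycle Symbol) :=
  newGroups_of_replace hm h.replace

/-- A list that starts with a `1`-like and ends with a `0`-like edge has a redex. -/
theorem exists_linearReplace (m k : ℕ) (p : Symbol) (u : List Symbol) (hp : 0 < p.1)
    (hu : ∀ q ∈ (p :: u).getLast?, 0 < q.2) :
    ∃ d q u', LinearReplace m k (p :: u) d (q :: u') := by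
  induction u generalizing p with
  | nil => exact ⟨1, _, _, LinearReplace.diamond [] [] p hp (hu p rfl)⟩
  | cons q u ih =>
    by_cases h : 0 < p.2
    · exact ⟨1, _, _, LinearReplace.diamond [] _ p hp h⟩
    · by_cases h' : 0 < q.1
      · obtain ⟨d, q', u', h''⟩ := ih q h' (by simpa using hu)
        exact ⟨d, p, q' :: u', by simpa using h''.append [p] []⟩
      · exact ⟨0, _, _, LinearReplace.merge [] u p q (by omega) (by omega)⟩

/-- A group of `m` empty sites and `k` cars may be inserted anywhere. -/
theorem newGroups_insert {m : ℕ} (hm : 1 ≤ m) (k : ℕ) (x y : List Symbol) (h : x ++ y ≠ []) :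
    newGroups m k ((x ++ (0, 0) :: y : List Symbol) : Cycle Symbol) =
      newGroups m k ((x ++ y : List Symbol) : Cycle Symbol) := by
  -- The neutral symbol is absorbed by its right neighbour if `p.1 ≤ 0`, and by its left neighbour,
  -- which is the last symbol of the circle, if that one has a nonpositive second index. Otherwise
  -- the rest of the string has a redex that avoids the neutral symbol. Performing it in both
  -- strings gives the same `Δg` and a smaller potential.
  have key : ∀ (p : Symbol) (u : List Symbol),
      newGroups m k (((0, 0) :: p :: u : List Symbol) : Cycle Symbol) =
        newGroups m k ((p :: u : List Symbol) : Cycle Symbol) := by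
    intro p u
    induction hn : potential (p :: u) using Nat.strong_induction_on generalizing p u with
    | _ n ih =>
      subst hn
      by_cases hp : p.1 ≤ 0
      · simpa [show ((0, 0) : Symbol) = 0 from rfl] using
          newGroups_of_linear (k := k) hm (LinearReplace.merge [] u (0, 0) p le_rfl hp)
      · by_cases hl : ∀ q ∈ (p :: u).getLast?, 0 < q.2
        · obtain ⟨d, q, u', h⟩ := exists_linearReplace m k p u (by omega) hl
          have h₁ := h.append [(0, 0)] []
          simp only [List.append_nil, List.cons_append, List.nil_append] at h₁
          rw [newGroups_of_linear hm h₁, newGroups_of_linear hm h, ih _ ?_ q u' rfl]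
          simpa using h.replace.potential_lt hm
        · push Not at hl
          obtain ⟨q, hq, hq'⟩ := hl
          obtain ⟨v, hv⟩ := List.getLast?_eq_some_iff.1 (Option.mem_def.1 hq)
          rw [hv]
          have := newGroups_of_linear (k := k) hm (LinearReplace.merge v [] q (0, 0) hq' le_rfl)
          rw [show v ++ q :: [(0, 0)] = (v ++ [q]) ++ [(0, 0)] by simp, coe_append_comm] at this
          simpa [show ((0, 0) : Symbol) = 0 from rfl] using this
  rw [coe_append_comm x, coe_append_comm x]
  obtain ⟨p, u, hu⟩ := List.exists_cons_of_ne_nil (l := y ++ x) (by simpa [and_comm] using h)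
  rw [List.cons_append, hu]
  exact key p u

/-! ### The time step on strings of symbols -/

/-- Concatenate `f p q` over all pairs of neighbours `p, q` of the list `p₀ :: t`. -/
def linkFrom {α β : Type*} (f : α → α → List β) : α → List α → List β
  | _, [] => []
  | p, q :: t => f p q ++ linkFrom f q t

/-- Concatenate `f p q` over all pairs of neighbours of a circular list. -/
def link {α β : Type*} (f : α → α → List β) : List α → List β
  | [] => []
  | p :: t => linkFrom f p (t ++ [p])

theorem linkFrom_split {α β : Type*} (F G : α → List β) (p q : α) (t : List α) :
    G p ++ linkFrom (fun p q => F p ++ G q) p (t ++ [q]) =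
      (p :: t).flatMap (fun p => G p ++ F p) ++ G q := by
  induction t generalizing p with
  | nil => simp [linkFrom]
  | cons q' t ih =>
    have := ih q'
    simp only [List.flatMap_cons, List.cons_append, linkFrom, List.append_assoc] at this ⊢
    rw [this]

theorem map_linkFrom {α β γ : Type*} (f : α → α → List β) (g : β → γ) (p : α) (t : List α) :
    (linkFrom f p t).map g = linkFrom (fun p q => (f p q).map g) p t := by
  induction t generalizing p with
  | nil => rfl
  | cons q t ih => simp [linkFrom, ih]

theorem flatMap_linkFrom {α β γ : Type*} (f : α → α → List β) (g : β → List γ) (p : α)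
    (t : List α) : (linkFrom f p t).flatMap g = linkFrom (fun p q => (f p q).flatMap g) p t := by
  induction t generalizing p with
  | nil => rfl
  | cons q t ih => simp [linkFrom, ih]

/-- What a group hands over to the group behind it in a time step, without new cars or sites. -/
def leftPart (p : Symbol) : Symbol := if 0 < p.1 then 0 else (p.1, max p.2 0)

/-- The mirror image of `leftPart`: the surplus of empty sites and the deficit of cars go to the new
group in front, while the deficit of empty sites and the surplus of cars go to the new group behind.
If there is a surplus of both, it forms a group of its own, the `core`. -/
def rightPart (p : Symbol) : Symbol := if 0 < p.2 then 0 else (max p.1 0, p.2)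

/-- What remains of a group between the two parts. -/
def core (m k : ℕ) (p : Symbol) : List Symbol :=
  if 0 < p.1 ∧ 0 < p.2 then [shrink m k p] else []

/-- The time step on a circular string of symbols. -/
def stepString (m k : ℕ) (u : List Symbol) : List Symbol :=
  link (fun p q => core m k p ++ [rightPart p + leftPart q]) u

/-- The number of groups that are divided in the next time step. -/
def diamonds (u : List Symbol) : ℕ := u.countP fun p => decide (0 < p.1 ∧ 0 < p.2)

theorem rightPart_snd_nonpos (p : Symbol) : (rightPart p).2 ≤ 0 := by
  unfold rightPart; split_ifs <;> simp; omega

theorem leftPart_fst_nonpos (p : Symbol) : (leftPart p).1 ≤ 0 := by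
  unfold leftPart; split_ifs <;> simp; omega

/-- By kinds: a `◇` is divided, and two neutral symbols are put around the remainder; a `0` or a `1`
gets one neutral symbol before or behind it; a `⋆` is the join of its two parts, read backwards. -/
theorem newGroups_parts {m : ℕ} (hm : 1 ≤ m) (k : ℕ) (p : Symbol) (x y : List Symbol) :
    newGroups m k ((x ++ (leftPart p :: (core m k p ++ [rightPart p])) ++ y : List Symbol) :
      Cycle Symbol) + diamonds [p] = newGroups m k ((x ++ p :: y : List Symbol) : Cycle Symbol) := by
  by_cases h1 : 0 < p.1 <;> by_cases h2 : 0 < p.2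
  · have e1 := newGroups_insert hm k x (shrink m k p :: (0, 0) :: y) (by simp)
    have e2 := newGroups_insert hm k (x ++ [shrink m k p]) y (by simp)
    have e3 := newGroups_of_linear hm (LinearReplace.diamond (m := m) (k := k) x y p h1 h2)
    simp only [List.append_assoc, List.cons_append, List.nil_append] at e1 e2
    simp only [leftPart, core, rightPart, h1, h2, and_self, if_true, diamonds, List.append_assoc,
      List.cons_append, List.nil_append, List.countP_cons, List.countP_nil, decide_true]
    rw [e3, ← e2, ← e1, add_comm]; rfl
  · have e1 := newGroups_insert hm k x (p :: y) (by simp)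
    have e2 : rightPart p = p := by simp [rightPart, h2, max_eq_left h1.le]
    rw [e2, ← e1]
    simp [leftPart, core, diamonds, h1, h2]; rfl
  · have e1 := newGroups_insert hm k (x ++ [p]) y (by simp)
    have e2 : leftPart p = p := by simp [leftPart, h1, max_eq_left h2.le]
    rw [e2]
    simp only [List.append_assoc, List.cons_append, List.nil_append] at e1
    rw [← e1]
    simp [rightPart, core, diamonds, h1, h2]; rfl
  · have e1 := newGroups_of_linear hm (LinearReplace.merge (m := m) (k := k) x y (leftPart p)
      (rightPart p) (by simp [leftPart, h1]; omega) (by simp [rightPart, h2]; omega))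
    have e2 : leftPart p + rightPart p = p := by
      simp [leftPart, rightPart, h1, h2, max_eq_right (not_lt.1 h1), max_eq_right (not_lt.1 h2)]
    rw [e2] at e1
    simpa [core, diamonds, h1, h2] using e1

theorem newGroups_flatMap_parts {m : ℕ} (hm : 1 ≤ m) (k : ℕ) (x u : List Symbol) :
    newGroups m k ((x ++ u.flatMap (fun p => leftPart p :: (core m k p ++ [rightPart p])) :
      List Symbol) : Cycle Symbol) + diamonds u =
      newGroups m k ((x ++ u : List Symbol) : Cycle Symbol) := by
  induction u generalizing x with
  | nil => simp [diamonds]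
  | cons p u ih =>
    have h1 := ih (x ++ leftPart p :: (core m k p ++ [rightPart p]))
    have h2 := newGroups_parts hm k p x u
    have h3 : diamonds (p :: u) = diamonds u + diamonds [p] := by
      simp only [diamonds, List.countP_cons, List.countP_nil]; omega
    rw [h3, ← h2, ← h1]
    simp only [List.flatMap_cons, List.append_assoc]; omega

/-- Second half of a time step: each right part is joined with the left part that follows it. The
signs of the parts always permit this join, and it creates no group. -/
theorem newGroups_linkFrom {m : ℕ} (hm : 1 ≤ m) (k : ℕ) (p : Symbol) (x t : List Symbol) :
    newGroups m k ((x ++ linkFrom (fun p q => (core m k p ++ [rightPart p]) ++ [leftPart q]) p t :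
      List Symbol) : Cycle Symbol) =
    newGroups m k ((x ++ linkFrom (fun p q => core m k p ++ [rightPart p + leftPart q]) p t :
      List Symbol) : Cycle Symbol) := by
  induction t generalizing x p with
  | nil => rfl
  | cons q t ih =>
    have h1 := ih q (x ++ (core m k p ++ [rightPart p + leftPart q]))
    have h2 := newGroups_of_linear hm (LinearReplace.merge (m := m) (k := k) (x ++ core m k p)
      (linkFrom (fun p q => (core m k p ++ [rightPart p]) ++ [leftPart q]) q t) _ _
      (rightPart_snd_nonpos p) (leftPart_fst_nonpos q))
    simp only [linkFrom, List.append_assoc, List.cons_append, List.nil_append, zero_add] at h1 h2 ⊢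
    rw [h2, h1]

/-- Every group that is divided in a time step takes one off the new groups still to come. -/
theorem newGroups_stepString {m : ℕ} (hm : 1 ≤ m) (k : ℕ) (u : List Symbol) :
    newGroups m k (stepString m k u : Cycle Symbol) + diamonds u =
      newGroups m k (u : Cycle Symbol) := by
  cases u with
  | nil => simp [stepString, link, diamonds]
  | cons p t =>
    have h1 := newGroups_linkFrom hm k p [] (t ++ [p])
    -- The sequence of all parts can be read symbol by symbol or boundary by boundary. The two
    -- readings differ by rotating the first left part to the end, which the circular string does
    -- not see.
    have h2 := linkFrom_split (fun p => core m k p ++ [rightPart p]) (fun p => [leftPart p]) p p t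
    have h3 := newGroups_flatMap_parts hm k [] (p :: t)
    simp only [List.nil_append] at h1 h3
    rw [stepString, link, ← h1, ← h3]
    congr 2
    generalize linkFrom _ p _ = X at h2
    simp only [List.flatMap_cons, List.cons_append, List.nil_append, List.cons.injEq, true_and] at h2
    rw [h2, coe_append_comm]
    simp

/-- Each symbol contributes one boundary to its successor, and a `◇` also its core. Together with
`newGroups_stepString` this makes the length plus `newGroups` a conserved quantity. -/
theorem length_stepString (m k : ℕ) (u : List Symbol) :
    (stepString m k u).length = u.length + diamonds u := by
  have key : ∀ (p : Symbol) (t : List Symbol) (q : Symbol),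
      (linkFrom (fun p q => core m k p ++ [rightPart p + leftPart q]) p (t ++ [q])).length =
        (p :: t).length + diamonds (p :: t) := by
    intro p t q
    induction t generalizing p with
    | nil =>
      by_cases h : 0 < p.1 ∧ 0 < p.2 <;> simp [linkFrom, diamonds, core, h]
    | cons q' t ih =>
      have := ih q'
      by_cases h : 0 < p.1 ∧ 0 < p.2 <;>
        simp [linkFrom, diamonds, core, h, List.countP_cons] at this ⊢ <;> omega
  cases u with
  | nil => rfl
  | cons p t => exact key p t p

/-! ### Roads and strings -/

/-- The values of a function on the sites `r, r+1, …` of the road. -/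
def readFrom {α : Type*} {L : ℕ} (F : ZMod L → α) (r : ZMod L) : List α :=
  (List.range L).map fun j : ℕ => F (r + (j : ZMod L))

section readFrom

variable {α : Type*} {L : ℕ}

@[simp] theorem length_readFrom (F : ZMod L → α) (r : ZMod L) : (readFrom F r).length = L := by
  simp [readFrom]

theorem getElem_readFrom (F : ZMod L → α) (r : ZMod L) (n : ℕ) (h : n < (readFrom F r).length) :
    (readFrom F r)[n] = F (r + (n : ZMod L)) := by
  simp [readFrom]

theorem readFrom_add (F : ZMod L → α) (r : ZMod L) (n : ℕ) :
    readFrom F (r + (n : ZMod L)) = (readFrom F r).rotate n := by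
  apply List.ext_getElem
  · simp
  · intro i h _
    rw [List.getElem_rotate, getElem_readFrom, getElem_readFrom, length_readFrom, ZMod.natCast_mod]
    push_cast
    congr 1; ring

theorem readFrom_add_length {F : ZMod L → α} {r : ZMod L} {x y : List α}
    (h : readFrom F r = x ++ y) : readFrom F (r + (x.length : ZMod L)) = y ++ x := by
  rw [readFrom_add, h, List.rotate_append_length_eq]

theorem readFrom_isRotated [NeZero L] (F : ZMod L → α) (r r' : ZMod L) :
    readFrom F r ~r readFrom F r' := by
  refine ⟨(r' - r).val, ?_⟩
  rw [← readFrom_add, ZMod.natCast_zmod_val, add_sub_cancel]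

theorem exists_readFrom_of_isRotated {F : ZMod L → α} {r : ZMod L} {l : List α}
    (h : readFrom F r ~r l) : ∃ r', readFrom F r' = l := by
  obtain ⟨n, rfl⟩ := h
  exact ⟨_, readFrom_add F r n⟩

theorem sum_readFrom [NeZero L] [AddCommMonoid α] (F : ZMod L → α) (r : ZMod L) :
    (readFrom F r).sum = ∑ i, F i := by
  obtain ⟨n, rfl⟩ := Nat.exists_eq_succ_of_ne_zero (NeZero.ne L)
  have h : (readFrom F r).Perm (readFrom F 0) := (readFrom_isRotated F r 0).perm
  have h' : readFrom F 0 = List.ofFn fun i : Fin (n + 1) => F i := by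
    apply List.ext_getElem
    · simp
    · intro i hi hi'
      rw [getElem_readFrom, List.getElem_ofFn, zero_add]
      congr 1
      exact Fin.natCast_eq_mk (by simpa using hi)
  rw [h.sum_eq, h', List.sum_ofFn]; rfl

end readFrom

section run

variable {L : ℕ} {s : Road L} {v : Bool} {i : ZMod L}

theorem run_eq_takeWhile (s : Road L) (v : Bool) (i : ZMod L) :
    run s v i = ((readFrom s i).takeWhile fun b => b == v).length := by
  simp only [run, readFrom, List.takeWhile_map, List.length_map, List.pure_def, List.bind_eq_flatMap,
    ← List.map_eq_flatMap]
  rfl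

theorem run_eq_of_readFrom {n : ℕ} {l : List Bool} (h : readFrom s i = List.replicate n v ++ l)
    (hl : l.head? ≠ some v) : run s v i = n := by
  rw [run_eq_takeWhile, h, List.takeWhile_append_of_pos (by simp)]
  cases l with
  | nil => simp
  | cons a l =>
    have : a ≠ v := by simpa using hl
    simp [this]

theorem run_le_of_ne {n : ℕ} (h : s (i + (n : ZMod L)) ≠ v) : run s v i ≤ n := by
  by_contra hlt
  push Not at hlt
  rw [run_eq_takeWhile] at hlt
  have h1 := List.mem_takeWhile_imp (List.getElem_mem hlt)
  have h2 : ((readFrom s i).takeWhile fun b => b == v)[n] = (readFrom s i)[n]'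
      (hlt.trans_le (List.takeWhile_sublist _).length_le) := by
    simp [List.takeWhile_eq_take_findIdx_not]
  rw [h2, getElem_readFrom] at h1
  exact h (by simpa using h1)

theorem run_pos [NeZero L] (h : s i = v) : 0 < run s v i := by
  obtain ⟨n, rfl⟩ := Nat.exists_eq_succ_of_ne_zero (NeZero.ne L)
  rw [run, List.range_succ_eq_map]
  simp [h]

end run

/-! ### Roads as words of alternating blocks -/

/-- `x` sites with value `c` and then `y` sites with the other value, for each pair `(x, y)`. -/
def twoBlock (c : Bool) (b : ℕ × ℕ) : List Bool :=
  List.replicate b.1 c ++ List.replicate b.2 !c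

def twoWord (c : Bool) (bs : List (ℕ × ℕ)) : List Bool := bs.flatMap (twoBlock c)

@[simp] theorem length_twoBlock (c : Bool) (b : ℕ × ℕ) : (twoBlock c b).length = b.1 + b.2 := by
  simp [twoBlock]

/-- The road reads `l` from site `r` on, and all blocks are nonempty. -/
def Blocks {L : ℕ} (s : Road L) (c : Bool) (r : ZMod L) (bs : List (ℕ × ℕ)) : Prop :=
  readFrom s r = twoWord c bs ∧ ∀ b ∈ bs, 0 < b.1 ∧ 0 < b.2

section Blocks

variable {L : ℕ} {s : Road L} {c : Bool} {r : ZMod L}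

/-- By rotation every block pair may be taken as the first one, so local facts have to be proved
only at the start of the list. -/
theorem Blocks.rotate {bs bs' : List (ℕ × ℕ)} (h : Blocks s c r (bs ++ bs')) :
    Blocks s c (r + ((twoWord c bs).length : ZMod L)) (bs' ++ bs) := by
  refine ⟨?_, fun b hb => h.2 b (by simpa [or_comm] using hb)⟩
  have := h.1
  rw [twoWord, List.flatMap_append] at this
  rw [twoWord, twoWord, List.flatMap_append]
  exact readFrom_add_length this

/-- Compute the values of a function on all sites from its values on the first two blocks. -/
theorem Blocks.readFrom_eq {β : Type*} {bs : List (ℕ × ℕ)} (h : Blocks s c r bs)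
    (F : ZMod L → β) (G : ℕ × ℕ → List β)
    (hG : ∀ r b l, Blocks s c r (b :: l) →
      ((List.range (b.1 + b.2)).map fun t : ℕ => F (r + (t : ZMod L))) = G b) :
    readFrom F r = bs.flatMap G := by
  have key : ∀ bs' bs'' : List (ℕ × ℕ), bs = bs'' ++ bs' →
      ((List.range (twoWord c bs').length).map fun t : ℕ =>
        F (r + ((twoWord c bs'').length : ZMod L) + (t : ZMod L))) = bs'.flatMap G := by
    intro bs'
    induction bs' with
    | nil => intro _ _; simp [twoWord]
    | cons b bs' ih =>
      intro bs'' hbs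
      subst hbs
      have h1 := hG _ _ _ h.rotate
      have h2 := ih (bs'' ++ [b]) (by simp)
      rw [List.flatMap_cons, ← h2, ← h1]
      simp only [twoWord, List.flatMap_cons, List.length_append, length_twoBlock, List.range_add,
        List.map_append, List.map_map, List.flatMap_append, List.flatMap_nil, List.append_nil]
      congr 1
      apply List.map_congr_left
      intro t _
      simp only [Function.comp]
      congr 1
      push_cast; ring
  have h1 := key bs [] rfl
  have h2 : (twoWord c bs).length = L := by rw [← h.1]; simp
  rw [h2] at h1
  simpa [twoWord, readFrom] using h1

theorem Blocks.first {x y : ℕ} {l : List (ℕ × ℕ)} (h : Blocks s c r ((x, y) :: l)) {t : ℕ}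
    (ht : t < x) : s (r + (t : ZMod L)) = c ∧ run s c (r + (t : ZMod L)) = x - t := by
  have h1 : readFrom s r = List.replicate t c ++ (List.replicate (x - t) c ++
      (List.replicate y (!c) ++ twoWord c l)) := by
    rw [h.1, twoWord, List.flatMap_cons, twoBlock]
    conv_lhs => rw [show x = t + (x - t) by omega, List.replicate_add]
    simp only [twoWord, List.append_assoc]
  have h2 := readFrom_add_length h1
  rw [List.length_replicate, List.append_assoc] at h2
  have hy := (h.2 (x, y) (by simp)).2
  obtain ⟨y, rfl⟩ := Nat.exists_eq_succ_of_ne_zero hy.ne'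
  obtain ⟨n, hn⟩ := Nat.exists_eq_succ_of_ne_zero (show x - t ≠ 0 by omega)
  refine ⟨?_, run_eq_of_readFrom h2 (by simp [List.replicate_succ])⟩
  have hL : 0 < L := by
    have := congrArg List.length h1
    simp at this; omega
  have h3 : (readFrom s (r + (t : ZMod L)))[0]? = some c := by
    rw [h2, hn, List.replicate_succ]; rfl
  rw [List.getElem?_eq_getElem (by simpa using hL), getElem_readFrom] at h3
  simpa using h3

theorem Blocks.second {x y : ℕ} {l : List (ℕ × ℕ)} (h : Blocks s c r ((x, y) :: l)) :
    (∀ t < y, s (r + (x : ZMod L) + (t : ZMod L)) = !c) ∧ run s (!c) (r + (x : ZMod L)) = y := by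
  have h1 : readFrom s r = List.replicate x c ++ (List.replicate y (!c) ++ twoWord c l) := by
    rw [h.1, twoWord, List.flatMap_cons, twoBlock, List.append_assoc]; rfl
  have h2 := readFrom_add_length h1
  rw [List.length_replicate, List.append_assoc] at h2
  have hx := (h.2 (x, y) (by simp)).1
  have hh : (twoWord c l ++ List.replicate x c).head? = some c := by
    cases l with
    | nil =>
      obtain ⟨x, rfl⟩ := Nat.exists_eq_succ_of_ne_zero hx.ne'
      simp [twoWord, List.replicate_succ]
    | cons b l =>
      have := (h.2 b (by simp)).1
      obtain ⟨n, hn⟩ := Nat.exists_eq_succ_of_ne_zero this.ne'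
      simp [twoWord, twoBlock, hn, List.replicate_succ]
  refine ⟨fun t ht => ?_, run_eq_of_readFrom h2 (by rw [hh]; simp)⟩
  have hL : t < L := by
    have := congrArg List.length h1
    simp at this; omega
  have h3 : (readFrom s (r + (x : ZMod L)))[t]? = some (!c) := by
    rw [h2, List.getElem?_append_left (by simpa using ht)]; simp [ht]
  rw [List.getElem?_eq_getElem (by simpa using hL), getElem_readFrom] at h3
  simpa using h3

theorem Blocks.length_le {x y : ℕ} {l : List (ℕ × ℕ)} (h : Blocks s c r ((x, y) :: l)) :
    x + y ≤ L := by
  have := congrArg List.length h.1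
  simp only [length_readFrom, twoWord, List.flatMap_cons, List.length_append,
    length_twoBlock] at this
  omega

theorem Blocks.last {bs : List (ℕ × ℕ)} (h : Blocks s c r bs) (hbs : bs ≠ []) :
    s (r - 1) = !c := by
  obtain ⟨bs', ⟨x, y⟩, rfl⟩ := List.eq_nil_or_concat bs |>.resolve_left hbs
  have h1 := (Blocks.rotate (by simpa using h)).second.1
  have hb := h.2 (x, y) (by simp)
  have h2 := h1 (y - 1) (by omega)
  have h3 : twoWord c bs' ++ twoBlock c (x, y) = readFrom s r := by
    rw [h.1]; simp [twoWord]
  have h4 := congrArg List.length h3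
  rw [List.length_append, length_twoBlock, length_readFrom] at h4
  rw [← h2]
  congr 1
  have h5 : (((twoWord c bs').length + (x + (y - 1)) + 1 : ℕ) : ZMod L) = 0 := by
    rw [show (twoWord c bs').length + (x + (y - 1)) + 1 = L by simp at h4; omega]; simp
  push_cast at h5
  linear_combination -h5

end Blocks

/-! ### One time step on the road -/

/-- The result of one time step on `x` cars followed by `y` empty sites. -/
def movedBlock (m k : ℕ) (b : ℕ × ℕ) : List Bool :=
  List.replicate (b.1 - min k b.1) true ++ List.replicate (min m b.2) false ++
    List.replicate (min k b.1) true ++ List.replicate (b.2 - min m b.2) false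

section

variable {L : ℕ} {s : Road L} {r : ZMod L}

theorem Blocks.displacement_first {x y m k : ℕ} {l : List (ℕ × ℕ)}
    (h : Blocks s true r ((x, y) :: l)) {t : ℕ} (ht : t < x) :
    displacement m k s (r + (t : ZMod L)) = if x - t ≤ k then min m y else 0 := by
  obtain ⟨h1, h2⟩ := h.first ht
  have h3 : r + (t : ZMod L) + ((x - t : ℕ) : ZMod L) = r + (x : ZMod L) := by
    rw [Nat.cast_sub ht.le]; ring
  have h4 := h.second.2
  rw [Bool.not_true] at h4
  simp only [displacement, h1, h2, h3, h4, true_and]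

theorem Blocks.displacement_second {x y m k : ℕ} {l : List (ℕ × ℕ)}
    (h : Blocks s true r ((x, y) :: l)) {t : ℕ} (ht : t < y) :
    displacement m k s (r + (x : ZMod L) + (t : ZMod L)) = 0 := by
  have h1 := h.second.1 t ht
  simp [displacement, h1]

variable [NeZero L]

/-- No car drives past a site in front of which a `10` boundary lies. -/
theorem Blocks.add_displacement_lt {b : ℕ × ℕ} {l : List (ℕ × ℕ)} {m k : ℕ}
    (h : Blocks s true r (b :: l)) {c : ℕ} (hc : c < L) (hs : s (r + (c : ZMod L)) = true) :
    c + displacement m k s (r + (c : ZMod L)) < L := by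
  obtain ⟨x, y⟩ := b
  have hx := (h.2 (x, y) (by simp)).1
  have h0 := (h.first hx).1
  have h1 := h.last (by simp)
  have h2 : run s true (r + (c : ZMod L)) ≤ L - 1 - c := by
    apply run_le_of_ne
    have : r + (c : ZMod L) + ((L - 1 - c : ℕ) : ZMod L) = r - 1 := by
      rw [Nat.cast_sub (by omega), Nat.cast_sub (NeZero.one_le)]; simp; ring
    rw [this, h1]; simp
  have h3 := run_pos hs
  rw [displacement]
  split_ifs with hd
  · have h4 : run s false (r + (c : ZMod L) + (run s true (r + (c : ZMod L)) : ZMod L)) ≤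
        L - (c + run s true (r + (c : ZMod L))) := by
      apply run_le_of_ne
      have : r + (c : ZMod L) + (run s true (r + (c : ZMod L)) : ZMod L) +
          ((L - (c + run s true (r + (c : ZMod L))) : ℕ) : ZMod L) = r + ((0 : ℕ) : ZMod L) := by
        rw [Nat.cast_sub (by omega)]; push_cast; simp
      rw [this, h0]; simp
    omega
  · omega

theorem Blocks.step_eq {x y m k : ℕ} {l : List (ℕ × ℕ)} (h : Blocks s true r ((x, y) :: l))
    {t : ℕ} (ht : t < x + y) : step m k s (r + (t : ZMod L)) =
      decide (t < x - min k x ∨ x - min k x + min m y ≤ t ∧ t < x + min m y) := by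
  have hL := h.length_le
  rw [step]
  congr 1
  apply propext
  constructor
  · rintro ⟨i, hi, hj⟩
    obtain ⟨c, hc, rfl⟩ : ∃ c : ℕ, c < L ∧ i = r + (c : ZMod L) :=
      ⟨(i - r).val, ZMod.val_lt _, by rw [ZMod.natCast_zmod_val]; ring⟩
    -- Seen from the start of a block of cars, no car crosses the cut of the circle. The equation
    -- between sites in `ZMod L` is therefore an equation between natural numbers below `L`.
    have hlt := h.add_displacement_lt (m := m) (k := k) hc hi
    have hct : c + displacement m k s (r + (c : ZMod L)) = t := by
      have : ((c + displacement m k s (r + (c : ZMod L)) : ℕ) : ZMod L) = (t : ZMod L) := by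
        push_cast; linear_combination hj
      rw [ZMod.natCast_eq_natCast_iff', Nat.mod_eq_of_lt hlt, Nat.mod_eq_of_lt (by omega)] at this
      exact this
    rcases lt_or_ge c x with hcx | hcx
    · rw [h.displacement_first hcx] at hct
      split_ifs at hct <;> omega
    · have h1 := h.second.1 (c - x) (by omega)
      rw [Nat.cast_sub hcx] at h1
      rw [show r + (x : ZMod L) + ((c : ZMod L) - x) = r + (c : ZMod L) by ring, hi] at h1
      simp at h1
  · intro ht'
    rcases ht' with ht' | ht'
    · refine ⟨r + (t : ZMod L), (h.first (by omega)).1, ?_⟩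
      rw [h.displacement_first (by omega), if_neg (by omega)]; simp
    · have : t - min m y < x := by omega
      refine ⟨r + ((t - min m y : ℕ) : ZMod L), (h.first this).1, ?_⟩
      rw [h.displacement_first this, if_pos (by omega), Nat.cast_sub (by omega)]; ring

theorem Blocks.readFrom_step {m k : ℕ} {bs : List (ℕ × ℕ)} (h : Blocks s true r bs) :
    readFrom (step m k s) r = bs.flatMap (movedBlock m k) := by
  apply h.readFrom_eq
  rintro r ⟨x, y⟩ l h
  apply List.ext_getElem
  · simp [movedBlock]; omega
  · intro t ht ht'
    simp only [List.length_map, List.length_range] at ht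
    simp only [List.getElem_map, List.getElem_range]
    rw [h.step_eq ht]
    simp only [movedBlock, List.getElem_append, List.length_replicate, List.length_append,
      List.getElem_replicate]
    split_ifs <;> simp <;> omega

theorem sum_range_if_le (x y k c : ℕ) :
    (((List.range (x + y)).map fun t : ℕ => if t < x ∧ x - t ≤ k then c else 0).sum) = min k x * c := by
  rw [List.range_add, List.map_append, List.sum_append, List.map_map]
  have h1 : (((List.range y).map
      ((fun t : ℕ => if t < x ∧ x - t ≤ k then c else 0) ∘ fun i => x + i)).sum) = 0 := by
    apply List.sum_eq_zero
    simp
  -- The truncated difference `n - (x - k)` counts those of the first `n` cars that are among the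
  -- last `k` of the block.
  have h2 : ∀ n ≤ x, (((List.range n).map fun t : ℕ => if t < x ∧ x - t ≤ k then c else 0).sum) =
      (n - (x - k)) * c := by
    intro n hn
    induction n with
    | zero => simp
    | succ n ih =>
      rw [List.range_succ, List.map_append, List.sum_append, ih (by omega)]
      simp only [List.map_cons, List.map_nil, List.sum_cons, List.sum_nil, add_zero]
      split_ifs
      · rw [show n + 1 - (x - k) = n - (x - k) + 1 by omega]; ring
      · rw [show n + 1 - (x - k) = n - (x - k) by omega]; ring
  rw [h1, h2 x le_rfl, add_zero, show x - (x - k) = min k x by omega]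

theorem Blocks.sum_displacement {m k : ℕ} {bs : List (ℕ × ℕ)} (h : Blocks s true r bs) :
    ∑ i, displacement m k s i = (bs.map fun b => min k b.1 * min m b.2).sum := by
  rw [← sum_readFrom _ r, h.readFrom_eq (displacement m k s) (fun b =>
    (List.range (b.1 + b.2)).map fun t : ℕ => if t < b.1 ∧ b.1 - t ≤ k then min m b.2 else 0)]
  · clear h
    induction bs with
    | nil => rfl
    | cons b bs ih => rw [List.flatMap_cons, List.sum_append, ih, sum_range_if_le]; simp
  · rintro r ⟨x, y⟩ l h
    apply List.map_congr_left
    intro t ht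
    rw [List.mem_range] at ht
    rcases lt_or_ge t x with hx | hx
    · simp [h.displacement_first hx, hx]
    · have := h.displacement_second (m := m) (k := k) (t := t - x) (by simp at ht; omega)
      rw [Nat.cast_sub hx, show r + (x : ZMod L) + ((t : ZMod L) - x) = r + (t : ZMod L) by ring] at this
      simp [this, not_lt.2 hx]

end

/-! ### Strings of symbols that present a road -/

/-- The symbol stands for a group with at least one empty site and one car. -/
def Valid (m k : ℕ) (p : Symbol) : Prop := 0 < p.1 + m ∧ 0 < p.2 + k

/-- The lengths of the two blocks of a group. -/
def sizes (m k : ℕ) (p : Symbol) : ℕ × ℕ := ((p.1 + m).toNat, (p.2 + k).toNat)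

/-- The road reads the groups of the string `u` from site `r` on. -/
def Presents (m k : ℕ) {L : ℕ} (s : Road L) (r : ZMod L) (u : List Symbol) : Prop :=
  readFrom s r = twoWord false (u.map (sizes m k)) ∧ ∀ p ∈ u, Valid m k p

section

variable {m k L : ℕ} {s : Road L} {r : ZMod L} {u : List Symbol}

theorem Presents.blocks (h : Presents m k s r u) : Blocks s false r (u.map (sizes m k)) := by
  refine ⟨h.1, fun b hb => ?_⟩
  obtain ⟨p, hp, rfl⟩ := List.mem_map.1 hb
  have := h.2 p hp
  simp only [Valid, sizes] at this ⊢
  omega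

theorem Presents.ne_nil [NeZero L] (h : Presents m k s r u) : u ≠ [] := by
  rintro rfl
  have := congrArg List.length h.1
  simp [twoWord] at this
  exact NeZero.ne L this

/-- The same road from the first car of the first group on. -/
theorem Presents.blocks_true {p : Symbol} {t : List Symbol} (h : Presents m k s r (p :: t)) :
    Blocks s true (r + ((p.1 + m).toNat : ZMod L))
      (linkFrom (fun p q => [((sizes m k p).2, (sizes m k q).1)]) p (t ++ [p])) := by
  have hpos : ∀ q ∈ p :: t, 0 < (sizes m k q).1 ∧ 0 < (sizes m k q).2 := fun q hq =>
    h.blocks.2 _ (List.mem_map_of_mem hq)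
  constructor
  · have h1 := linkFrom_split (fun p => List.replicate (sizes m k p).2 true)
      (fun p => List.replicate (sizes m k p).1 false) p p t
    have h2 : readFrom s r = List.replicate (sizes m k p).1 false ++
        (List.replicate (sizes m k p).2 true ++ twoWord false (t.map (sizes m k))) := by
      rw [h.1]; simp [twoWord, twoBlock]
    have h3 := readFrom_add_length h2
    rw [List.length_replicate] at h3
    rw [sizes] at h3
    simp only at h3
    rw [h3, twoWord, twoWord, flatMap_linkFrom]
    simp only [List.flatMap_cons, List.flatMap_nil, List.append_nil, twoBlock, Bool.not_true]
    rw [← List.append_cancel_left_eq (List.replicate (sizes m k p).1 false), h1]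
    simp [twoBlock, List.flatMap_map, sizes]
  · have : ∀ (p : Symbol) (t : List Symbol), (∀ q ∈ p :: t, 0 < (sizes m k q).1 ∧ 0 < (sizes m k q).2) →
        ∀ b ∈ linkFrom (fun p q => [((sizes m k p).2, (sizes m k q).1)]) p t, 0 < b.1 ∧ 0 < b.2 := by
      intro p t
      induction t generalizing p with
      | nil => simp [linkFrom]
      | cons q t ih =>
        intro hp b hb
        simp only [linkFrom, List.cons_append, List.nil_append, List.mem_cons] at hb
        rcases hb with rfl | hb
        · exact ⟨(hp p (by simp)).2, (hp q (by simp)).1⟩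
        · exact ih q (fun q' hq' => hp q' (List.mem_cons_of_mem _ hq')) b hb
    apply this
    intro q hq
    apply hpos
    simp only [List.mem_cons, List.mem_append, List.mem_nil_iff, or_false] at hq ⊢
    tauto

/-- Two ways to divide the residues between the neighbours give the same circular word. -/
theorem exists_linkFrom_eq {α β : Type*} (F G F' G' : α → List β) (B : α → α → List β)
    (t : List α) (p q : α) (h : ∀ p ∈ t, G p ++ F p = G' p ++ F' p) :
    ∃ Z, linkFrom (fun p q => F p ++ B p q ++ G q) p (t ++ [q]) = F p ++ Z ++ G q ∧
      linkFrom (fun p q => F' p ++ B p q ++ G' q) p (t ++ [q]) = F' p ++ Z ++ G' q := by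
  induction t generalizing p with
  | nil => exact ⟨B p q, by simp [linkFrom], by simp [linkFrom]⟩
  | cons q' t ih =>
    obtain ⟨Z, h1, h2⟩ := ih q' (fun p hp => h p (List.mem_cons_of_mem _ hp))
    have h3 := h q' (by simp)
    refine ⟨B p q' ++ (G q' ++ F q') ++ Z, ?_, ?_⟩
    · simp only [List.cons_append, linkFrom, h1]; simp
    · simp only [List.cons_append, linkFrom, h2, h3]; simp

theorem linkFrom_congr {α β : Type*} {f g : α → α → List β} {P : α → Prop} {p : α} {t : List α}
    (h : ∀ p q, P p → P q → f p q = g p q) (ht : ∀ q ∈ p :: t, P q) :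
    linkFrom f p t = linkFrom g p t := by
  induction t generalizing p with
  | nil => rfl
  | cons q t ih =>
    simp only [List.forall_mem_cons] at ht ih
    simp only [linkFrom]
    rw [h p q ht.1 ht.2.1, ih ht.2]

/-- The new group at a boundary contains the `min k x ≥ 1` cars that moved and the `min m y ≥ 1`
sites they passed, and a core is what remains of a `◇`; so no block becomes empty. This uses `m, k ≥
1`. -/
theorem valid_stepString (hm : 1 ≤ m) (hk : 1 ≤ k) (h : ∀ p ∈ u, Valid m k p) : ∀ p ∈ stepString m k u, Valid m k p := by
  have key : ∀ (p : Symbol) (t : List Symbol), (∀ q ∈ p :: t, Valid m k q) →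
      ∀ q ∈ linkFrom (fun p q => core m k p ++ [rightPart p + leftPart q]) p t, Valid m k q := by
    intro p t
    induction t generalizing p with
    | nil => simp [linkFrom]
    | cons q t ih =>
      intro ht q' hq'
      simp only [linkFrom, List.append_assoc, List.mem_append, List.mem_cons, List.mem_nil_iff,
        or_false] at hq'
      have h1 := ht p (by simp)
      have h2 := ht q (by simp)
      rcases hq' with hq' | rfl | hq'
      · unfold core at hq'
        split_ifs at hq' with hp
        · rw [List.mem_singleton] at hq'
          subst hq'
          simp only [Valid, shrink]; omega
        · simp at hq'
      · simp only [Valid, rightPart, leftPart] at h1 h2 ⊢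
        split_ifs <;>
          simp only [Prod.fst_add, Prod.snd_add, Prod.fst_zero, Prod.snd_zero] <;> omega
      · exact ih q (fun q' hq' => ht q' (List.mem_cons_of_mem _ hq')) q' hq'
  cases u with
  | nil => simp [stepString, link]
  | cons p t =>
    apply key
    intro q hq
    apply h
    simp only [List.mem_cons, List.mem_append, List.mem_nil_iff, or_false] at hq ⊢
    tauto

/-- The rule acts on a block of cars and the empty block in front of it, that is, across a boundary
of groups. What a group keeps, its remaining empty sites followed by its remaining cars, stays
contiguous. These remainders have to be redistributed: both nonempty, they form the core; a lone
rest of empty sites extends the new group to the right, a lone rest of cars the one to the left. -/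
theorem Presents.step [NeZero L] (hm : 1 ≤ m) (hk : 1 ≤ k) (h : Presents m k s r u) :
    ∃ r', Presents m k (TrafficRule.step m k s) r' (stepString m k u) := by
  obtain ⟨p, t, rfl⟩ := List.exists_cons_of_ne_nil h.ne_nil
  have h1 := h.blocks_true.readFrom_step (m := m) (k := k)
  rw [flatMap_linkFrom] at h1
  simp only [List.flatMap_cons, List.flatMap_nil, List.append_nil] at h1
  let y := fun p : Symbol => (p.1 + m).toNat
  let x := fun p : Symbol => (p.2 + k).toNat
  -- `F` and `G` are the remaining cars and empty sites as the rule produces them, and `B` is the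
  -- new group at a boundary. `F'` and `G'` cut the same remainder `G q ++ F q` at the place where
  -- `stepString` cuts it.
  let F := fun p : Symbol => List.replicate (x p - min k (x p)) true
  let G := fun p : Symbol => List.replicate (y p - min m (y p)) false
  let B := fun p q : Symbol => List.replicate (min m (y q)) false ++ List.replicate (min k (x p)) true
  let F' := fun p : Symbol => twoWord false ((core m k p).map (sizes m k)) ++
    List.replicate (if 0 < p.2 then 0 else y p - min m (y p)) false
  let G' := fun p : Symbol => List.replicate (if 0 < p.1 then 0 else x p - min k (x p)) true
  have h6 : ∀ q, G q ++ F q = G' q ++ F' q := by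
    intro q
    simp only [F, G, F', G', core, x, y]
    by_cases ha : 0 < q.1 <;> by_cases hb : 0 < q.2
    · have e1 : (q.1 + m).toNat - min m (q.1 + m).toNat = (q.1 - m + m).toNat := by omega
      have e2 : (q.2 + k).toNat - min k (q.2 + k).toNat = (q.2 - k + k).toNat := by omega
      simp only [ha, hb, and_self, if_true, twoWord, twoBlock, sizes, shrink, List.map_cons,
        List.map_nil, List.flatMap_cons, List.flatMap_nil, List.replicate_zero, List.append_nil,
        List.nil_append, Bool.not_false, e1, e2]
    · have e2 : (q.2 + k).toNat - min k (q.2 + k).toNat = 0 := by omega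
      simp [ha, hb, twoWord, e2]
    · have e1 : (q.1 + m).toNat - min m (q.1 + m).toNat = 0 := by omega
      simp [ha, hb, twoWord, e1]
    · have e1 : (q.1 + m).toNat - min m (q.1 + m).toNat = 0 := by omega
      have e2 : (q.2 + k).toNat - min k (q.2 + k).toNat = 0 := by omega
      simp [ha, hb, twoWord, e1, e2]
  obtain ⟨Z, h2, h3⟩ := exists_linkFrom_eq F G F' G' B t p p fun q _ => h6 q
  have h4 : linkFrom (fun p q => F p ++ B p q ++ G q) p (t ++ [p]) =
      linkFrom (fun p q => movedBlock m k ((sizes m k p).2, (sizes m k q).1)) p (t ++ [p]) := by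
    congr 1; funext p q
    simp [F, G, B, x, y, movedBlock, sizes]
  have h5 : twoWord false ((stepString m k (p :: t)).map (sizes m k)) =
      linkFrom (fun p q => F' p ++ B p q ++ G' q) p (t ++ [p]) := by
    rw [stepString, link, map_linkFrom, twoWord, flatMap_linkFrom]
    apply linkFrom_congr (P := Valid m k)
    · intro p q hp hq
      simp only [F', B, G', List.map_append, List.flatMap_append, twoWord, List.append_assoc,
        List.append_cancel_left_eq, List.map_cons, List.map_nil, List.flatMap_cons,
        List.flatMap_nil, List.append_nil, twoBlock, sizes, Bool.not_false]
      rw [← List.append_assoc, ← List.replicate_add, ← List.replicate_add]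
      simp only [x, y, rightPart, leftPart, Valid] at hp hq ⊢
      congr 2 <;> split_ifs <;> simp <;> omega
    · intro q hq
      apply h.2
      simp only [List.mem_cons, List.mem_append, List.mem_nil_iff, or_false] at hq ⊢
      tauto
  rw [← h4, h2] at h1
  -- Both words have the form `F p ++ Z ++ G p` with the same `Z`, and `G p ++ F p` is the same in
  -- both cuttings, so they agree up to rotation.
  have h7 : readFrom (TrafficRule.step m k s) (r + ((p.1 + m).toNat : ZMod L)) ~r
      linkFrom (fun p q => F' p ++ B p q ++ G' q) p (t ++ [p]) := by
    rw [h1, h3, List.append_assoc, List.append_assoc]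
    refine List.isRotated_append.trans ?_
    refine List.IsRotated.trans ?_ List.isRotated_append
    rw [List.append_assoc, List.append_assoc, h6]
  obtain ⟨r', hr'⟩ := exists_readFrom_of_isRotated h7
  exact ⟨r', hr'.trans h5.symm, valid_stepString hm hk h.2⟩

end

section

variable {m k L : ℕ} {s : Road L} {r : ZMod L} {u : List Symbol}

/-! ### Strings of roads and the quantities they determine -/

theorem List.IsRotated.reduceOption {α : Type*} {l l' : List (Option α)} (h : l ~r l') :
    l.reduceOption ~r l'.reduceOption := by
  obtain ⟨x, y, rfl, rfl⟩ := exists_append_of_coe_eq (Cycle.coe_eq_coe.2 h)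
  rw [List.reduceOption_append, List.reduceOption_append]
  exact List.isRotated_append

theorem map_sizes_sub (h : ∀ p ∈ u, Valid m k p) :
    (u.map (sizes m k)).map (fun b => ((b.1 : ℤ) - m, (b.2 : ℤ) - k)) = u := by
  rw [List.map_map]
  conv_rhs => rw [← List.map_id u]
  apply List.map_congr_left
  intro p hp
  have := h p hp
  simp only [Valid] at this
  simp only [Function.comp, sizes, id]
  ext <;> simp <;> omega

theorem Presents.initialString_eq [NeZero L] (h : Presents m k s r u) :
    initialString m k s = (u : Cycle Symbol) := by
  let F : ZMod L → Option Symbol := fun j => if s (j - 1) = true ∧ s j = false then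
      some ((run s false j : ℤ) - (m : ℤ), (run s true (j + (run s false j : ZMod L)) : ℤ) - (k : ℤ))
    else none
  have h1 : initialString m k s = ((readFrom F 0).reduceOption : Cycle Symbol) := by
    simp only [initialString, readFrom, List.reduceOption, List.filterMap_map, zero_add,
      List.pure_def, List.bind_eq_flatMap, ← List.map_eq_flatMap]
    rfl
  -- Only the first empty site of a group, the one behind which a car stands, contributes a symbol.
  -- All its other sites give `none`.
  have h2 := h.blocks.readFrom_eq F (fun b => some ((b.1 : ℤ) - m, (b.2 : ℤ) - k) ::
    List.replicate (b.1 + b.2 - 1) none) (by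
      rintro r ⟨x, y⟩ l h
      have hx := (h.2 (x, y) (by simp)).1
      simp only at hx ⊢
      rw [show x + y = 1 + (x + y - 1) by omega, List.range_add, List.map_append]
      have h3 := h.first hx
      have h4 := h.second
      have h5 := h.last (by simp)
      simp only [Nat.cast_zero, add_zero, Bool.not_false, Nat.sub_zero] at h3 h4 h5
      simp only [List.range_one, List.map_cons, List.map_nil, List.cons_append, List.nil_append,
        Nat.cast_zero, add_zero, List.map_map, F, h3, h4, h5, and_self, if_true, List.cons.injEq,
        true_and, List.eq_replicate_iff, List.length_map, List.length_range, List.mem_map,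
        List.mem_range, Function.comp]
      refine ⟨by omega, ?_⟩
      rintro _ ⟨t, ht, rfl⟩
      rw [if_neg]
      rintro ⟨h6, h7⟩
      rcases lt_or_ge t x with htx | htx
      · have := (h.first htx).1
        rw [show r + ((1 + t : ℕ) : ZMod L) - 1 = r + (t : ZMod L) by push_cast; ring, this] at h6
        simp at h6
      · have := h4.1 (1 + t - x) (by omega)
        rw [show r + (x : ZMod L) + ((1 + t - x : ℕ) : ZMod L) = r + ((1 + t : ℕ) : ZMod L) by
          rw [Nat.cast_sub (by omega)]; ring, h7] at this
        simp at this)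
  rw [h1, Cycle.coe_eq_coe.2 (List.IsRotated.reduceOption (readFrom_isRotated F 0 r)), h2]
  conv_rhs => rw [← map_sizes_sub h.2]
  congr 1
  generalize u.map (sizes m k) = bs
  induction bs with
  | nil => rfl
  | cons b bs ih =>
    rw [List.flatMap_cons, List.reduceOption_append, ih]
    simp [List.reduceOption_replicate_none]

theorem Blocks.sum_eq [NeZero L] {c : Bool} {bs : List (ℕ × ℕ)} (h : Blocks s c r bs)
    {M : Type*} [AddCommMonoid M] (F : ZMod L → M) (g : ℕ × ℕ → M)
    (hg : ∀ r b l, Blocks s c r (b :: l) →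
      ∑ t ∈ Finset.range (b.1 + b.2), F (r + (t : ZMod L)) = g b) :
    ∑ i, F i = (bs.map g).sum := by
  have key : ∀ bs' bs'' : List (ℕ × ℕ), bs = bs'' ++ bs' →
      ∑ t ∈ Finset.range (twoWord c bs').length,
        F (r + ((twoWord c bs'').length : ZMod L) + (t : ZMod L)) = (bs'.map g).sum := by
    intro bs'
    induction bs' with
    | nil => intro _ _; simp [twoWord]
    | cons b bs' ih =>
      intro bs'' hbs
      subst hbs
      have h1 := hg _ _ _ h.rotate
      have h2 := ih (bs'' ++ [b]) (by simp)
      rw [List.map_cons, List.sum_cons, ← h2, ← h1]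
      simp only [twoWord, List.flatMap_cons, List.length_append, length_twoBlock,
        Finset.sum_range_add, List.flatMap_append, List.flatMap_nil, List.append_nil]
      congr 1
      refine Finset.sum_congr rfl fun t _ => ?_
      congr 1
      push_cast; ring
  have h1 := key bs [] rfl
  have h2 : (twoWord c bs).length = L := by rw [← h.1]; simp
  rw [h2] at h1
  rw [← h1, ← sum_readFrom F r]
  simp only [twoWord, List.flatMap_nil, List.length_nil, Nat.cast_zero, add_zero]
  rfl

theorem Presents.groups_eq [NeZero L] (h : Presents m k s r u) : groups s = u.length := by
  rw [groups, Finset.card_filter, h.blocks.sum_eq _ fun _ => 1]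
  · simp [Function.comp_def]
  · rintro r ⟨x, y⟩ l h
    obtain ⟨hx, hy⟩ := h.2 (x, y) (by simp)
    simp only at hx hy ⊢
    obtain ⟨x, rfl⟩ := Nat.exists_eq_succ_of_ne_zero hx.ne'
    -- After replacing `x` by its predecessor, these are all empty sites of the block but the last
    -- one, and only that last one is followed by a car.
    have h1 : ∀ t ∈ Finset.range x, (if s (r + (t : ZMod L)) = false ∧
        s (r + (t : ZMod L) + 1) = true then 1 else 0) = 0 := by
      intro t ht
      rw [Finset.mem_range] at ht
      have h2 := (h.first (t := t + 1) (by omega)).1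
      rw [if_neg]
      rintro ⟨-, h3⟩
      rw [show r + (t : ZMod L) + 1 = r + ((t + 1 : ℕ) : ZMod L) by push_cast; ring, h2] at h3
      simp at h3
    have h2 : ∀ t ∈ Finset.range y, (if s (r + ((x.succ + t : ℕ) : ZMod L)) = false ∧
        s (r + ((x.succ + t : ℕ) : ZMod L) + 1) = true then 1 else 0) = 0 := by
      intro t ht
      rw [Finset.mem_range] at ht
      have h2 := h.second.1 t ht
      rw [if_neg]
      rintro ⟨h3, -⟩
      rw [Nat.cast_add, ← add_assoc, h2] at h3
      simp at h3
    have h3 : s (r + (x : ZMod L)) = false ∧ s (r + (x : ZMod L) + 1) = true := by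
      refine ⟨(h.first (Nat.lt_succ_self x)).1, ?_⟩
      rw [show r + (x : ZMod L) + 1 = r + ((x + 1 : ℕ) : ZMod L) + ((0 : ℕ) : ZMod L) by
        push_cast; ring, h.second.1 0 hy]; rfl
    rw [Finset.sum_range_add, Finset.sum_range_succ, Finset.sum_eq_zero h1, Finset.sum_eq_zero h2,
      if_pos h3, zero_add, add_zero]

theorem Presents.card_cars [NeZero L] (h : Presents m k s r u) :
    (((Finset.univ.filter fun i : ZMod L => s i = true).card : ℕ) : ℤ) =
      (u.map fun p => p.2 + (k : ℤ)).sum := by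
  rw [Finset.card_filter, h.blocks.sum_eq _ fun b => b.2]
  · rw [Nat.cast_list_sum, List.map_map, List.map_map]
    congr 1
    apply List.map_congr_left
    intro p hp
    have := h.2 p hp
    simp only [Valid] at this
    simp only [Function.comp, sizes]; omega
  · rintro r ⟨x, y⟩ l h
    simp only
    rw [Finset.sum_range_add, Finset.sum_eq_zero, Finset.sum_congr rfl (g := fun _ => 1)]
    · simp
    · intro t ht
      rw [Finset.mem_range] at ht
      have h2 := h.second.1 t ht
      rw [if_pos]
      rw [Nat.cast_add, ← add_assoc, h2]; rfl
    · intro t ht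
      rw [Finset.mem_range] at ht
      have h2 := (h.first ht).1
      simp [h2]

theorem Presents.length_eq [NeZero L] (h : Presents m k s r u) :
    (L : ℤ) = (u.map fun p => p.1 + (m : ℤ)).sum + (u.map fun p => p.2 + (k : ℤ)).sum := by
  have h1 := congrArg List.length h.1
  rw [length_readFrom, twoWord, List.length_flatMap, List.map_map] at h1
  rw [h1, Nat.cast_list_sum, List.map_map, ← List.sum_map_add]
  congr 1
  apply List.map_congr_left
  intro p hp
  have := h.2 p hp
  simp only [Valid] at this
  simp only [Function.comp, sizes, length_twoBlock]; omega

/-- The total displacement of the cars: every group moves `min k` of its cars into at most `m` of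
the empty sites of the next group. -/
theorem Presents.sum_displacement [NeZero L] (h : Presents m k s r u) :
    ((∑ i, displacement m k s i : ℕ) : ℤ) =
      (link (fun p q => [((k : ℤ) + min 0 p.2) * ((m : ℤ) + min 0 q.1)]) u).sum := by
  obtain ⟨p, t, rfl⟩ := List.exists_cons_of_ne_nil h.ne_nil
  rw [h.blocks_true.sum_displacement, map_linkFrom, Nat.cast_list_sum, map_linkFrom, link]
  congr 1
  apply linkFrom_congr (P := Valid m k)
  · intro p q hp hq
    simp only [Valid] at hp hq
    simp only [sizes, List.map_cons, List.map_nil, List.cons.injEq, and_true, Nat.cast_mul]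
    congr 1 <;> omega
  · intro q hq
    apply h.2
    simp only [List.mem_cons, List.mem_append, List.mem_nil_iff, or_false] at hq ⊢
    tauto

theorem exists_twoWord {l : List Bool} (hh : l.head? = some false) (hl : l.getLast? = some true) :
    ∃ bs : List (ℕ × ℕ), l = twoWord false bs ∧ ∀ b ∈ bs, 0 < b.1 ∧ 0 < b.2 := by
  -- `c` cars may precede the first empty site, so that the induction can prepend either value. A
  -- new empty site extends the first `0`-block if `c = 0`, and otherwise closes the pending `c`
  -- cars to a new group.
  have key : ∀ l : List Bool, ∃ (c : ℕ) (bs : List (ℕ × ℕ)),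
      l ++ [true] = List.replicate c true ++ twoWord false bs ∧
      (∀ b ∈ bs, 0 < b.1 ∧ 0 < b.2) ∧ (c = 0 → bs ≠ []) := by
    intro l
    induction l with
    | nil => exact ⟨1, [], by simp [twoWord], by simp, by simp⟩
    | cons v l ih =>
      obtain ⟨c, bs, h1, h2, h3⟩ := ih
      cases v with
      | true => exact ⟨c + 1, bs, by simp [h1, List.replicate_succ], h2, by simp⟩
      | false =>
        rcases Nat.eq_zero_or_pos c with rfl | hc
        · obtain ⟨⟨x, y⟩, bs, rfl⟩ := List.exists_cons_of_ne_nil (h3 rfl)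
          refine ⟨0, (x + 1, y) :: bs, ?_, ?_, by simp⟩
          · simp [h1, twoWord, twoBlock, List.replicate_succ]
          · simp only [List.forall_mem_cons] at h2 ⊢
            exact ⟨⟨by omega, h2.1.2⟩, h2.2⟩
        · refine ⟨0, (1, c) :: bs, ?_, ?_, by simp⟩
          · simp [h1, twoWord, twoBlock, List.replicate_succ]
          · simp only [List.forall_mem_cons]
            exact ⟨⟨one_pos, hc⟩, h2⟩
  obtain ⟨l, rfl⟩ := List.getLast?_eq_some_iff.1 hl
  obtain ⟨c, bs, h1, h2, -⟩ := key l
  rcases Nat.eq_zero_or_pos c with rfl | hc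
  · exact ⟨bs, by simpa using h1, h2⟩
  · obtain ⟨c, rfl⟩ := Nat.exists_eq_succ_of_ne_zero hc.ne'
    rw [h1] at hh
    simp [List.replicate_succ] at hh

theorem exists_presents_of_ends (m k : ℕ) (hh : (readFrom s r).head? = some false)
    (hl : (readFrom s r).getLast? = some true) : ∃ u, Presents m k s r u := by
  obtain ⟨bs, h1, h2⟩ := exists_twoWord hh hl
  refine ⟨bs.map fun b => ((b.1 : ℤ) - m, (b.2 : ℤ) - k), ?_, ?_⟩
  · rw [h1, List.map_map]
    congr 1
    conv_lhs => rw [← List.map_id bs]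
    apply List.map_congr_left
    intro b _
    simp [sizes]
  · intro p hp
    obtain ⟨b, hb, rfl⟩ := List.mem_map.1 hp
    have := h2 b hb
    simp only [Valid]; omega

theorem constant_or_exists [NeZero L] (s : Road L) :
    (∃ v, s = fun _ => v) ∨ ∃ i, s i = true ∧ s (i + 1) = false := by
  by_cases h : ∃ i, s i = true ∧ s (i + 1) = false
  · exact Or.inr h
  · push Not at h
    left
    by_cases h0 : ∃ i, s i = true
    · obtain ⟨i, hi⟩ := h0
      refine ⟨true, funext fun j => ?_⟩
      have : ∀ n : ℕ, s (i + (n : ZMod L)) = true := by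
        intro n
        induction n with
        | zero => simpa using hi
        | succ n ih => simpa [← add_assoc] using h _ ih
      have := this (j - i).val
      rwa [ZMod.natCast_zmod_val, add_sub_cancel] at this
    · push Not at h0
      exact ⟨false, funext fun j => by simpa using h0 j⟩

theorem exists_presents [NeZero L] (m k : ℕ) {s : Road L} (h : ¬ ∃ v, s = fun _ => v) :
    ∃ r u, Presents m k s r u := by
  obtain ⟨i, hi, hi'⟩ := (constant_or_exists s).resolve_left h
  refine ⟨i + 1, exists_presents_of_ends m k ?_ ?_⟩
  · rw [List.head?_eq_getElem?, List.getElem?_eq_getElem (by simpa using NeZero.pos L),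
      getElem_readFrom]
    simpa using hi'
  · rw [List.getLast?_eq_getElem?, List.getElem?_eq_getElem (by simpa using NeZero.pos L),
      getElem_readFrom, length_readFrom, Nat.cast_sub NeZero.one_le]
    simpa using hi

end

section constant

variable {L : ℕ} (m k : ℕ) (v : Bool)

theorem displacement_constant (i : ZMod L) : displacement m k (fun _ => v : Road L) i = 0 := by
  unfold displacement
  split_ifs with h
  · have : run (fun _ => v : Road L) false
        (i + (run (fun _ => v : Road L) true i : ZMod L)) ≤ 0 :=
      run_le_of_ne (by simpa using h.1)
    omega
  · rfl

theorem initialString_constant : initialString m k (fun _ => v : Road L) = Cycle.nil := by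
  simp [initialString]

variable [NeZero L]

theorem step_constant : step m k (fun _ => v : Road L) = fun _ => v := by
  funext j
  simp [step, displacement_constant]

theorem groups_constant : groups (fun _ => v : Road L) = 0 := by
  simp [groups]

end constant

/-! ### Cyclic states -/

theorem groups_step {m k : ℕ} (hm : 1 ≤ m) (hk : 1 ≤ k) {L : ℕ} [NeZero L] {s : Road L} {r : ZMod L}
    {u : List Symbol} (h : Presents m k s r u) : groups (step m k s) = groups s + diamonds u := by
  obtain ⟨r', h'⟩ := h.step hm hk
  rw [h'.groups_eq, h.groups_eq, length_stepString]

theorem groups_le_groups_step {m k : ℕ} (hm : 1 ≤ m) (hk : 1 ≤ k) {L : ℕ} [NeZero L] (s : Road L) :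
    groups s ≤ groups (step m k s) := by
  by_cases h : ∃ v, s = fun _ => v
  · obtain ⟨v, rfl⟩ := h
    rw [step_constant]
  · obtain ⟨r, u, h⟩ := exists_presents m k h
    rw [groups_step hm hk h]; omega

theorem IsCyclicState.step {m k L : ℕ} [NeZero L] {s : Road L} (h : IsCyclicState m k s) :
    IsCyclicState m k (TrafficRule.step m k s) := by
  obtain ⟨n, hn, h⟩ := h
  exact ⟨n, hn, h.apply⟩

/-- The number of groups is constant on cycles. -/
theorem IsCyclicState.groups_step {m k L : ℕ} [NeZero L] (hm : 1 ≤ m) (hk : 1 ≤ k) {s : Road L}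
    (h : IsCyclicState m k s) : groups (TrafficRule.step m k s) = groups s := by
  obtain ⟨n, hn, h⟩ := h
  have h1 : Monotone fun t => groups ((TrafficRule.step m k)^[t] s) :=
    monotone_nat_of_le_succ fun t => by
      rw [Function.iterate_succ_apply']; exact groups_le_groups_step hm hk _
  have h2 := h1 (show 1 ≤ n from hn)
  have h3 := h1 (show 0 ≤ 1 by omega)
  simp only [h.eq, Function.iterate_one, Function.iterate_zero, id] at h2 h3
  exact le_antisymm h2 h3

/-- The time step on an infinite periodic string without `◇`. -/
def evolve (P : ℕ → Symbol) (i : ℕ) : Symbol := rightPart (P i) + leftPart (P (i + 1))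

theorem link_map_range {α β : Type*} (g : α → α → β) {N : ℕ} (hN : 0 < N) {P : ℕ → α}
    (hP : P N = P 0) : link (fun p q => [g p q]) ((List.range N).map P) =
      (List.range N).map fun i => g (P i) (P (i + 1)) := by
  have key : ∀ (n : ℕ) (P : ℕ → α), linkFrom (fun p q => [g p q]) (P 0)
      ((List.range n).map fun i => P (i + 1)) = (List.range n).map fun i => g (P i) (P (i + 1)) := by
    intro n
    induction n with
    | zero => intro P; rfl
    | succ n ih =>
      intro P
      have := ih fun i => P (i + 1)
      simp only [List.range_succ_eq_map, List.map_cons, List.map_map, linkFrom, Function.comp_def,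
        Nat.succ_eq_add_one, List.cons_append, List.nil_append] at this ⊢
      rw [this]
  obtain ⟨n, rfl⟩ := Nat.exists_eq_succ_of_ne_zero hN.ne'
  rw [← key, List.range_succ_eq_map, List.map_cons, link, ← List.range_succ_eq_map,
    List.range_succ, List.map_append, List.map_map, List.map_cons, ← hP]
  rfl

/-- The cyclic state `s` has the groups `P 0, P 1, …, P (N - 1)`. -/
structure CyclicProfile (m k : ℕ) {L : ℕ} [NeZero L] (s : Road L) (N : ℕ) (P : ℕ → Symbol) :
    Prop where
  pos : 0 < N
  periodic : ∀ i, P (i + N) = P i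
  cyclic : IsCyclicState m k s
  presents : ∃ r, Presents m k s r ((List.range N).map P)

section

variable {m k L N : ℕ} [NeZero L] {s : Road L} {P : ℕ → Symbol}

theorem CyclicProfile.add_mul (h : CyclicProfile m k s N P) (i j : ℕ) : P (i + N * j) = P i := by
  induction j with
  | zero => simp
  | succ j ih => rw [Nat.mul_succ, ← add_assoc, h.periodic, ih]

theorem CyclicProfile.mod (h : CyclicProfile m k s N P) (i : ℕ) : P (i % N) = P i := by
  conv_rhs => rw [← Nat.mod_add_div i N]
  exact (h.add_mul _ _).symm

/-- A `◇` would increase the number of groups in the next step, but that number is constant on a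
cycle. -/
theorem CyclicProfile.not_diamond (hm : 1 ≤ m) (hk : 1 ≤ k) (h : CyclicProfile m k s N P) (i : ℕ) :
    ¬ (0 < (P i).1 ∧ 0 < (P i).2) := by
  obtain ⟨r, hr⟩ := h.presents
  have h1 := groups_step hm hk hr
  rw [h.cyclic.groups_step hm hk] at h1
  have h2 : diamonds ((List.range N).map P) = 0 := by omega
  rw [diamonds, List.countP_eq_zero] at h2
  have := h2 (P (i % N)) (List.mem_map_of_mem (List.mem_range.2 (Nat.mod_lt _ h.pos)))
  rw [h.mod] at this
  simpa using this

theorem CyclicProfile.next (hm : 1 ≤ m) (hk : 1 ≤ k) (h : CyclicProfile m k s N P) :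
    CyclicProfile m k (TrafficRule.step m k s) N (evolve P) := by
  refine ⟨h.pos, fun i => ?_, h.cyclic.step, ?_⟩
  · rw [evolve, evolve, h.periodic, add_right_comm, h.periodic]
  · obtain ⟨r, hr⟩ := h.presents
    obtain ⟨r', hr'⟩ := hr.step hm hk
    refine ⟨r', ?_⟩
    have h1 : stepString m k ((List.range N).map P) = (List.range N).map (evolve P) := by
      have h2 := link_map_range (fun p q => rightPart p + leftPart q) h.pos
        (by simpa using h.periodic 0)
      have h3 : (List.range N).map (evolve P) =
        (List.range N).map fun i => rightPart (P i) + leftPart (P (i + 1)) := rfl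
      rw [h3, ← h2, stepString]
      obtain ⟨n, rfl⟩ := Nat.exists_eq_succ_of_ne_zero h.pos.ne'
      rw [List.range_succ_eq_map, List.map_cons]
      apply linkFrom_congr (P := fun p => ¬ (0 < p.1 ∧ 0 < p.2))
      · intro p q hp hq
        simp only [core, if_neg hp, List.nil_append]
      · intro q hq
        have : ∃ i, q = P i := by
          simp only [List.mem_cons, List.mem_append, List.mem_map, List.mem_nil_iff, or_false] at hq
          rcases hq with rfl | ⟨i, _, rfl⟩ | rfl
          exacts [⟨0, rfl⟩, ⟨_, rfl⟩, ⟨0, rfl⟩]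
        obtain ⟨i, rfl⟩ := this
        exact h.not_diamond hm hk i
    rwa [h1] at hr'

theorem CyclicProfile.iterate (hm : 1 ≤ m) (hk : 1 ≤ k) (h : CyclicProfile m k s N P) (t : ℕ) :
    CyclicProfile m k ((TrafficRule.step m k)^[t] s) N (evolve^[t] P) := by
  induction t with
  | zero => exact h
  | succ t ih =>
    rw [Function.iterate_succ_apply', Function.iterate_succ_apply']
    exact ih.next hm hk

/-- Without `◇`, surpluses of empty sites keep their index and deficits move one index to the left.
For cars it is the other way round, see `evolve_snd`. -/
theorem CyclicProfile.evolve_fst (hm : 1 ≤ m) (hk : 1 ≤ k) (h : CyclicProfile m k s N P) (i : ℕ) :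
    (evolve P i).1 = max (P i).1 0 + min 0 (P (i + 1)).1 := by
  have := h.not_diamond hm hk i
  simp only [evolve, rightPart, leftPart, Prod.fst_add]
  split_ifs <;> simp <;> omega

theorem CyclicProfile.evolve_snd (hm : 1 ≤ m) (hk : 1 ≤ k) (h : CyclicProfile m k s N P) (i : ℕ) :
    (evolve P i).2 = min 0 (P i).2 + max (P (i + 1)).2 0 := by
  have := h.not_diamond hm hk (i + 1)
  simp only [evolve, rightPart, leftPart, Prod.snd_add]
  split_ifs <;> simp <;> omega

theorem sum_range_shift {M : Type*} [AddCommMonoid M] {f : ℕ → M} (h : f N = f 0) :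
    ∑ i ∈ Finset.range N, f (i + 1) = ∑ i ∈ Finset.range N, f i := by
  cases N with
  | zero => rfl
  | succ n => rw [Finset.sum_range_succ, h, Finset.sum_range_succ' f _]

/-- A sum over the groups that no time step increases is constant on cycles. -/
theorem CyclicProfile.sum_evolve (hm : 1 ≤ m) (hk : 1 ≤ k) (h : CyclicProfile m k s N P)
    (f : Symbol → ℤ) (hf : ∀ (s : Road L) (P : ℕ → Symbol), CyclicProfile m k s N P →
      ∑ i ∈ Finset.range N, f (evolve P i) ≤ ∑ i ∈ Finset.range N, f (P i)) :
    ∑ i ∈ Finset.range N, f (evolve P i) = ∑ i ∈ Finset.range N, f (P i) := by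
  have h1 : Antitone fun t => ∑ i ∈ Finset.range N, f (evolve^[t] P i) :=
    antitone_nat_of_succ_le fun t => by
      simp only [Function.iterate_succ_apply']
      exact hf _ _ (h.iterate hm hk t)
  -- The sum depends on the state alone, not on where the numbering of its groups starts. It
  -- therefore returns to its value after a full cycle.
  have h2 : ∀ (s : Road L) (P : ℕ → Symbol), CyclicProfile m k s N P →
      ∑ i ∈ Finset.range N, f (P i) = ((initialString m k s).toMultiset.map f).sum := by
    intro s P h
    obtain ⟨r, hr⟩ := h.presents
    rw [hr.initialString_eq, Cycle.coe_toMultiset, Multiset.map_coe, Multiset.sum_coe, List.map_map]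
    rfl
  obtain ⟨n, hn, hc⟩ := h.cyclic
  have h3 := h1 (show 1 ≤ n from hn)
  simp only [Function.iterate_one] at h3
  rw [h2 _ _ (h.iterate hm hk n), hc.eq, ← h2 _ _ h] at h3
  exact le_antisymm (hf _ _ h) h3

/-- A deficit next to a surplus would cancel part of it. Each `max (P i).1 0` can only shrink, and
the sum is constant on a cycle, so no such cancellation takes place. -/
theorem CyclicProfile.fst_nonneg (hm : 1 ≤ m) (hk : 1 ≤ k) (h : CyclicProfile m k s N P) {i : ℕ}
    (hi : 0 < (P i).1) : 0 ≤ (P (i + 1)).1 := by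
  have hle : ∀ (s : Road L) (P : ℕ → Symbol), CyclicProfile m k s N P → ∀ i,
      max (evolve P i).1 0 ≤ max (P i).1 0 := by
    intro s P h i
    rw [h.evolve_fst hm hk]; omega
  have h1 := h.sum_evolve hm hk (fun p => max p.1 0) fun s P h =>
    Finset.sum_le_sum fun i _ => hle s P h i
  rw [Finset.sum_eq_sum_iff_of_le fun i _ => hle s P h i] at h1
  have h2 := h1 (i % N) (Finset.mem_range.2 (Nat.mod_lt _ h.pos))
  rw [h.mod, (h.next hm hk).mod, h.evolve_fst hm hk] at h2
  omega

theorem CyclicProfile.snd_nonneg (hm : 1 ≤ m) (hk : 1 ≤ k) (h : CyclicProfile m k s N P) {i : ℕ}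
    (hi : 0 < (P (i + 1)).2) : 0 ≤ (P i).2 := by
  have hle : ∀ (s : Road L) (P : ℕ → Symbol), CyclicProfile m k s N P → ∀ i,
      max (evolve P i).2 0 ≤ max (P (i + 1)).2 0 := by
    intro s P h i
    rw [h.evolve_snd hm hk]; omega
  have hs : ∀ (s : Road L) (P : ℕ → Symbol), CyclicProfile m k s N P →
      ∑ i ∈ Finset.range N, max (P (i + 1)).2 0 = ∑ i ∈ Finset.range N, max (P i).2 0 := by
    intro s P h
    exact sum_range_shift (f := fun i => max (P i).2 0) (by
      have := h.periodic 0
      rw [zero_add] at this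
      simp only [this])
  have h1 := h.sum_evolve hm hk (fun p => max p.2 0) fun s P h =>
    (Finset.sum_le_sum fun i _ => hle s P h i).trans_eq (hs s P h)
  rw [← hs s P h, Finset.sum_eq_sum_iff_of_le fun i _ => hle s P h i] at h1
  have h2 := h1 (i % N) (Finset.mem_range.2 (Nat.mod_lt _ h.pos))
  have h3 : P (i % N + 1) = P (i + 1) := by
    rw [← h.mod (i + 1), ← h.mod (i % N + 1), Nat.mod_add_mod]
  rw [h3, (h.next hm hk).mod, h.evolve_snd hm hk] at h2
  omega

/-- A surplus at `i` stays there, while a deficit at `i + t + 1` moves to `i + t` in one step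
without being absorbed. So the distance shrinks until both stand at the same index, which is absurd.
The two lemmas below use the same pursuit for positive second indices, which also move to the left;
there the target is a positive first index, where a `◇` would arise, or a negative second index,
which stays in place. -/
theorem CyclicProfile.fst_nonneg_of_fst_pos (hm : 1 ≤ m) (hk : 1 ≤ k)
    (h : CyclicProfile m k s N P) {i t : ℕ} (hi : 0 < (P i).1) : 0 ≤ (P (i + t)).1 := by
  by_contra ht
  push Not at ht
  induction t generalizing s P with
  | zero => exact absurd hi ht.not_gt
  | succ t ih =>
    refine ih (h.next hm hk) ?_ ?_
    · have := h.fst_nonneg hm hk hi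
      rw [h.evolve_fst hm hk]; omega
    · have h1 : ¬ 0 < (P (i + t)).1 := fun h' => by
        have := h.fst_nonneg hm hk h'
        rw [← add_assoc] at ht; omega
      rw [h.evolve_fst hm hk]; rw [← add_assoc] at ht; omega

theorem CyclicProfile.snd_nonpos_of_fst_pos (hm : 1 ≤ m) (hk : 1 ≤ k)
    (h : CyclicProfile m k s N P) {i t : ℕ} (hi : 0 < (P i).1) : (P (i + t)).2 ≤ 0 := by
  by_contra ht
  push Not at ht
  induction t generalizing s P with
  | zero => exact h.not_diamond hm hk i ⟨hi, ht⟩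
  | succ t ih =>
    rw [← add_assoc] at ht
    refine ih (h.next hm hk) ?_ ?_
    · have := h.fst_nonneg hm hk hi
      rw [h.evolve_fst hm hk]; omega
    · have := h.snd_nonneg hm hk ht
      rw [h.evolve_snd hm hk]; omega

theorem CyclicProfile.snd_nonpos_of_snd_neg (hm : 1 ≤ m) (hk : 1 ≤ k)
    (h : CyclicProfile m k s N P) {i t : ℕ} (hi : (P i).2 < 0) : (P (i + t)).2 ≤ 0 := by
  by_contra ht
  push Not at ht
  induction t generalizing s P with
  | zero => exact absurd hi ht.not_gt
  | succ t ih =>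
    rw [← add_assoc] at ht
    refine ih (h.next hm hk) ?_ ?_
    · have h1 : ¬ 0 < (P (i + 1)).2 := fun h' => by
        have := h.snd_nonneg hm hk h'
        omega
      rw [h.evolve_snd hm hk]; omega
    · have := h.snd_nonneg hm hk ht
      rw [h.evolve_snd hm hk]; omega

/-- A cyclic state has free flow, a jam everywhere, or only small groups. -/
theorem CyclicProfile.cases (hm : 1 ≤ m) (hk : 1 ≤ k) (h : CyclicProfile m k s N P) :
    (∀ i, 0 ≤ (P i).1 ∧ (P i).2 ≤ 0) ∨ (∀ i, (P i).1 ≤ 0 ∧ 0 ≤ (P i).2) ∨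
      ∀ i, (P i).1 ≤ 0 ∧ (P i).2 ≤ 0 := by
  -- By periodicity every group is ahead of every other one, so the one-sided lemmas reach all
  -- indices.
  have key : ∀ i j, ∃ t, P j = P (i + t) := by
    intro i j
    have h1 : i ≤ j + N * i := by
      have := Nat.le_mul_of_pos_left i h.pos
      omega
    exact ⟨j + N * i - i, by rw [Nat.add_sub_cancel' h1, h.add_mul]⟩
  by_cases h1 : ∃ i, 0 < (P i).1
  · obtain ⟨i, hi⟩ := h1
    refine Or.inl fun j => ?_
    obtain ⟨t, ht⟩ := key i j
    rw [ht]
    exact ⟨h.fst_nonneg_of_fst_pos hm hk hi, h.snd_nonpos_of_fst_pos hm hk hi⟩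
  · push Not at h1
    right
    by_cases h2 : ∃ i, 0 < (P i).2
    · obtain ⟨i, hi⟩ := h2
      refine Or.inl fun j => ⟨h1 j, ?_⟩
      by_contra hj
      obtain ⟨t, ht⟩ := key j i
      have := h.snd_nonpos_of_snd_neg hm hk (t := t) (not_le.1 hj)
      rw [← ht] at this
      omega
    · push Not at h2
      exact Or.inr fun j => ⟨h1 j, h2 j⟩

end

/-- The condition `π ≤ 0` excludes every `◇` and passes to joins by additivity, so no division ever
becomes possible. It is applied with `π` one of the two coordinates. -/
theorem newGroups_eq_zero_of_forall {m : ℕ} (hm : 1 ≤ m) (k : ℕ) (w : Cycle Symbol) (π : Symbol →+ ℤ)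
    (hπ : ∀ p : Symbol, 0 < p.1 → 0 < p.2 → 0 < π p) (hw : ∀ p ∈ w, π p ≤ 0) :
    newGroups m k w = 0 := by
  induction hn : cyclePotential w using Nat.strong_induction_on generalizing w with
  | _ n ih =>
    subst hn
    by_cases h : ∃ d w', Replace m k w d w'
    · obtain ⟨d, w', h⟩ := h
      have hlt := h.potential_lt hm
      rw [newGroups_of_replace hm h]
      rw [replace_iff] at h
      rcases h with ⟨p, u, hp, hp', rfl, rfl, rfl⟩ | ⟨p, q, u, hp, hp', rfl, rfl, rfl⟩
      · have := hw p (by simp)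
        exact absurd (hπ p hp hp') (by omega)
      · rw [ih _ hlt _ _ rfl]
        simp only [Cycle.mem_coe_iff, List.mem_cons, forall_eq_or_imp, map_add] at hw ⊢
        exact ⟨by omega, hw.2.2⟩
    · exact newGroups_eq hm ⟨Replaces.refl w, fun d w₁ hr => h ⟨d, w₁, hr⟩⟩

/-! ### The flow of cyclic states -/

section

variable {m k L N : ℕ} [NeZero L] {s : Road L} {P : ℕ → Symbol}

theorem CyclicProfile.flow_eq (h : CyclicProfile m k s N P) :
    flow m k s = ((∑ i ∈ Finset.range N,
      ((k : ℤ) + min 0 (P i).2) * ((m : ℤ) + min 0 (P (i + 1)).1) : ℤ) : ℝ) / L := by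
  obtain ⟨r, hr⟩ := h.presents
  have h1 := hr.sum_displacement
  have h2 := link_map_range (fun p q : Symbol => ((k : ℤ) + min 0 p.2) * ((m : ℤ) + min 0 q.1))
    h.pos (by simpa using h.periodic 0)
  rw [h2] at h1
  rw [flow, ← Nat.cast_sum, ← Int.cast_natCast (∑ i, displacement m k s i), h1]
  rfl

theorem CyclicProfile.density_eq (h : CyclicProfile m k s N P) :
    density s = ((∑ i ∈ Finset.range N, ((P i).2 + (k : ℤ)) : ℤ) : ℝ) / L := by
  obtain ⟨r, hr⟩ := h.presents
  have h1 := hr.card_cars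
  rw [List.map_map] at h1
  rw [density, ← Int.cast_natCast (Finset.card _), h1]
  rfl

theorem CyclicProfile.length_eq (h : CyclicProfile m k s N P) :
    (L : ℝ) = ((∑ i ∈ Finset.range N, ((P i).1 + (m : ℤ)) : ℤ) : ℝ) +
      ((∑ i ∈ Finset.range N, ((P i).2 + (k : ℤ)) : ℤ) : ℝ) := by
  obtain ⟨r, hr⟩ := h.presents
  have h1 := hr.length_eq
  rw [List.map_map, List.map_map] at h1
  have h2 : ((L : ℤ) : ℝ) = _ := congrArg _ h1
  rw [Int.cast_add] at h2
  exact_mod_cast h2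

theorem sum_range_mul_of_periodic {M : Type*} [Semiring M] {f : ℕ → M} {n : ℕ}
    (h : ∀ i, f (i + n) = f i) (a : ℕ) :
    ∑ i ∈ Finset.range (n * a), f i = a * ∑ i ∈ Finset.range n, f i := by
  have h' : ∀ a i, f (n * a + i) = f i := by
    intro a
    induction a with
    | zero => simp
    | succ a ih => intro i; rw [← ih i, ← h (n * a + i), Nat.mul_succ, add_right_comm]
  induction a with
  | zero => simp
  | succ a ih =>
    rw [Nat.mul_succ, Finset.sum_range_add, ih, Finset.sum_congr rfl fun i _ => h' a i,
      Nat.cast_succ, add_mul, one_mul]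

theorem cycleFlow_of_const {φ : ℝ} (h : IsCyclicState m k s)
    (hf : ∀ t, flow m k ((step m k)^[t] s) = φ) : cycleFlow m k s = φ := by
  have := Function.minimalPeriod_pos_of_mem_periodicPts h
  rw [cycleFlow, Finset.sum_congr rfl fun t _ => hf t, Finset.sum_const, Finset.card_range,
    nsmul_eq_mul]
  field_simp

/-- If the flow has period `n`, its average over the cycle is its average over `n` time steps. -/
theorem cycleFlow_of_periodic {n : ℕ} (hn : 0 < n) (h : IsCyclicState m k s)
    (hf : ∀ t, flow m k ((step m k)^[t + n] s) = flow m k ((step m k)^[t] s)) :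
    cycleFlow m k s = (∑ t ∈ Finset.range n, flow m k ((step m k)^[t] s)) / n := by
  have h0 := Function.minimalPeriod_pos_of_mem_periodicPts h
  -- Both averages are compared over the common period `n * minimalPeriod`.
  have h1 := sum_range_mul_of_periodic (f := fun t => flow m k ((step m k)^[t] s)) hf
    (Function.minimalPeriod (step m k) s)
  have h2 := sum_range_mul_of_periodic (f := fun t => flow m k ((step m k)^[t] s))
    (n := Function.minimalPeriod (step m k) s) (fun t => by
      rw [Function.iterate_add_apply, Function.iterate_minimalPeriod]) n
  rw [cycleFlow, div_eq_div_iff (by positivity) (by positivity), mul_comm, ← h2, mul_comm, h1,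
    mul_comm]

theorem CyclicProfile.newGroups_eq_zero (hm : 1 ≤ m) (hk : 1 ≤ k) (h : CyclicProfile m k s N P) :
    newGroups m k (initialString m k s) = 0 := by
  obtain ⟨r, hr⟩ := h.presents
  rw [hr.initialString_eq]
  rcases h.cases hm hk with h | h | h
  · refine newGroups_eq_zero_of_forall hm k _ (AddMonoidHom.snd ℤ ℤ) (fun _ _ h => h) ?_
    simp only [Cycle.mem_coe_iff, List.mem_map]
    rintro _ ⟨i, _, rfl⟩
    exact (h i).2
  all_goals
    refine newGroups_eq_zero_of_forall hm k _ (AddMonoidHom.fst ℤ ℤ) (fun _ h _ => h) ?_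
    simp only [Cycle.mem_coe_iff, List.mem_map]
    rintro _ ⟨i, _, rfl⟩
    exact (h i).1

theorem CyclicProfile.sum_succ (h : CyclicProfile m k s N P) {M : Type*} [AddCommMonoid M]
    (f : Symbol → M) (t : ℕ) :
    ∑ i ∈ Finset.range N, f (P (i + t)) = ∑ i ∈ Finset.range N, f (P i) := by
  induction t with
  | zero => rfl
  | succ t ih =>
    rw [← ih, ← sum_range_shift (f := fun i => f (P (i + t)))]
    · simp only [add_assoc, add_comm 1 t]
    · rw [add_comm, h.periodic, zero_add]

/-- With `n` cars and `z` empty sites the three terms are `m n`, `n z / N` and `k z`, divided by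
`L`. The signs in each regime compare `z` with `N m` and `n` with `N k`, and this decides which term
is the least. With a surplus of empty sites all cars move `m` sites; in a jam all empty sites are
crossed by `k` cars each. -/
theorem CyclicProfile.cycleFlow_eq (hm : 1 ≤ m) (hk : 1 ≤ k) (h : CyclicProfile m k s N P) :
    cycleFlow m k s = min ((m : ℝ) * density s)
      (min (density s * (1 - density s) / ((N : ℝ) / (L : ℝ))) ((k : ℝ) * (1 - density s))) := by
  have hd := h.density_eq
  have hL := h.length_eq
  set n : ℤ := ∑ i ∈ Finset.range N, ((P i).2 + (k : ℤ)) with hn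
  set z : ℤ := ∑ i ∈ Finset.range N, ((P i).1 + (m : ℤ)) with hz
  have hN : (0 : ℝ) < N := by exact_mod_cast h.pos
  have hL0 : (0 : ℝ) < L := by exact_mod_cast NeZero.pos L
  have hm0 : (0 : ℝ) < m := by exact_mod_cast hm
  have hk0 : (0 : ℝ) < k := by exact_mod_cast hk
  have hd' : 1 - density s = z / L := by
    rw [hd]; field_simp; linarith
  have hmid : density s * (1 - density s) / ((N : ℝ) / (L : ℝ)) = n * z / N / L := by
    rw [hd', hd]; field_simp
  have h1 : (m : ℝ) * density s = m * n / L := by rw [hd]; ring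
  have h2 : (k : ℝ) * (1 - density s) = k * z / L := by rw [hd']; ring
  rw [hmid, h1, h2]
  have hz0 : (0 : ℝ) ≤ z := by
    obtain ⟨r, hr⟩ := h.presents
    rw [hz]
    exact_mod_cast Finset.sum_nonneg fun i hi => (hr.2 (P i) (List.mem_map_of_mem
      (List.mem_range.2 (Finset.mem_range.1 hi)))).1.le
  have hn0 : (0 : ℝ) ≤ n := by
    obtain ⟨r, hr⟩ := h.presents
    rw [hn]
    exact_mod_cast Finset.sum_nonneg fun i hi => (hr.2 (P i) (List.mem_map_of_mem
      (List.mem_range.2 (Finset.mem_range.1 hi)))).2.le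
  have hzle : (∀ i, (P i).1 ≤ 0) → (z : ℝ) ≤ N * m := by
    intro h'
    have : z ≤ N * m := by
      rw [hz, ← Finset.card_range N, ← nsmul_eq_mul, Finset.card_range]
      exact (Finset.sum_le_card_nsmul _ _ (m : ℤ) fun i _ => by have := h' i; omega).trans_eq (by simp)
    exact_mod_cast this
  have hzge : (∀ i, 0 ≤ (P i).1) → (N * m : ℝ) ≤ z := by
    intro h'
    have : (N * m : ℤ) ≤ z := by
      rw [hz]
      refine le_trans (le_of_eq ?_)
        (Finset.card_nsmul_le_sum _ _ (m : ℤ) fun i _ => by have := h' i; omega)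
      simp
    exact_mod_cast this
  have hnle : (∀ i, (P i).2 ≤ 0) → (n : ℝ) ≤ N * k := by
    intro h'
    have : n ≤ N * k := by
      rw [hn]
      exact (Finset.sum_le_card_nsmul _ _ (k : ℤ) fun i _ => by have := h' i; omega).trans_eq (by simp)
    exact_mod_cast this
  have hnge : (∀ i, 0 ≤ (P i).2) → (N * k : ℝ) ≤ n := by
    intro h'
    have : (N * k : ℤ) ≤ n := by
      rw [hn]
      refine le_trans (le_of_eq ?_)
        (Finset.card_nsmul_le_sum _ _ (k : ℤ) fun i _ => by have := h' i; omega)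
      simp
    exact_mod_cast this
  rcases h.cases hm hk with hc | hc | hc
  · have hev : ∀ t, evolve^[t] P = P := by
      intro t
      refine Function.iterate_fixed (funext fun i => ?_) t
      have ha := hc i; have hb := hc (i + 1)
      ext
      · rw [h.evolve_fst hm hk]; omega
      · rw [h.evolve_snd hm hk]; omega
    rw [cycleFlow_of_const (φ := m * n / L) h.cyclic]
    · have e1 := hzge fun i => (hc i).1
      have e2 := hnle fun i => (hc i).2
      refine (min_eq_left (le_min ?_ ?_)).symm
      · rw [div_le_div_iff_of_pos_right hL0, le_div_iff₀ hN]
        nlinarith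
      · rw [div_le_div_iff_of_pos_right hL0]
        nlinarith
    · intro t
      rw [(h.iterate hm hk t).flow_eq, hev]
      congr 1
      have : (m : ℝ) * n = ((m * n : ℤ) : ℝ) := by push_cast; ring
      rw [this, hn, Finset.mul_sum]
      congr 1
      refine Finset.sum_congr rfl fun i _ => ?_
      rw [min_eq_right (hc i).2, min_eq_left (hc (i + 1)).1]; ring
  · have hev : ∀ t, evolve^[t] P = fun i => P (i + t) := by
      intro t
      induction t with
      | zero => rfl
      | succ t ih =>
        rw [Function.iterate_succ_apply', ih]
        funext i
        have hp := h.iterate hm hk t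
        rw [ih] at hp
        have ha := hc (i + t); have hb := hc (i + (t + 1))
        have e : i + 1 + t = i + (t + 1) := by ring
        ext
        · rw [hp.evolve_fst hm hk, e]; omega
        · rw [hp.evolve_snd hm hk, e]; omega
    rw [cycleFlow_of_const (φ := k * z / L) h.cyclic]
    · have e1 := hzle fun i => (hc i).1
      have e2 := hnge fun i => (hc i).2
      have e3 : k * z / L ≤ n * z / N / (L : ℝ) := by
        rw [div_le_div_iff_of_pos_right hL0, le_div_iff₀ hN]
        nlinarith
      rw [min_eq_right e3, min_eq_right]
      rw [div_le_div_iff_of_pos_right hL0]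
      nlinarith
    · intro t
      rw [(h.iterate hm hk t).flow_eq, hev]
      congr 1
      have : (k : ℝ) * z = ((k * z : ℤ) : ℝ) := by push_cast; ring
      rw [this, hz, ← h.sum_succ (fun p => p.1 + (m : ℤ)) (1 + t), Finset.mul_sum]
      congr 1
      refine Finset.sum_congr rfl fun i _ => ?_
      rw [← add_assoc, min_eq_left (hc _).2, min_eq_right (hc (i + 1 + t)).1]; ring
  -- Without surpluses the blocks of empty sites shift by one index per step, while the blocks of
  -- cars keep theirs.
  · have hev : ∀ t, evolve^[t] P = fun i => ((P (i + t)).1, (P i).2) := by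
      intro t
      induction t with
      | zero => rfl
      | succ t ih =>
        rw [Function.iterate_succ_apply', ih]
        funext i
        have hp := h.iterate hm hk t
        rw [ih] at hp
        have ha := hc (i + t); have hb := hc (i + (t + 1)); have hd := hc i; have he := hc (i + 1)
        have e : i + 1 + t = i + (t + 1) := by ring
        ext
        · rw [hp.evolve_fst hm hk]; simp only [e]; omega
        · rw [hp.evolve_snd hm hk]; simp only; omega
    have hfl : ∀ t, flow m k ((step m k)^[t] s) = ((∑ i ∈ Finset.range N,
        ((P i).2 + (k : ℤ)) * ((P (t + (i + 1))).1 + (m : ℤ)) : ℤ) : ℝ) / L := by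
      intro t
      rw [(h.iterate hm hk t).flow_eq, hev]
      congr 2
      refine Finset.sum_congr rfl fun i _ => ?_
      simp only
      rw [min_eq_right (hc i).2, min_eq_right (hc (i + 1 + t)).1, add_comm t]; ring
    rw [cycleFlow_of_periodic h.pos h.cyclic]
    · have e1 := hzle fun i => (hc i).1
      have e2 := hnle fun i => (hc i).2
      have e3 : n * z / N / (L : ℝ) ≤ k * z / L := by
        rw [div_le_div_iff_of_pos_right hL0, div_le_iff₀ hN]
        nlinarith
      have e4 : n * z / N / (L : ℝ) ≤ m * n / L := by
        rw [div_le_div_iff_of_pos_right hL0, div_le_iff₀ hN]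
        nlinarith
      rw [min_eq_left e3, min_eq_right e4, Finset.sum_congr rfl fun t _ => hfl t,
        ← Finset.sum_div, ← Int.cast_sum, Finset.sum_comm]
      -- At time `t` the cars of group `i` cross the empty block with index `t + i + 1`, so in `N`
      -- steps each pair of a car block and an empty block meets exactly once.
      have : ∑ i ∈ Finset.range N, ∑ t ∈ Finset.range N,
          ((P i).2 + (k : ℤ)) * ((P (t + (i + 1))).1 + (m : ℤ)) = n * z := by
        rw [hn, Finset.sum_mul]
        refine Finset.sum_congr rfl fun i _ => ?_
        rw [← Finset.mul_sum, h.sum_succ (fun p => p.1 + (m : ℤ))]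
      rw [this, Int.cast_mul]; ring
    · intro t
      rw [hfl, hfl]
      congr 2
      refine Finset.sum_congr rfl fun i _ => ?_
      rw [show t + N + (i + 1) = t + (i + 1) + N by ring, h.periodic]

end

/-! ### Conserved quantities and the state finally reached -/

theorem exists_cyclicProfile {m k L : ℕ} [NeZero L] {s : Road L} {r : ZMod L} {u : List Symbol}
    (h : IsCyclicState m k s) (hu : Presents m k s r u) :
    ∃ P, CyclicProfile m k s u.length P := by
  have hpos : 0 < u.length := List.length_pos_iff.2 hu.ne_nil
  refine ⟨fun i => u[i % u.length]'(Nat.mod_lt _ hpos), hpos, fun i => by simp, h, r, ?_⟩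
  convert hu
  apply List.ext_getElem
  · simp
  · intro i h1 h2
    simp [Nat.mod_eq_of_lt h2]

/-- Initial groups and new groups together are constant in time. -/
theorem length_add_newGroups_step {m k L : ℕ} [NeZero L] (hm : 1 ≤ m) (hk : 1 ≤ k) (s : Road L) :
    (initialString m k (step m k s)).length + newGroups m k (initialString m k (step m k s)) =
      (initialString m k s).length + newGroups m k (initialString m k s) := by
  by_cases h : ∃ v, s = fun _ => v
  · obtain ⟨v, rfl⟩ := h
    rw [step_constant]
  · obtain ⟨r, u, h⟩ := exists_presents m k h
    obtain ⟨r', h'⟩ := h.step hm hk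
    rw [h.initialString_eq, h'.initialString_eq, Cycle.length_coe, Cycle.length_coe,
      length_stepString, ← newGroups_stepString hm k u]
    omega

theorem length_add_newGroups_iterate {m k L : ℕ} [NeZero L] (hm : 1 ≤ m) (hk : 1 ≤ k) (s : Road L)
    (T : ℕ) : (initialString m k ((step m k)^[T] s)).length +
        newGroups m k (initialString m k ((step m k)^[T] s)) =
      (initialString m k s).length + newGroups m k (initialString m k s) := by
  induction T with
  | zero => rfl
  | succ T ih => rw [Function.iterate_succ_apply', length_add_newGroups_step hm hk, ih]

theorem Presents.iterate {m k L : ℕ} [NeZero L] (hm : 1 ≤ m) (hk : 1 ≤ k) {s : Road L}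
    {r : ZMod L} {u : List Symbol} (h : Presents m k s r u) (T : ℕ) :
    ∃ r u, Presents m k ((TrafficRule.step m k)^[T] s) r u := by
  induction T with
  | zero => exact ⟨r, u, h⟩
  | succ T ih =>
    obtain ⟨r, u, h⟩ := ih
    obtain ⟨r', h'⟩ := h.step hm hk
    exact ⟨r', _, by rwa [Function.iterate_succ_apply']⟩

theorem card_cars_eq_count {L : ℕ} [NeZero L] (s : Road L) (r : ZMod L) :
    (Finset.univ.filter fun i : ZMod L => s i = true).card = (readFrom s r).count true := by
  rw [Finset.card_filter, ← sum_readFrom _ r]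
  have : readFrom (fun i => if s i = true then 1 else 0) r =
      (readFrom s r).map fun v => if v = true then 1 else 0 := by
    simp [readFrom]
  rw [this]
  induction readFrom s r with
  | nil => rfl
  | cons v l ih => cases v <;> simp [ih, add_comm]

theorem Presents.density_step {m k L : ℕ} [NeZero L] {s : Road L} {r : ZMod L} {u : List Symbol}
    (h : Presents m k s r u) : density (TrafficRule.step m k s) = density s := by
  obtain ⟨p, t, rfl⟩ := List.exists_cons_of_ne_nil h.ne_nil
  have hb := h.blocks_true
  rw [density, density, card_cars_eq_count _ (r + ((p.1 + m).toNat : ZMod L)),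
    card_cars_eq_count s (r + ((p.1 + m).toNat : ZMod L)), hb.readFrom_step, hb.1]
  congr 2
  generalize linkFrom _ p _ = bs
  induction bs with
  | nil => rfl
  | cons b bs ih =>
    simp only [twoWord, List.flatMap_cons, List.count_append] at ih ⊢
    rw [ih]
    simp [movedBlock, twoBlock, List.count_replicate]

theorem density_iterate {m k L : ℕ} [NeZero L] (s : Road L) (T : ℕ) :
    density ((step m k)^[T] s) = density s := by
  induction T with
  | zero => rfl
  | succ T ih =>
    rw [Function.iterate_succ_apply', ← ih]
    by_cases h : ∃ v, (step m k)^[T] s = fun _ => v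
    · obtain ⟨v, hv⟩ := h
      rw [hv, step_constant]
    · obtain ⟨r, u, h⟩ := exists_presents m k h
      exact h.density_step

theorem exists_isCyclicState {m k L : ℕ} [NeZero L] (s : Road L) :
    ∃ T : ℕ, IsCyclicState m k ((step m k)^[T] s) := by
  obtain ⟨a, b, hab, h⟩ := Finite.exists_ne_map_eq_of_infinite fun t => (step m k)^[t] s
  wlog hlt : a < b generalizing a b
  · exact this b a hab.symm h.symm (by omega)
  refine ⟨a, b - a, by omega, ?_⟩
  rw [Function.IsPeriodicPt, Function.IsFixedPt, ← Function.iterate_add_apply,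
    Nat.sub_add_cancel hlt.le]
  exact h.symm

/-- The number of groups and the flow of the cyclic states that evolve from `s`. -/
theorem groups_and_cycleFlow {m k L : ℕ} [NeZero L] (hm : 1 ≤ m) (hk : 1 ≤ k) (s : Road L) (g : ℕ)
    (w : Cycle Symbol) (hw : MaximalApplication m k (initialString m k s) g w) (T : ℕ)
    (hT : IsCyclicState m k ((step m k)^[T] s)) :
    groups ((step m k)^[T] s) = (initialString m k s).length + g ∧
    cycleFlow m k ((step m k)^[T] s) =
      min ((m : ℝ) * density s)
        (min (density s * (1 - density s) /
            ((((initialString m k s).length + g : ℕ) : ℝ) / (L : ℝ)))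
          ((k : ℝ) * (1 - density s))) := by
  by_cases h : ∃ v, s = fun _ => v
  · obtain ⟨v, rfl⟩ := h
    have h0 : ∀ t, (step m k)^[t] (fun _ => v : Road L) = fun _ => v :=
      Function.iterate_fixed (step_constant m k v)
    rw [h0] at hT ⊢
    rw [← newGroups_eq hm hw, initialString_constant, groups_constant,
      newGroups_eq hm (w' := Cycle.nil) ⟨Replaces.refl _, ?_⟩]
    · refine ⟨rfl, ?_⟩
      have h1 : ∀ t, flow m k ((step m k)^[t] (fun _ => v : Road L)) = 0 := by
        intro t
        rw [h0]; simp [flow, displacement_constant]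
      rw [cycleFlow_of_const hT h1]
      have hL0 : (L : ℝ) ≠ 0 := by exact_mod_cast NeZero.ne L
      -- For equal sites the factor `ρ (1 - ρ)` vanishes and `N_G` is zero; as division by zero
      -- gives zero, the middle term is zero, and so are the minimum and the flow.
      have h2 : density (fun _ => v : Road L) = if v then 1 else 0 := by
        cases v <;> simp [density, hL0]
      rw [h2]
      cases v <;> simp
    · intro d w' hr
      have := hr.potential_lt hm
      simp [cyclePotential] at this
  · obtain ⟨r, u, hu⟩ := exists_presents m k h
    obtain ⟨r', u', hu'⟩ := hu.iterate hm hk T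
    obtain ⟨P, hP⟩ := exists_cyclicProfile hT hu'
    have h1 := length_add_newGroups_iterate hm hk s T
    rw [hP.newGroups_eq_zero hm hk, newGroups_eq hm hw, hu'.initialString_eq, Cycle.length_coe,
      add_zero] at h1
    rw [← h1, hu'.groups_eq, hP.cycleFlow_eq hm hk, density_iterate]
    exact ⟨rfl, rfl⟩

/-! ### A long transient: the dissolution of one large block of cars -/

/-- Among neutral groups a `◇` only loses `m` empty sites and `k` cars, and these form one more
neutral group. -/
theorem stepString_dissolve (m k : ℕ) {p : Symbol} (hp : 0 < p.1) (hp' : 0 < p.2) (t : ℕ) :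
    stepString m k (p :: List.replicate t 0) = shrink m k p :: List.replicate (t + 1) 0 := by
  have hl : leftPart p = 0 := if_pos hp
  have hr : rightPart p = 0 := if_pos hp'
  have hl0 : leftPart 0 = 0 := by simp [leftPart]
  have hr0 : rightPart 0 = 0 := by simp [rightPart]
  have key : ∀ t, linkFrom (fun p q => core m k p ++ [rightPart p + leftPart q]) 0
      (List.replicate t 0 ++ [p]) = List.replicate (t + 1) 0 := by
    intro t
    induction t with
    | zero => simp [linkFrom, core, hr0, hl]
    | succ t ih =>
      rw [List.replicate_succ, List.cons_append, linkFrom, ih, List.replicate_succ (n := t + 1)]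
      simp [core, hr0, hl0]
  cases t with
  | zero => simp [stepString, link, linkFrom, core, hp, hp', hl, hr]
  | succ t =>
    rw [stepString, link, List.replicate_succ, List.cons_append, linkFrom, key,
      List.replicate_succ (n := t + 1)]
    simp [core, hp, hp', hr, hl0]

/-- The road with one block of cars, behind `y` empty sites. -/
def oneBlock (L y : ℕ) : Road L := fun j => decide (y ≤ j.val)

theorem presents_oneBlock (m k : ℕ) {L y : ℕ} [NeZero L] (hy : 0 < y) (hy' : y < L) :
    Presents m k (oneBlock L y) 0 [((y : ℤ) - m, ((L - y : ℕ) : ℤ) - k)] := by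
  constructor
  · apply List.ext_getElem
    · simp [twoWord, sizes]; omega
    · intro i h1 h2
      rw [length_readFrom] at h1
      rw [getElem_readFrom, zero_add, oneBlock, ZMod.val_natCast_of_lt h1]
      simp only [twoWord, twoBlock, sizes, List.map_cons, List.map_nil, List.flatMap_cons,
        List.flatMap_nil, List.append_nil, List.getElem_append, List.length_replicate,
        List.getElem_replicate]
      split_ifs with h
      · simp at h ⊢; omega
      · simp at h ⊢; omega
  · simp [Valid]; omega

/-- The factor is `t + 1`, not `t`, because the indices of a symbol already have `m` and `k`
subtracted at time zero. For `t < T` the first symbol is a `◇`. -/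
theorem presents_iterate_oneBlock {m k : ℕ} (hm : 1 ≤ m) (hk : 1 ≤ k) {L y : ℕ} [NeZero L]
    {T : ℕ} (hT : T * m < y) (hT' : T * k < L - y) {t : ℕ} (ht : t ≤ T) :
    ∃ r, Presents m k ((step m k)^[t] (oneBlock L y)) r
      (((y : ℤ) - (t + 1) * m, ((L - y : ℕ) : ℤ) - (t + 1) * k) :: List.replicate t 0) := by
  induction t with
  | zero => exact ⟨0, by simpa using presents_oneBlock m k (L := L) (y := y) (by omega) (by omega)⟩
  | succ t ih =>
    obtain ⟨r, h⟩ := ih (by omega)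
    obtain ⟨r', h'⟩ := h.step hm hk
    have h1 : (t + 1) * m ≤ T * m := Nat.mul_le_mul_right _ ht
    have h2 : (t + 1) * k ≤ T * k := Nat.mul_le_mul_right _ ht
    zify at h1 h2 hT
    have h3 : ((T * k : ℕ) : ℤ) < ((L - y : ℕ) : ℤ) := by exact_mod_cast hT'
    push_cast at h3
    rw [stepString_dissolve m k (by simp only; linarith) (by simp only; linarith)] at h'
    refine ⟨r', ?_⟩
    rw [Function.iterate_succ_apply']
    convert h' using 2
    simp only [shrink]
    push_cast
    ext <;> simp only <;> ring

/-- Each of the first `T` steps creates a group, but a step from a cyclic state creates none. -/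
theorem le_transientTime_oneBlock {m k : ℕ} (hm : 1 ≤ m) (hk : 1 ≤ k) {L y : ℕ} [NeZero L]
    {T : ℕ} (hT : T * m < y) (hT' : T * k < L - y) : T ≤ transientTime m k (oneBlock L y) := by
  by_contra hlt
  push Not at hlt
  have h : IsCyclicState m k ((step m k)^[transientTime m k (oneBlock L y)] (oneBlock L y)) :=
    Nat.sInf_mem (exists_isCyclicState (oneBlock L y))
  obtain ⟨r, h1⟩ := presents_iterate_oneBlock hm hk hT hT' hlt.le
  obtain ⟨r', h2⟩ := presents_iterate_oneBlock hm hk hT hT' (Nat.succ_le_of_lt hlt)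
  have h3 := h.groups_step hm hk
  rw [h1.groups_eq, ← Function.iterate_succ_apply' (step m k), h2.groups_eq] at h3
  simp at h3

theorem exists_quadratic_transient {m k : ℕ} (hm : 1 ≤ m) (hk : 1 ≤ k) :
    ∃ c : ℝ, 0 < c ∧ ∃ L₀ : ℕ, ∀ (L : ℕ) [NeZero L], L₀ ≤ L →
      ∃ s : Road L, c * (L : ℝ) ^ 2 ≤ (directSimulationTime m k s : ℝ) := by
  refine ⟨1 / (8 * (m + k)), by positivity, 8 * (m + k), fun L _ hL => ?_⟩
  refine ⟨oneBlock L (L / 2), ?_⟩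
  -- This choice gives `T m ≤ L / 4` and `T k ≤ L / 4`, safely below the two block lengths of about
  -- `L / 2`. The bound `L ≥ 8 (m + k)` makes `T` positive, so rounding costs at most a factor `2`.
  set T := L / (4 * (m + k)) with hT
  have h1 : T * (4 * (m + k)) ≤ L := Nat.div_mul_le_self _ _
  have h2 : L < (T + 1) * (4 * (m + k)) := by
    rw [add_mul, one_mul]; exact Nat.lt_div_mul_add (by omega)
  have h3 : T * m * 4 ≤ L := by nlinarith
  have h4 : T * k * 4 ≤ L := by nlinarith
  have h5 := le_transientTime_oneBlock hm hk (L := L) (y := L / 2) (T := T) (by omega) (by omega)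
  have h6 : L ≤ 8 * (m + k) * T := by nlinarith
  have h7 : (L : ℝ) ≤ 8 * (m + k) * T := by exact_mod_cast h6
  have h8 : (T : ℝ) ≤ transientTime m k (oneBlock L (L / 2)) := by exact_mod_cast h5
  have h9 : (0 : ℝ) < 8 * (m + k) := by positivity
  rw [directSimulationTime, Nat.cast_mul, one_div, inv_mul_le_iff₀ h9]
  have h10 : (L : ℝ) ≤ 8 * (m + k) * transientTime m k (oneBlock L (L / 2)) :=
    h7.trans (mul_le_mul_of_nonneg_left h8 h9.le)
  nlinarith [Nat.cast_nonneg (α := ℝ) L]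

/-! ### Running time of stack programs -/

/-- `P` started in `σ` halts in `τ` after at most `T` operations. -/
def Within (W : ℤ) (P : Program) (σ : Store) (T : ℕ) (τ : Store) : Prop :=
  ∃ t ≤ T, Exec W P σ t τ

/-- The store with the registers `R`, the stacks `S` and the input `I`. -/
def mem (R : List ℤ) (S : List (List ℤ)) (I : List Bool) : Store where
  reg := fun i => R.getD i 0
  stack := fun i => S.getD i []
  input := I

theorem update_getD {α : Type*} (l : List α) (d z : α) {i : ℕ} (hi : i < l.length) :
    Function.update (fun j => l.getD j d) i z = fun j => (l.set i z).getD j d := by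
  funext j
  by_cases h : j = i
  · subst h
    simp [List.getD_eq_getElem?_getD, hi]
  · rw [Function.update_of_ne h, List.getD_eq_getElem?_getD, List.getD_eq_getElem?_getD,
      List.getElem?_set_ne (Ne.symm h)]

section

variable {W : ℤ} {R : List ℤ} {S : List (List ℤ)} {I : List Bool}

theorem mem_set {r : ℕ} (z : ℤ) (hr : r < R.length) : (mem R S I).set r z = mem (R.set r z) S I := by
  simp only [mem, Store.set, update_getD R 0 z hr]

theorem mem_setStack {i : ℕ} (l : List ℤ) (hi : i < S.length) :
    (mem R S I).setStack i l = mem R (S.set i l) I := by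
  simp only [mem, Store.setStack, update_getD S [] l hi]

theorem Within.mono {P : Program} {σ σ' : Store} {T T' : ℕ} (h : Within W P σ T σ') (hT : T ≤ T') :
    Within W P σ T' σ' := by
  obtain ⟨t, ht, h⟩ := h
  exact ⟨t, ht.trans hT, h⟩

theorem Within.seq {c d : Program} {σ σ' σ'' : Store} {T T' : ℕ} (h : Within W c σ T σ')
    (h' : Within W d σ' T' σ'') : Within W (.seq c d) σ (T + T') σ'' := by
  obtain ⟨t, ht, h⟩ := h
  obtain ⟨t', ht', h'⟩ := h'
  exact ⟨t + t', by omega, h.seq h'⟩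

theorem Within.const (r : ℕ) (z : ℤ) (hz : |z| ≤ W)
    (hr : r < R.length := by simp only [List.length_cons, List.length_set]; omega) :
    Within W (.const r z) (mem R S I) 1 (mem (R.set r z) S I) :=
  ⟨1, le_rfl, by rw [← mem_set z hr]; exact Exec.const _ r z hz⟩

theorem Within.add (r p q : ℕ) (hz : |R.getD p 0 + R.getD q 0| ≤ W)
    (hr : r < R.length := by simp only [List.length_cons, List.length_set]; omega) :
    Within W (.add r p q) (mem R S I) 1 (mem (R.set r (R.getD p 0 + R.getD q 0)) S I) :=
  ⟨1, le_rfl, by rw [← mem_set _ hr]; exact Exec.add _ r p q hz⟩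

theorem Within.sub (r p q : ℕ) (hz : |R.getD p 0 - R.getD q 0| ≤ W)
    (hr : r < R.length := by simp only [List.length_cons, List.length_set]; omega) :
    Within W (.sub r p q) (mem R S I) 1 (mem (R.set r (R.getD p 0 - R.getD q 0)) S I) :=
  ⟨1, le_rfl, by rw [← mem_set _ hr]; exact Exec.sub _ r p q hz⟩

theorem Within.read_site (r : ℕ) (v : Bool)
    (hr : r < R.length := by simp only [List.length_cons, List.length_set]; omega) :
    Within W (.read r) (mem R S (v :: I)) 1 (mem (R.set r (if v then 1 else 0)) S I) :=
  ⟨1, le_rfl, by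
    have := Exec.read_site (W := W) (mem R S (v :: I)) r v I rfl
    rwa [mem_set _ hr] at this⟩

theorem Within.read_end (r : ℕ)
    (hr : r < R.length := by simp only [List.length_cons, List.length_set]; omega) :
    Within W (.read r) (mem R S []) 1 (mem (R.set r (-1)) S []) :=
  ⟨1, le_rfl, by rw [← mem_set _ hr]; exact Exec.read_end _ r rfl⟩

theorem Within.push (i r : ℕ)
    (hi : i < S.length := by simp only [List.length_cons, List.length_set]; omega) :
    Within W (.push i r) (mem R S I) 1 (mem R (S.set i (R.getD r 0 :: S.getD i [])) I) :=
  ⟨1, le_rfl, by rw [← mem_setStack _ hi]; exact Exec.push _ i r⟩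

theorem Within.pop (i r : ℕ) (z : ℤ) (l : List ℤ) (h : S.getD i [] = z :: l)
    (hr : r < R.length := by simp only [List.length_cons, List.length_set]; omega)
    (hi : i < S.length := by simp only [List.length_cons, List.length_set]; omega) :
    Within W (.pop i r) (mem R S I) 1 (mem (R.set r z) (S.set i l) I) :=
  ⟨1, le_rfl, by rw [← mem_setStack _ hi, ← mem_set _ hr]; exact Exec.pop _ i r z l h⟩

theorem Within.if_pos {r : ℕ} {c d : Program} {σ' : Store} {T : ℕ} (h : 0 < R.getD r 0)
    (h' : Within W c (mem R S I) T σ') : Within W (.ifPos r c d) (mem R S I) (T + 1) σ' := by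
  obtain ⟨t, ht, h'⟩ := h'
  exact ⟨t + 1, by omega, Exec.if_pos h h'⟩

theorem Within.if_not {r : ℕ} {c d : Program} {σ' : Store} {T : ℕ} (h : R.getD r 0 ≤ 0)
    (h' : Within W d (mem R S I) T σ') : Within W (.ifPos r c d) (mem R S I) (T + 1) σ' := by
  obtain ⟨t, ht, h'⟩ := h'
  exact ⟨t + 1, by omega, Exec.if_not (not_lt.2 h) h'⟩

theorem Within.while_pos {r : ℕ} {c : Program} {σ' σ'' : Store} {T T' : ℕ} (h : 0 < R.getD r 0)
    (h₁ : Within W c (mem R S I) T σ') (h₂ : Within W (.whilePos r c) σ' T' σ'') :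
    Within W (.whilePos r c) (mem R S I) (T + T' + 1) σ'' := by
  obtain ⟨t, ht, h₁⟩ := h₁
  obtain ⟨t', ht', h₂⟩ := h₂
  exact ⟨t + t' + 1, by omega, Exec.while_pos h h₁ h₂⟩

theorem Within.while_not {r : ℕ} {c : Program} (h : R.getD r 0 ≤ 0) :
    Within W (.whilePos r c) (mem R S I) 1 (mem R S I) :=
  ⟨1, le_rfl, Exec.while_not (not_lt.2 h)⟩

end

/-! ### Sequences of replacements inside of a linear string -/

inductive LinearReplaces (m k : ℕ) : List Symbol → ℕ → List Symbol → Prop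
  | refl (u : List Symbol) : LinearReplaces m k u 0 u
  | head {u u' u'' : List Symbol} {d g : ℕ} : LinearReplace m k u d u' →
      LinearReplaces m k u' g u'' → LinearReplaces m k u (d + g) u''

theorem LinearReplaces.trans {m k g g' : ℕ} {u u' u'' : List Symbol}
    (h : LinearReplaces m k u g u') (h' : LinearReplaces m k u' g' u'') :
    LinearReplaces m k u (g + g') u'' := by
  induction h with
  | refl => simpa using h'
  | head hr _ ih => rw [add_assoc]; exact LinearReplaces.head hr (ih h')

theorem LinearReplaces.append_left {m k g : ℕ} {u u' : List Symbol} (h : LinearReplaces m k u g u')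
    (x : List Symbol) : LinearReplaces m k (x ++ u) g (x ++ u') := by
  induction h with
  | refl => exact LinearReplaces.refl _
  | head hr _ ih => exact LinearReplaces.head (by simpa using hr.append x []) ih

theorem LinearReplaces.replaces {m k g : ℕ} {u u' : List Symbol} (h : LinearReplaces m k u g u') :
    Replaces m k (u : Cycle Symbol) g (u' : Cycle Symbol) := by
  induction h with
  | refl => exact Replaces.refl _
  | head hr _ ih => exact ih.head hr.replace

/-- A bound for the indices of a symbol that survives the replacements. -/
def symbolWeight (m k : ℕ) (p : Symbol) : ℤ := |p.1| + |p.2| + (max p.1 0 + 1) * (m + k)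

def weight (m k : ℕ) (u : List Symbol) : ℤ := (u.map (symbolWeight m k)).sum

@[simp] theorem weight_nil (m k : ℕ) : weight m k [] = 0 := rfl

@[simp] theorem weight_cons (m k : ℕ) (p : Symbol) (u : List Symbol) :
    weight m k (p :: u) = symbolWeight m k p + weight m k u := by simp [weight]

@[simp] theorem weight_append (m k : ℕ) (u v : List Symbol) :
    weight m k (u ++ v) = weight m k u + weight m k v := by simp [weight]

theorem abs_add_abs_le_symbolWeight (m k : ℕ) (p : Symbol) : |p.1| + |p.2| ≤ symbolWeight m k p := by
  have : 0 ≤ (max p.1 0 + 1) * ((m : ℤ) + k) := by positivity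
  rw [symbolWeight]; omega

theorem symbolWeight_nonneg (m k : ℕ) (p : Symbol) : 0 ≤ symbolWeight m k p :=
  le_trans (by positivity) (abs_add_abs_le_symbolWeight m k p)

theorem weight_nonneg (m k : ℕ) (u : List Symbol) : 0 ≤ weight m k u := by
  induction u with
  | nil => simp
  | cons p u ih => rw [weight_cons]; have := symbolWeight_nonneg m k p; omega

/-- A division may increase the absolute values by `m + k`, but it lowers `max p.1 0` by at least
one, which releases a summand `m + k`. -/
theorem symbolWeight_shrink_le {m k : ℕ} (hm : 1 ≤ m) {p : Symbol} (hp : 0 < p.1) :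
    symbolWeight m k (shrink m k p) ≤ symbolWeight m k p := by
  have h1 : max (p.1 - m) 0 + 1 ≤ max p.1 0 := by omega
  have h2 : (max (p.1 - m) 0 + 1) * ((m : ℤ) + k) ≤ max p.1 0 * (m + k) :=
    mul_le_mul_of_nonneg_right h1 (by positivity)
  have h3 : |p.1 - m| ≤ |p.1| + m := (abs_sub _ _).trans (by simp)
  have h4 : |p.2 - k| ≤ |p.2| + k := (abs_sub _ _).trans (by simp)
  simp only [symbolWeight, shrink]
  rw [add_mul _ 1]
  linarith

theorem symbolWeight_add_le (m k : ℕ) (p q : Symbol) :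
    symbolWeight m k (p + q) ≤ symbolWeight m k p + symbolWeight m k q := by
  have h1 : max (p.1 + q.1) 0 + 1 ≤ (max p.1 0 + 1) + (max q.1 0 + 1) := by omega
  have h2 := mul_le_mul_of_nonneg_right h1 (show 0 ≤ (m : ℤ) + k by positivity)
  have h3 := abs_add_le p.1 q.1
  have h4 := abs_add_le p.2 q.2
  simp only [symbolWeight, Prod.fst_add, Prod.snd_add]
  linarith

theorem LinearReplace.weight_le {m k d : ℕ} (hm : 1 ≤ m) {u u' : List Symbol}
    (h : LinearReplace m k u d u') : weight m k u' ≤ weight m k u := by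
  cases h with
  | diamond u v p h h' =>
    have := symbolWeight_shrink_le (k := k) hm h
    simp only [weight_append, weight_cons]; omega
  | merge u v p q h h' =>
    have := symbolWeight_add_le m k p q
    simp only [weight_append, weight_cons]; omega

theorem LinearReplace.potential_add_le {m k d : ℕ} (hm : 1 ≤ m) {u u' : List Symbol}
    (h : LinearReplace m k u d u') : potential u' + 1 ≤ potential u ∧ d ≤ 1 := by
  refine ⟨by simpa using h.replace.potential_lt hm, ?_⟩
  cases h <;> simp

theorem LinearReplaces.weight_le {m k g : ℕ} (hm : 1 ≤ m) {u u' : List Symbol}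
    (h : LinearReplaces m k u g u') : weight m k u' ≤ weight m k u := by
  induction h with
  | refl => exact le_rfl
  | head hr _ ih => exact ih.trans (hr.weight_le hm)

theorem LinearReplaces.potential_add_le {m k g : ℕ} (hm : 1 ≤ m) {u u' : List Symbol}
    (h : LinearReplaces m k u g u') : potential u' + g ≤ potential u := by
  induction h with
  | refl => exact le_rfl
  | head hr _ ih => have := hr.potential_add_le hm; omega

theorem length_le_potential (u : List Symbol) : u.length ≤ potential u := by
  induction u with
  | nil => simp
  | cons p u ih => simp only [List.length_cons, potential_cons, symbolPotential]; omega

/-! ### Insertion of a symbol -/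

@[simp] theorem encode_nil : encode [] = [] := rfl

@[simp] theorem encode_cons (p : Symbol) (u : List Symbol) :
    encode (p :: u) = p.1 :: p.2 :: encode u := rfl

set_option linter.unusedSimpArgs false

/-- Push the symbol in registers 3 and 4 on stack `i`, whose size is in register `n`. -/
def pushSymbol (i n : ℕ) : Program :=
  .seq (.push i 4) (.seq (.push i 3) (.seq (.add n n 2) (.const 8 0)))

/-- Registers: `0`, `1` hold `m`, `k`; `2` holds `1`; `3`, `4` hold the current symbol; `5`, `6` the
sizes of stacks 0 and 1; `7` counts groups; `8` is the loop flag; `9` is scratch. The cases are: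
divide a `◇`; keep a `1`; join a symbol with nonpositive second index with the top of stack 0, whose
first index is never positive; and, if stack 0 is empty, keep a `0` on stack 1 or a `⋆` on stack 0.
-/
def insertBody : Program :=
  .ifPos 4
    (.ifPos 3 (.seq (.sub 3 3 0) (.seq (.sub 4 4 1) (.add 7 7 2))) (pushSymbol 0 5))
    (.ifPos 5
      (.seq (.pop 0 9) (.seq (.add 3 3 9) (.seq (.pop 0 9) (.seq (.add 4 4 9) (.sub 5 5 2)))))
      (.ifPos 3 (pushSymbol 1 6) (pushSymbol 0 5)))

/-- Put the symbol in registers 3 and 4 before the string on stacks 0 and 1 and apply the rules. -/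
def insertSymbol : Program := .seq (.const 8 1) (.whilePos 8 insertBody)

/-- The string on stack 0: symbols `1`, and at the end possibly a `⋆`. -/
def JamShape : List Symbol → Prop
  | [] => True
  | p :: u => p.1 ≤ 0 ∧ (0 < p.2 ∨ u = []) ∧ JamShape u

theorem Within.push_jam {W : ℤ} (m k a b n l N f q : ℤ) (R : List ℤ) (S A B : List ℤ) (I : List Bool)
    (hW : 0 ≤ W) (hn : |n + 1| ≤ W) : Within W (pushSymbol 0 5)
      (mem (m :: k :: 1 :: a :: b :: n :: l :: N :: f :: q :: R) [S, A, B] I) 4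
      (mem (m :: k :: 1 :: a :: b :: (n + 1) :: l :: N :: 0 :: q :: R) [a :: b :: S, A, B] I) := by
  refine Within.seq (T := 1) (T' := 3) (Within.push 0 4) ?_
  simp only [List.set_cons_succ, List.set_cons_zero, List.getD_cons_succ, List.getD_cons_zero]
  refine Within.seq (T := 1) (T' := 2) (Within.push 0 3) ?_
  simp only [List.set_cons_succ, List.set_cons_zero, List.getD_cons_succ, List.getD_cons_zero]
  refine Within.seq (T := 1) (T' := 1) (Within.add 5 5 2 hn) ?_
  simp only [List.set_cons_succ, List.set_cons_zero, List.getD_cons_succ, List.getD_cons_zero]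
  exact Within.const 8 0 (by simpa using hW)

theorem Within.push_free {W : ℤ} (m k a b n l N f q : ℤ) (R : List ℤ) (S A B : List ℤ) (I : List Bool)
    (hW : 0 ≤ W) (hl : |l + 1| ≤ W) : Within W (pushSymbol 1 6)
      (mem (m :: k :: 1 :: a :: b :: n :: l :: N :: f :: q :: R) [S, A, B] I) 4
      (mem (m :: k :: 1 :: a :: b :: n :: (l + 1) :: N :: 0 :: q :: R) [S, a :: b :: A, B] I) := by
  refine Within.seq (T := 1) (T' := 3) (Within.push 1 4) ?_
  simp only [List.set_cons_succ, List.set_cons_zero, List.getD_cons_succ, List.getD_cons_zero]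
  refine Within.seq (T := 1) (T' := 2) (Within.push 1 3) ?_
  simp only [List.set_cons_succ, List.set_cons_zero, List.getD_cons_succ, List.getD_cons_zero]
  refine Within.seq (T := 1) (T' := 1) (Within.add 6 6 2 hl) ?_
  simp only [List.set_cons_succ, List.set_cons_zero, List.getD_cons_succ, List.getD_cons_zero]
  exact Within.const 8 0 (by simpa using hW)

section

variable {W : ℤ} {m k a b n l N q : ℤ} {R : List ℤ} {S A B : List ℤ} {I : List Bool}

theorem Within.insert_diamond (ha : 0 < a) (hb : 0 < b) (h₁ : |a - m| ≤ W) (h₂ : |b - k| ≤ W)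
    (h₃ : |N + 1| ≤ W) : Within W insertBody
      (mem (m :: k :: 1 :: a :: b :: n :: l :: N :: 1 :: q :: R) [S, A, B] I) 5
      (mem (m :: k :: 1 :: (a - m) :: (b - k) :: n :: l :: (N + 1) :: 1 :: q :: R) [S, A, B] I) := by
  rw [insertBody]
  refine Within.if_pos (T := 4) hb ?_
  refine Within.if_pos (T := 3) ha ?_
  refine Within.seq (T := 1) (T' := 2) (Within.sub 3 3 0 h₁) ?_
  simp only [List.set_cons_succ, List.set_cons_zero, List.getD_cons_succ, List.getD_cons_zero]
  refine Within.seq (T := 1) (T' := 1) (Within.sub 4 4 1 h₂) ?_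
  simp only [List.set_cons_succ, List.set_cons_zero, List.getD_cons_succ, List.getD_cons_zero]
  exact Within.add 7 7 2 h₃

theorem Within.insert_join {a' b' : ℤ} (hb : b ≤ 0) (hn : 0 < n) (h₁ : |a + a'| ≤ W)
    (h₂ : |b + b'| ≤ W) (h₃ : |n - 1| ≤ W) : Within W insertBody
      (mem (m :: k :: 1 :: a :: b :: n :: l :: N :: 1 :: q :: R) [a' :: b' :: S, A, B] I) 7
      (mem (m :: k :: 1 :: (a + a') :: (b + b') :: (n - 1) :: l :: N :: 1 :: b' :: R) [S, A, B] I) := by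
  rw [insertBody]
  refine Within.if_not (T := 6) hb ?_
  refine Within.if_pos (T := 5) hn ?_
  refine Within.seq (T := 1) (T' := 4) (Within.pop 0 9 _ _ rfl) ?_
  simp only [List.set_cons_succ, List.set_cons_zero, List.getD_cons_succ, List.getD_cons_zero]
  refine Within.seq (T := 1) (T' := 3) (Within.add 3 3 9 h₁) ?_
  simp only [List.set_cons_succ, List.set_cons_zero, List.getD_cons_succ, List.getD_cons_zero]
  refine Within.seq (T := 1) (T' := 2) (Within.pop 0 9 _ _ rfl) ?_
  simp only [List.set_cons_succ, List.set_cons_zero, List.getD_cons_succ, List.getD_cons_zero]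
  refine Within.seq (T := 1) (T' := 1) (Within.add 4 4 9 h₂) ?_
  simp only [List.set_cons_succ, List.set_cons_zero, List.getD_cons_succ, List.getD_cons_zero]
  exact Within.sub 5 5 2 h₃

theorem Within.insert_one (ha : a ≤ 0) (hb : 0 < b) (hW : 0 ≤ W) (h : |n + 1| ≤ W) :
    Within W insertBody (mem (m :: k :: 1 :: a :: b :: n :: l :: N :: 1 :: q :: R) [S, A, B] I) 6
      (mem (m :: k :: 1 :: a :: b :: (n + 1) :: l :: N :: 0 :: q :: R) [a :: b :: S, A, B] I) :=
  Within.if_pos (T := 5) hb <| Within.if_not (T := 4) ha <|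
    Within.push_jam _ _ _ _ _ _ _ _ _ _ _ _ _ _ hW h

theorem Within.insert_star (ha : a ≤ 0) (hb : b ≤ 0) (hn : n ≤ 0) (hW : 0 ≤ W) (h : |n + 1| ≤ W) :
    Within W insertBody (mem (m :: k :: 1 :: a :: b :: n :: l :: N :: 1 :: q :: R) [S, A, B] I) 7
      (mem (m :: k :: 1 :: a :: b :: (n + 1) :: l :: N :: 0 :: q :: R) [a :: b :: S, A, B] I) :=
  Within.if_not (T := 6) hb <| Within.if_not (T := 5) hn <| Within.if_not (T := 4) ha <|
    Within.push_jam _ _ _ _ _ _ _ _ _ _ _ _ _ _ hW h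

theorem Within.insert_zero (ha : 0 < a) (hb : b ≤ 0) (hn : n ≤ 0) (hW : 0 ≤ W) (h : |l + 1| ≤ W) :
    Within W insertBody (mem (m :: k :: 1 :: a :: b :: n :: l :: N :: 1 :: q :: R) [S, A, B] I) 7
      (mem (m :: k :: 1 :: a :: b :: n :: (l + 1) :: N :: 0 :: q :: R) [S, a :: b :: A, B] I) :=
  Within.if_not (T := 6) hb <| Within.if_not (T := 5) hn <| Within.if_pos (T := 4) ha <|
    Within.push_free _ _ _ _ _ _ _ _ _ _ _ _ _ _ hW h

end

/-- Amortized cost: an iteration that applies a rule takes at most 8 operations and lowers the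
potential by one or more; the last iteration and the final test take at most 9. The last three
clauses serve to close the circle: a `0` reaches stack 1 only while stack 0 is empty; a symbol with
nonpositive first index stays one after all joins and never touches stack 1; and a `⋆` can survive
only as the sole symbol on stack 0 if there was none before. -/
theorem Within.insert_loop {m k : ℕ} (hm : 1 ≤ m) {W : ℤ} (hW : 1 ≤ W) (p : Symbol)
    (S A : List Symbol) (N q : ℤ) (R : List ℤ) (B : List ℤ) (I : List Bool)
    (hS : JamShape S) (hA : ∀ p ∈ A, 0 < p.1 ∧ p.2 ≤ 0) (hN : 0 ≤ N)
    (hwt : weight m k (p :: (S ++ A)) ≤ W) (hpot : N + potential (p :: (S ++ A)) ≤ W) :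
    ∃ (S' A' : List Symbol) (g T : ℕ) (a' b' q' : ℤ),
      Within W (.whilePos 8 insertBody)
        (mem (m :: k :: 1 :: p.1 :: p.2 :: S.length :: A.length :: N :: 1 :: q :: R)
          [encode S, encode A, B] I) T
        (mem (m :: k :: 1 :: a' :: b' :: S'.length :: A'.length :: (N + g) :: 0 :: q' :: R)
          [encode S', encode A', B] I) ∧
      LinearReplaces m k (p :: (S ++ A)) g (S' ++ A') ∧
      T + 10 * potential (S' ++ A') ≤ 10 * potential (p :: (S ++ A)) + 10 ∧
      JamShape S' ∧ (∀ p ∈ A', 0 < p.1 ∧ p.2 ≤ 0) ∧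
      (A = [] ∨ S = [] ∧ 0 < p.1 ∧ p.2 ≤ 0 → A' = [] ∨ S' = []) ∧
      (p.1 ≤ 0 → A' = A) ∧
      ((∀ q ∈ S, 0 < q.2) → (∀ q ∈ S', 0 < q.2) ∨ S'.length ≤ 1) := by
  -- Stack 1 is not read by the loop and grows at most in the final iteration, so `A` stays fixed in
  -- the induction.
  induction hn : potential (p :: S) using Nat.strong_induction_on generalizing p S N q with
  | _ n ih =>
  subst hn
  have hlen := length_le_potential (p :: (S ++ A))
  simp only [List.length_cons, List.length_append] at hlen
  have hlenS : |(S.length : ℤ) + 1| ≤ W := by rw [abs_of_nonneg (by positivity)]; omega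
  have hlenA : |(A.length : ℤ) + 1| ≤ W := by rw [abs_of_nonneg (by positivity)]; omega
  -- a final iteration, which pushes the symbol
  have hpush : p.1 ≤ 0 → (0 < p.2 ∨ S = []) →
      Within W insertBody (mem (m :: k :: 1 :: p.1 :: p.2 :: S.length :: A.length :: N :: 1 :: q :: R)
          [encode S, encode A, B] I) 7
        (mem (m :: k :: 1 :: p.1 :: p.2 :: (S.length + 1) :: A.length :: N :: 0 :: q :: R)
          [encode (p :: S), encode A, B] I) →
      ∃ (S' A' : List Symbol) (g T : ℕ) (a' b' q' : ℤ),
      Within W (.whilePos 8 insertBody)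
        (mem (m :: k :: 1 :: p.1 :: p.2 :: S.length :: A.length :: N :: 1 :: q :: R)
          [encode S, encode A, B] I) T
        (mem (m :: k :: 1 :: a' :: b' :: S'.length :: A'.length :: (N + g) :: 0 :: q' :: R)
          [encode S', encode A', B] I) ∧
      LinearReplaces m k (p :: (S ++ A)) g (S' ++ A') ∧
      T + 10 * potential (S' ++ A') ≤ 10 * potential (p :: (S ++ A)) + 10 ∧
      JamShape S' ∧ (∀ p ∈ A', 0 < p.1 ∧ p.2 ≤ 0) ∧
      (A = [] ∨ S = [] ∧ 0 < p.1 ∧ p.2 ≤ 0 → A' = [] ∨ S' = []) ∧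
      (p.1 ≤ 0 → A' = A) ∧
      ((∀ q ∈ S, 0 < q.2) → (∀ q ∈ S', 0 < q.2) ∨ S'.length ≤ 1) := by
    intro hp1 hp2 hrun
    refine ⟨p :: S, A, 0, 9, p.1, p.2, q, ?_, LinearReplaces.refl _, by simp; omega, ⟨hp1, hp2, hS⟩, hA,
      ?_, fun _ => rfl, ?_⟩
    · simpa using Within.while_pos one_pos hrun (Within.while_not le_rfl)
    · rintro (h | ⟨-, h, -⟩)
      · exact Or.inl h
      · omega
    · intro h
      rcases hp2 with hp2 | rfl
      · exact Or.inl (List.forall_mem_cons.2 ⟨hp2, h⟩)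
      · exact Or.inr (by simp)
  by_cases hb : 0 < p.2
  · by_cases ha : 0 < p.1
    · -- the symbol is a `◇`
      have hr : LinearReplace m k (p :: (S ++ A)) 1 (shrink m k p :: (S ++ A)) :=
        LinearReplace.diamond [] _ p ha hb
      have h1 := hr.weight_le hm
      have h2 := (hr.potential_add_le hm).1
      have h3 := abs_add_abs_le_symbolWeight m k (shrink m k p)
      have h4 := weight_nonneg m k (S ++ A)
      simp only [weight_cons] at h1 hwt
      have h5 : |p.1 - m| ≤ W := (le_trans (by simp [shrink]) h3).trans (by omega)
      have h6 : |p.2 - k| ≤ W := (le_trans (by simp [shrink]) h3).trans (by omega)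
      have h7 : |N + 1| ≤ W := by rw [abs_of_nonneg (by omega)]; omega
      have hrun : Within W insertBody
          (mem (m :: k :: 1 :: p.1 :: p.2 :: S.length :: A.length :: N :: 1 :: q :: R)
            [encode S, encode A, B] I) 5
          (mem (m :: k :: 1 :: (shrink m k p).1 :: (shrink m k p).2 :: S.length :: A.length ::
            (N + 1) :: 1 :: q :: R) [encode S, encode A, B] I) :=
        Within.insert_diamond ha hb h5 h6 h7
      obtain ⟨S', A', g, T, a', b', q', i1, i2, i3, i4, i5, i6, i7, i8⟩ :=
        ih _ (by simp only [potential_cons, potential_append] at h2 ⊢; omega) (shrink m k p) S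
          (N + 1) q hS (by omega) (by simp only [weight_cons]; omega) (by omega) rfl
      refine ⟨S', A', 1 + g, 5 + T + 1, a', b', q', ?_, LinearReplaces.head hr i2, by omega, i4, i5,
        ?_, ?_, i8⟩
      · have := Within.while_pos one_pos hrun i1
        rwa [show N + ((1 + g : ℕ) : ℤ) = N + 1 + g by push_cast; ring]
      · rintro (h | ⟨-, -, h⟩)
        · exact i6 (Or.inl h)
        · omega
      · intro h; omega
    · refine hpush (by omega) (Or.inl hb) ?_
      exact (Within.insert_one (not_lt.1 ha) hb (by omega) hlenS).mono (by omega)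
  · have hb' : p.2 ≤ 0 := not_lt.1 hb
    rcases S with _ | ⟨p', S⟩
    · by_cases ha : 0 < p.1
      · have hrun : Within W insertBody
            (mem (m :: k :: 1 :: p.1 :: p.2 :: (0 : ℕ) :: A.length :: N :: 1 :: q :: R)
              [encode [], encode A, B] I) 7
            (mem (m :: k :: 1 :: p.1 :: p.2 :: (0 : ℕ) :: (A.length + 1) :: N :: 0 :: q :: R)
              [encode [], encode (p :: A), B] I) :=
          Within.insert_zero ha hb' (by simp) (by omega) hlenA
        refine ⟨[], p :: A, 0, 9, p.1, p.2, q, ?_, LinearReplaces.refl _, by simp; omega, trivial,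
          by simpa [ha, hb'] using hA, fun _ => Or.inr rfl, fun h => by omega, fun _ => Or.inl (by simp)⟩
        simpa using Within.while_pos one_pos hrun (Within.while_not le_rfl)
      · refine hpush (by omega) (Or.inr rfl) ?_
        exact Within.insert_star (not_lt.1 ha) hb' (by simp) (by omega) hlenS
    · -- the symbol is joined with the top of stack 0
      have hr : LinearReplace m k (p :: ((p' :: S) ++ A)) 0 ((p + p') :: (S ++ A)) :=
        LinearReplace.merge [] _ p p' hb' hS.1
      have h1 := hr.weight_le hm
      have h2 := (hr.potential_add_le hm).1
      have h3 := abs_add_abs_le_symbolWeight m k (p + p')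
      have h4 := weight_nonneg m k (S ++ A)
      simp only [weight_cons, List.cons_append] at h1 hwt
      have h5 : |p.1 + p'.1| ≤ W :=
        (le_trans (by simp) h3).trans (by omega)
      have h6 : |p.2 + p'.2| ≤ W :=
        (le_trans (by simp) h3).trans (by omega)
      have h7 : |((p' :: S).length : ℤ) - 1| ≤ W := by
        rw [abs_of_nonneg (by simp)]; omega
      have hrun : Within W insertBody
          (mem (m :: k :: 1 :: p.1 :: p.2 :: (p' :: S).length :: A.length :: N :: 1 :: q :: R)
            [encode (p' :: S), encode A, B] I) 7
          (mem (m :: k :: 1 :: (p + p').1 :: (p + p').2 :: (((p' :: S).length : ℤ) - 1) :: A.length ::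
            N :: 1 :: p'.2 :: R) [encode S, encode A, B] I) :=
        Within.insert_join hb' (by simp) h5 h6 h7
      rw [show (((p' :: S).length : ℤ) - 1) = S.length by simp] at hrun
      obtain ⟨S', A', g, T, a', b', q', i1, i2, i3, i4, i5, i6, i7, i8⟩ :=
        ih _ (by simp only [potential_cons, potential_append, List.cons_append] at h2 ⊢; omega)
          (p + p') S N p'.2 hS.2.2 hN (by simp only [weight_cons]; omega) (by omega) rfl
      refine ⟨S', A', 0 + g, 7 + T + 1, a', b', q', ?_, LinearReplaces.head hr i2, by omega, i4, i5,
        ?_, ?_, ?_⟩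
      · have := Within.while_pos one_pos hrun i1
        rwa [zero_add]
      · rintro (h | ⟨h, -, -⟩)
        · exact i6 (Or.inl h)
        · simp at h
      · intro h
        exact i7 (by have := hS.1; simp only [Prod.fst_add]; omega)
      · intro h
        exact i8 fun q hq => h q (List.mem_cons_of_mem _ hq)

/-! ### Moving a stack of symbols -/

/-- Move all symbols of stack `i`, whose size is in register `n`, to stack `j` with size `n'`. -/
def moveStack (i n j n' : ℕ) : Program :=
  .whilePos n (.seq (.pop i 9) (.seq (.pop i 10) (.seq (.push j 10) (.seq (.push j 9)
    (.seq (.sub n n 2) (.add n' n' 2))))))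

theorem Within.move_free_body {W m k a b n l N f q q₂ h z z' : ℤ} {R S A B : List ℤ} {I : List Bool}
    (h₁ : |l - 1| ≤ W) (h₂ : |h + 1| ≤ W) : Within W
      (.seq (.pop 1 9) (.seq (.pop 1 10) (.seq (.push 2 10) (.seq (.push 2 9)
    (.seq (.sub 6 6 2) (.add 11 11 2))))))
      (mem (m :: k :: 1 :: a :: b :: n :: l :: N :: f :: q :: q₂ :: h :: R)
        [S, z :: z' :: A, B] I) 6
      (mem (m :: k :: 1 :: a :: b :: n :: (l - 1) :: N :: f :: z :: z' :: (h + 1) :: R)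
        [S, A, z :: z' :: B] I) := by
  refine Within.seq (T := 1) (T' := 5) (Within.pop 1 9 _ _ rfl) ?_
  simp only [List.set_cons_succ, List.set_cons_zero, List.getD_cons_succ, List.getD_cons_zero]
  refine Within.seq (T := 1) (T' := 4) (Within.pop 1 10 _ _ rfl) ?_
  simp only [List.set_cons_succ, List.set_cons_zero, List.getD_cons_succ, List.getD_cons_zero]
  refine Within.seq (T := 1) (T' := 3) (Within.push 2 10) ?_
  simp only [List.set_cons_succ, List.set_cons_zero, List.getD_cons_succ, List.getD_cons_zero]
  refine Within.seq (T := 1) (T' := 2) (Within.push 2 9) ?_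
  simp only [List.set_cons_succ, List.set_cons_zero, List.getD_cons_succ, List.getD_cons_zero]
  refine Within.seq (T := 1) (T' := 1) (Within.sub 6 6 2 h₁) ?_
  simp only [List.set_cons_succ, List.set_cons_zero, List.getD_cons_succ, List.getD_cons_zero]
  exact Within.add 11 11 2 h₂

theorem Within.move_free {W m k a b n N f q q₂ : ℤ} {R S : List ℤ} {I : List Bool}
    (X Y : List Symbol) (hW : (X.length : ℤ) + Y.length ≤ W) : ∃ q' q₂', Within W (moveStack 1 6 2 11)
      (mem (m :: k :: 1 :: a :: b :: n :: (X.length : ℤ) :: N :: f :: q :: q₂ :: (Y.length : ℤ) :: R)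
        [S, encode X, encode Y] I) (7 * X.length + 1)
      (mem (m :: k :: 1 :: a :: b :: n :: 0 :: N :: f :: q' :: q₂' :: ((X.reverse ++ Y).length : ℤ) :: R)
        [S, [], encode (X.reverse ++ Y)] I) := by
  induction X generalizing Y q q₂ with
  | nil => exact ⟨q, q₂, Within.while_not le_rfl⟩
  | cons p X ih =>
    obtain ⟨q', q₂', hr⟩ := ih (p :: Y) (q := p.1) (q₂ := p.2) (by
      simp only [List.length_cons, Nat.cast_add, Nat.cast_one] at hW ⊢; omega)
    refine ⟨q', q₂', ?_⟩
    have h1 : |((p :: X).length : ℤ) - 1| ≤ W := by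
      simp only [List.length_cons, Nat.cast_add, Nat.cast_one] at hW ⊢
      rw [abs_of_nonneg (by omega)]; omega
    have h2 : |(Y.length : ℤ) + 1| ≤ W := by
      simp only [List.length_cons, Nat.cast_add, Nat.cast_one] at hW ⊢
      rw [abs_of_nonneg (by omega)]; omega
    have h3 : ((p :: X).length : ℤ) - 1 = X.length := by simp
    have hb := Within.move_free_body (W := W) (m := m) (k := k) (a := a) (b := b) (N := N) (f := f) (q := q)
      (q₂ := q₂) (z := p.1) (z' := p.2) (R := R) (I := I) (n := n) (S := S)
      (A := encode X) (B := encode Y) h1 h2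
    rw [h3] at hb
    have := Within.while_pos (r := 6) (by simp) hb (by simpa [moveStack] using hr)
    refine Within.mono (T := 6 + (7 * X.length + 1) + 1) (by simpa [moveStack] using this) ?_
    simp only [List.length_cons]; omega

theorem Within.move_jam_body {W m k a b n l N f q q₂ h z z' : ℤ} {R S A B : List ℤ} {I : List Bool}
    (h₁ : |n - 1| ≤ W) (h₂ : |h + 1| ≤ W) : Within W
      (.seq (.pop 0 9) (.seq (.pop 0 10) (.seq (.push 2 10) (.seq (.push 2 9)
    (.seq (.sub 5 5 2) (.add 11 11 2))))))
      (mem (m :: k :: 1 :: a :: b :: n :: l :: N :: f :: q :: q₂ :: h :: R)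
        [z :: z' :: S, A, B] I) 6
      (mem (m :: k :: 1 :: a :: b :: (n - 1) :: l :: N :: f :: z :: z' :: (h + 1) :: R)
        [S, A, z :: z' :: B] I) := by
  refine Within.seq (T := 1) (T' := 5) (Within.pop 0 9 _ _ rfl) ?_
  simp only [List.set_cons_succ, List.set_cons_zero, List.getD_cons_succ, List.getD_cons_zero]
  refine Within.seq (T := 1) (T' := 4) (Within.pop 0 10 _ _ rfl) ?_
  simp only [List.set_cons_succ, List.set_cons_zero, List.getD_cons_succ, List.getD_cons_zero]
  refine Within.seq (T := 1) (T' := 3) (Within.push 2 10) ?_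
  simp only [List.set_cons_succ, List.set_cons_zero, List.getD_cons_succ, List.getD_cons_zero]
  refine Within.seq (T := 1) (T' := 2) (Within.push 2 9) ?_
  simp only [List.set_cons_succ, List.set_cons_zero, List.getD_cons_succ, List.getD_cons_zero]
  refine Within.seq (T := 1) (T' := 1) (Within.sub 5 5 2 h₁) ?_
  simp only [List.set_cons_succ, List.set_cons_zero, List.getD_cons_succ, List.getD_cons_zero]
  exact Within.add 11 11 2 h₂

theorem Within.move_jam {W m k a b l N f q q₂ : ℤ} {R A : List ℤ} {I : List Bool}
    (X Y : List Symbol) (hW : (X.length : ℤ) + Y.length ≤ W) : ∃ q' q₂', Within W (moveStack 0 5 2 11)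
      (mem (m :: k :: 1 :: a :: b :: (X.length : ℤ) :: l :: N :: f :: q :: q₂ :: (Y.length : ℤ) :: R)
        [encode X, A, encode Y] I) (7 * X.length + 1)
      (mem (m :: k :: 1 :: a :: b :: 0 :: l :: N :: f :: q' :: q₂' :: ((X.reverse ++ Y).length : ℤ) :: R)
        [[], A, encode (X.reverse ++ Y)] I) := by
  induction X generalizing Y q q₂ with
  | nil => exact ⟨q, q₂, Within.while_not le_rfl⟩
  | cons p X ih =>
    obtain ⟨q', q₂', hr⟩ := ih (p :: Y) (q := p.1) (q₂ := p.2) (by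
      simp only [List.length_cons, Nat.cast_add, Nat.cast_one] at hW ⊢; omega)
    refine ⟨q', q₂', ?_⟩
    have h1 : |((p :: X).length : ℤ) - 1| ≤ W := by
      simp only [List.length_cons, Nat.cast_add, Nat.cast_one] at hW ⊢
      rw [abs_of_nonneg (by omega)]; omega
    have h2 : |(Y.length : ℤ) + 1| ≤ W := by
      simp only [List.length_cons, Nat.cast_add, Nat.cast_one] at hW ⊢
      rw [abs_of_nonneg (by omega)]; omega
    have h3 : ((p :: X).length : ℤ) - 1 = X.length := by simp
    have hb := Within.move_jam_body (W := W) (m := m) (k := k) (a := a) (b := b) (N := N) (f := f) (q := q)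
      (q₂ := q₂) (z := p.1) (z' := p.2) (R := R) (I := I) (l := l) (A := A)
      (S := encode X) (B := encode Y) h1 h2
    rw [h3] at hb
    have := Within.while_pos (r := 5) (by simp) hb (by simpa [moveStack] using hr)
    refine Within.mono (T := 6 + (7 * X.length + 1) + 1) (by simpa [moveStack] using this) ?_
    simp only [List.length_cons]; omega

theorem Within.move_back_body {W m k a b n l N f q q₂ h z z' : ℤ} {R S A B : List ℤ} {I : List Bool}
    (h₁ : |h - 1| ≤ W) (h₂ : |n + 1| ≤ W) : Within W
      (.seq (.pop 2 9) (.seq (.pop 2 10) (.seq (.push 0 10) (.seq (.push 0 9)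
    (.seq (.sub 11 11 2) (.add 5 5 2))))))
      (mem (m :: k :: 1 :: a :: b :: n :: l :: N :: f :: q :: q₂ :: h :: R)
        [S, A, z :: z' :: B] I) 6
      (mem (m :: k :: 1 :: a :: b :: (n + 1) :: l :: N :: f :: z :: z' :: (h - 1) :: R)
        [z :: z' :: S, A, B] I) := by
  refine Within.seq (T := 1) (T' := 5) (Within.pop 2 9 _ _ rfl) ?_
  simp only [List.set_cons_succ, List.set_cons_zero, List.getD_cons_succ, List.getD_cons_zero]
  refine Within.seq (T := 1) (T' := 4) (Within.pop 2 10 _ _ rfl) ?_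
  simp only [List.set_cons_succ, List.set_cons_zero, List.getD_cons_succ, List.getD_cons_zero]
  refine Within.seq (T := 1) (T' := 3) (Within.push 0 10) ?_
  simp only [List.set_cons_succ, List.set_cons_zero, List.getD_cons_succ, List.getD_cons_zero]
  refine Within.seq (T := 1) (T' := 2) (Within.push 0 9) ?_
  simp only [List.set_cons_succ, List.set_cons_zero, List.getD_cons_succ, List.getD_cons_zero]
  refine Within.seq (T := 1) (T' := 1) (Within.sub 11 11 2 h₁) ?_
  simp only [List.set_cons_succ, List.set_cons_zero, List.getD_cons_succ, List.getD_cons_zero]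
  exact Within.add 5 5 2 h₂

theorem Within.move_back {W m k a b l N f q q₂ : ℤ} {R A : List ℤ} {I : List Bool}
    (X Y : List Symbol) (hW : (X.length : ℤ) + Y.length ≤ W) : ∃ q' q₂', Within W (moveStack 2 11 0 5)
      (mem (m :: k :: 1 :: a :: b :: (Y.length : ℤ) :: l :: N :: f :: q :: q₂ :: (X.length : ℤ) :: R)
        [encode Y, A, encode X] I) (7 * X.length + 1)
      (mem (m :: k :: 1 :: a :: b :: ((X.reverse ++ Y).length : ℤ) :: l :: N :: f :: q' :: q₂' :: 0 :: R)
        [encode (X.reverse ++ Y), A, []] I) := by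
  induction X generalizing Y q q₂ with
  | nil => exact ⟨q, q₂, Within.while_not le_rfl⟩
  | cons p X ih =>
    obtain ⟨q', q₂', hr⟩ := ih (p :: Y) (q := p.1) (q₂ := p.2) (by
      simp only [List.length_cons, Nat.cast_add, Nat.cast_one] at hW ⊢; omega)
    refine ⟨q', q₂', ?_⟩
    have h1 : |((p :: X).length : ℤ) - 1| ≤ W := by
      simp only [List.length_cons, Nat.cast_add, Nat.cast_one] at hW ⊢
      rw [abs_of_nonneg (by omega)]; omega
    have h2 : |(Y.length : ℤ) + 1| ≤ W := by
      simp only [List.length_cons, Nat.cast_add, Nat.cast_one] at hW ⊢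
      rw [abs_of_nonneg (by omega)]; omega
    have h3 : ((p :: X).length : ℤ) - 1 = X.length := by simp
    have hb := Within.move_back_body (W := W) (m := m) (k := k) (a := a) (b := b) (N := N) (f := f) (q := q)
      (q₂ := q₂) (z := p.1) (z' := p.2) (R := R) (I := I) (l := l) (A := A)
      (B := encode X) (S := encode Y) h1 h2
    rw [h3] at hb
    have := Within.while_pos (r := 11) (by simp) hb (by simpa [moveStack] using hr)
    refine Within.mono (T := 6 + (7 * X.length + 1) + 1) (by simpa [moveStack] using this) ?_
    simp only [List.length_cons]; omega

/-! ### Insertion of a list of symbols -/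

theorem Within.insert {m k : ℕ} (hm : 1 ≤ m) {W : ℤ} (hW : 1 ≤ W) (p : Symbol)
    (S A : List Symbol) (N f q : ℤ) (R : List ℤ) (B : List ℤ) (I : List Bool)
    (hS : JamShape S) (hA : ∀ p ∈ A, 0 < p.1 ∧ p.2 ≤ 0) (hN : 0 ≤ N)
    (hwt : weight m k (p :: (S ++ A)) ≤ W) (hpot : N + potential (p :: (S ++ A)) ≤ W) :
    ∃ (S' A' : List Symbol) (g T : ℕ) (a' b' q' : ℤ),
      Within W insertSymbol
        (mem (m :: k :: 1 :: p.1 :: p.2 :: S.length :: A.length :: N :: f :: q :: R)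
          [encode S, encode A, B] I) T
        (mem (m :: k :: 1 :: a' :: b' :: S'.length :: A'.length :: (N + g) :: 0 :: q' :: R)
          [encode S', encode A', B] I) ∧
      LinearReplaces m k (p :: (S ++ A)) g (S' ++ A') ∧
      T + 10 * potential (S' ++ A') ≤ 10 * potential (p :: (S ++ A)) + 11 ∧
      JamShape S' ∧ (∀ p ∈ A', 0 < p.1 ∧ p.2 ≤ 0) ∧
      (A = [] ∨ S = [] ∧ 0 < p.1 ∧ p.2 ≤ 0 → A' = [] ∨ S' = []) ∧
      (p.1 ≤ 0 → A' = A) ∧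
      ((∀ q ∈ S, 0 < q.2) → (∀ q ∈ S', 0 < q.2) ∨ S'.length ≤ 1) := by
  obtain ⟨S', A', g, T, a', b', q', i1, i2, i3, i4⟩ :=
    Within.insert_loop hm hW p S A N q R B I hS hA hN hwt hpot
  refine ⟨S', A', g, 1 + T, a', b', q', ?_, i2, by omega, i4⟩
  refine Within.seq (T := 1) (T' := T) (Within.const 8 1 (by simpa using hW)) ?_
  simpa only [List.set_cons_succ, List.set_cons_zero] using i1

/-- Pop a symbol from stack 2, whose size is in register 11, into registers 3 and 4. -/
def popSymbol : Program := .seq (.pop 2 3) (.seq (.pop 2 4) (.sub 11 11 2))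

theorem Within.pop_symbol {W : ℤ} {m k a b n l N f q q₂ h z z' : ℤ} {R S A B : List ℤ} {I : List Bool}
    (hh : |h - 1| ≤ W) : Within W popSymbol
      (mem (m :: k :: 1 :: a :: b :: n :: l :: N :: f :: q :: q₂ :: h :: R) [S, A, z :: z' :: B] I) 3
      (mem (m :: k :: 1 :: z :: z' :: n :: l :: N :: f :: q :: q₂ :: (h - 1) :: R) [S, A, B] I) := by
  refine Within.seq (T := 1) (T' := 2) (Within.pop 2 3 _ _ rfl) ?_
  simp only [List.set_cons_succ, List.set_cons_zero, List.getD_cons_succ, List.getD_cons_zero]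
  refine Within.seq (T := 1) (T' := 1) (Within.pop 2 4 _ _ rfl) ?_
  simp only [List.set_cons_succ, List.set_cons_zero, List.getD_cons_succ, List.getD_cons_zero]
  exact Within.sub 11 11 2 hh

/-- Insert all symbols on stack 2. -/
def insertAll : Program := .whilePos 11 (.seq popSymbol insertSymbol)

/-- The symbols that were `0`s at the end of the string are put in front of it. As long as stack 0
is nonempty they are consumed by it, and once it is empty they are simply stacked. So one of the two
stacks ends up empty. -/
theorem Within.insert_all {m k : ℕ} (hm : 1 ≤ m) {W : ℤ} (hW : 1 ≤ W) (V S A : List Symbol)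
    (a b N f q q₂ : ℤ) (R : List ℤ) (I : List Bool)
    (hV : ∀ p ∈ V, 0 < p.1 ∧ p.2 ≤ 0) (hS : JamShape S) (hA : ∀ p ∈ A, 0 < p.1 ∧ p.2 ≤ 0)
    (hSA : A = [] ∨ S = []) (hN : 0 ≤ N) (hwt : weight m k (V.reverse ++ (S ++ A)) ≤ W)
    (hpot : N + potential (V.reverse ++ (S ++ A)) ≤ W) :
    ∃ (S' A' : List Symbol) (g T : ℕ) (a' b' f' q' : ℤ),
      Within W insertAll
        (mem (m :: k :: 1 :: a :: b :: S.length :: A.length :: N :: f :: q :: q₂ :: V.length :: R)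
          [encode S, encode A, encode V] I) T
        (mem (m :: k :: 1 :: a' :: b' :: S'.length :: A'.length :: (N + g) :: f' :: q' :: q₂ :: 0 :: R)
          [encode S', encode A', []] I) ∧
      LinearReplaces m k (V.reverse ++ (S ++ A)) g (S' ++ A') ∧
      T + 10 * potential (S' ++ A') ≤ 10 * potential (V.reverse ++ (S ++ A)) + 15 * V.length + 1 ∧
      JamShape S' ∧ (∀ p ∈ A', 0 < p.1 ∧ p.2 ≤ 0) ∧ (A' = [] ∨ S' = []) := by
  induction V generalizing S A a b N f q with
  | nil =>
    refine ⟨S, A, 0, 1, a, b, f, q, ?_, LinearReplaces.refl _, by simp; omega, hS, hA, hSA⟩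
    simpa [insertAll] using Within.while_not le_rfl
  | cons p V ih =>
    obtain ⟨hp, hV⟩ := List.forall_mem_cons.1 hV
    rw [List.reverse_cons, List.append_assoc, List.singleton_append] at hwt hpot ⊢
    have hlen := length_le_potential (V.reverse ++ (p :: (S ++ A)))
    simp only [List.length_append, List.length_reverse, List.length_cons] at hlen
    have w1 := weight_nonneg m k V.reverse
    have p1 : potential (V.reverse ++ (p :: (S ++ A))) = potential V.reverse + potential (p :: (S ++ A)) :=
      potential_append _ _
    rw [weight_append] at hwt
    obtain ⟨S₁, A₁, g₁, T₁, a₁, b₁, q₁, i1, i2, i3, i4, i5, i6, -⟩ :=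
      Within.insert (k := k) hm hW p S A N f q (q₂ :: V.length :: R) (encode V) I hS hA hN (by omega) (by omega)
    have h3 := i2.weight_le hm
    have h4 := i2.potential_add_le hm
    have p2 : potential (V.reverse ++ (S₁ ++ A₁)) = potential V.reverse + potential (S₁ ++ A₁) :=
      potential_append _ _
    obtain ⟨S', A', g, T, a', b', f', q', j1, j2, j3, j4⟩ :=
      ih S₁ A₁ a₁ b₁ (N + g₁) 0 q₁ hV i4 i5 (i6 (by tauto)) (by omega)
        (by rw [weight_append]; omega) (by omega)
    refine ⟨S', A', g₁ + g, (3 + T₁) + T + 1, a', b', f', q', ?_, (i2.append_left V.reverse).trans j2, ?_, j4⟩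
    · have hpop := Within.pop_symbol (W := W) (m := m) (k := k) (a := a) (b := b) (n := S.length)
        (l := A.length) (N := N) (f := f) (q := q) (q₂ := q₂) (h := (p :: V).length) (z := p.1)
        (z' := p.2) (R := R) (S := encode S) (A := encode A) (B := encode V) (I := I)
        (by rw [abs_of_nonneg (by simp)]; simp only [List.length_cons]; omega)
      rw [show (((p :: V).length : ℕ) : ℤ) - 1 = V.length by simp] at hpop
      have := Within.while_pos (r := 11) (by simp) (Within.seq hpop i1) j1
      rwa [show N + ((g₁ + g : ℕ) : ℤ) = N + g₁ + g by push_cast; ring]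
    · simp only [List.length_cons]; omega

/-! ### Closing the circle -/

theorem JamShape.append_singleton {u : List Symbol} {p : Symbol} (h : JamShape (u ++ [p])) :
    JamShape u ∧ ∀ q ∈ u, 0 < q.2 := by
  induction u with
  | nil => exact ⟨trivial, by simp⟩
  | cons q u ih =>
    obtain ⟨h1, h2, h3⟩ := h
    obtain ⟨h4, h5⟩ := ih h3
    have h6 : 0 < q.2 := by simpa using h2
    exact ⟨⟨h1, Or.inl h6, h4⟩, List.forall_mem_cons.2 ⟨h6, h5⟩⟩

theorem JamShape.fst_nonpos {u : List Symbol} (h : JamShape u) : ∀ p ∈ u, p.1 ≤ 0 := by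
  induction u with
  | nil => simp
  | cons q u ih => exact List.forall_mem_cons.2 ⟨h.1, ih h.2.2⟩

/-- The strings produced by the program, to which no rule applies. -/
def Settled (u : List Symbol) : Prop :=
  (∀ p ∈ u, 0 < p.1 ∧ p.2 ≤ 0) ∨ (∀ p ∈ u, p.1 ≤ 0 ∧ 0 < p.2) ∨ (u.length ≤ 1 ∧ ∀ p ∈ u, p.1 ≤ 0)

theorem Settled.not_replace {m k d : ℕ} {u : List Symbol} {w : Cycle Symbol} (hu : Settled u) :
    ¬ Replace m k (u : Cycle Symbol) d w := by
  intro h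
  have hmem : ∀ v : List Symbol, (u : Cycle Symbol) = v → u.length = v.length ∧ ∀ p, p ∈ u ↔ p ∈ v :=
    fun v h => ⟨(Cycle.coe_eq_coe.1 h).perm.length_eq, fun p => (Cycle.coe_eq_coe.1 h).perm.mem_iff⟩
  rcases replace_iff.1 h with ⟨p, v, h1, h2, h3, -⟩ | ⟨p, q, v, h1, h2, h3, -⟩
  · have hp := ((hmem _ h3).2 p).2 (by simp)
    rcases hu with hu | hu | ⟨-, hu⟩
    · have := hu p hp; omega
    · have := hu p hp; omega
    · have := hu p hp; omega
  · obtain ⟨hl, hv⟩ := hmem _ h3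
    have hp := (hv p).2 (by simp)
    have hq := (hv q).2 (by simp)
    rcases hu with hu | hu | ⟨hu, -⟩
    · have := hu q hq; omega
    · have := hu p hp; omega
    · simp only [List.length_cons] at hl; omega

/-- Push the symbol in registers 3 and 4 on stack 2, whose size is in register 11. -/
def unpopSymbol : Program := .seq (.push 2 4) (.seq (.push 2 3) (.add 11 11 2))

theorem Within.unpop_symbol {W : ℤ} {m k a b n l N f q q₂ h : ℤ} {R S A B : List ℤ} {I : List Bool}
    (hh : |h + 1| ≤ W) : Within W unpopSymbol
      (mem (m :: k :: 1 :: a :: b :: n :: l :: N :: f :: q :: q₂ :: h :: R) [S, A, B] I) 3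
      (mem (m :: k :: 1 :: a :: b :: n :: l :: N :: f :: q :: q₂ :: (h + 1) :: R) [S, A, a :: b :: B] I) := by
  refine Within.seq (T := 1) (T' := 2) (Within.push 2 4) ?_
  simp only [List.set_cons_succ, List.set_cons_zero, List.getD_cons_succ, List.getD_cons_zero]
  refine Within.seq (T := 1) (T' := 1) (Within.push 2 3) ?_
  simp only [List.set_cons_succ, List.set_cons_zero, List.getD_cons_succ, List.getD_cons_zero]
  exact Within.add 11 11 2 hh

/-- Apply the rules to the last symbol, which is on top of stack 2, and the first one. -/
def joinEnds : Program :=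
  .ifPos 11
    (.seq popSymbol
      (.ifPos 3 (.seq unpopSymbol (moveStack 2 11 0 5)) (.seq (moveStack 2 11 0 5) insertSymbol)))
    (.const 9 0)

/-- A circle of `0`s is already irreducible. Otherwise the only symbol that can be a `⋆` is the last
one. It is moved to the front of the circle and inserted before the remaining `1`s, where it absorbs
them until it becomes a `1` or is the only symbol left. -/
theorem Within.join_ends {m k : ℕ} (hm : 1 ≤ m) {W : ℤ} (hW : 1 ≤ W) (u : List Symbol)
    (a b N f q q₂ : ℤ) (R : List ℤ) (I : List Bool)
    (hu : JamShape u ∨ ∀ p ∈ u, 0 < p.1 ∧ p.2 ≤ 0) (hN : 0 ≤ N) (hwt : weight m k u ≤ W)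
    (hpot : N + potential u ≤ W) :
    ∃ (u' : List Symbol) (g T : ℕ) (a' b' n' f' q' q₂' : ℤ),
      Within W joinEnds
        (mem (m :: k :: 1 :: a :: b :: 0 :: 0 :: N :: f :: q :: q₂ :: u.length :: R)
          [[], [], encode u.reverse] I) T
        (mem (m :: k :: 1 :: a' :: b' :: n' :: 0 :: (N + g) :: f' :: q' :: q₂' :: 0 :: R)
          [encode u', [], []] I) ∧
      Replaces m k (u : Cycle Symbol) g (u' : Cycle Symbol) ∧
      T + 10 * potential u' ≤ 10 * potential u + 7 * u.length + 17 ∧ Settled u' := by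
  have hlen := length_le_potential u
  rcases List.eq_nil_or_concat' u with rfl | ⟨v, p, rfl⟩
  · refine ⟨[], 0, 2, a, b, 0, f, 0, q₂, ?_, Replaces.refl _, by simp, Or.inl (by simp)⟩
    have := Within.const (W := W) (R := m :: k :: 1 :: a :: b :: 0 :: 0 :: N :: f :: q :: q₂ :: 0 :: R)
      (S := [[], [], []]) (I := I) 9 0 (by simp; omega)
    simp only [List.set_cons_succ, List.set_cons_zero] at this
    simpa [joinEnds] using Within.if_not (T := 1) (r := 11) le_rfl this
  · have hl : ((v ++ [p]).length : ℤ) = v.length + 1 := by simp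
    have hpop := Within.pop_symbol (W := W) (m := m) (k := k) (a := a) (b := b) (n := 0)
      (l := 0) (N := N) (f := f) (q := q) (q₂ := q₂) (h := (v ++ [p]).length) (z := p.1)
      (z' := p.2) (R := R) (S := []) (A := []) (B := encode v.reverse) (I := I)
      (by rw [abs_of_nonneg (by rw [hl]; omega)]; omega)
    rw [show ((v ++ [p]).length : ℤ) - 1 = v.length by rw [hl]; ring] at hpop
    rw [show encode (v ++ [p]).reverse = p.1 :: p.2 :: encode v.reverse by simp]
    by_cases hp : 0 < p.1
    · have hu' : ∀ r ∈ v ++ [p], 0 < r.1 ∧ r.2 ≤ 0 := by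
        rcases hu with hu | hu
        · have := hu.fst_nonpos p (by simp); omega
        · exact hu
      obtain ⟨q', q₂', hmove⟩ := Within.move_back (W := W) (m := m) (k := k) (a := p.1) (b := p.2)
        (l := 0) (N := N) (f := f) (q := q) (q₂ := q₂) (R := R) (A := []) (I := I)
        (p :: v.reverse) [] (by
          simp only [List.length_cons, List.length_reverse, List.length_nil]; push_cast; omega)
      have hpush := Within.unpop_symbol (W := W) (m := m) (k := k) (a := p.1) (b := p.2) (n := 0)
        (l := 0) (N := N) (f := f) (q := q) (q₂ := q₂) (h := v.length) (R := R) (S := []) (A := [])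
        (B := encode v.reverse) (I := I) (by rw [abs_of_nonneg (by omega)]; omega)
      refine ⟨v ++ [p], 0, 3 + ((3 + (7 * (p :: v.reverse).length + 1)) + 1) + 1, p.1, p.2,
        (v.length + 1 : ℕ), f, q', q₂', ?_, Replaces.refl _, ?_, Or.inl hu'⟩
      · refine Within.if_pos (r := 11) (by simp) (Within.seq hpop (Within.if_pos (r := 3) hp
          (Within.seq hpush ?_)))
        simpa using hmove
      · simp only [List.length_append, List.length_cons, List.length_reverse, List.length_nil]; omega
    · have hu' : JamShape (v ++ [p]) := by
        rcases hu with hu | hu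
        · exact hu
        · exact absurd (hu p (by simp)).1 hp
      obtain ⟨hv, hv'⟩ := hu'.append_singleton
      obtain ⟨q', q₂', hmove⟩ := Within.move_back (W := W) (m := m) (k := k) (a := p.1) (b := p.2)
        (l := 0) (N := N) (f := f) (q := q) (q₂ := q₂) (R := R) (A := []) (I := I)
        v.reverse [] (by simp only [List.length_reverse, List.length_nil]; push_cast; omega)
      have hw : weight m k (p :: (v ++ [])) = weight m k (v ++ [p]) := by simp; ring
      have hpo : potential (p :: (v ++ [])) = potential (v ++ [p]) := by simp; ring
      obtain ⟨S', A', g, T, a', b', q₁, i1, i2, i3, i4, i5, i6, i7, i8⟩ :=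
        Within.insert (k := k) hm hW p v [] N f q' (q₂' :: 0 :: R) [] I hv (by simp) hN
          (by omega) (by omega)
      obtain rfl := i7 (by omega)
      have hcirc : ((v ++ [p] : List Symbol) : Cycle Symbol) = (p :: (v ++ []) : List Symbol) := by
        simpa using coe_append_comm v [p]
      refine ⟨S', g, 3 + (((7 * v.reverse.length + 1) + T) + 1) + 1, a', b', S'.length, 0, q₁, q₂',
        ?_, ?_, ?_, Or.inr ?_⟩
      · refine Within.if_pos (r := 11) (by simp) (Within.seq hpop (Within.if_not (r := 3) (not_lt.1 hp)
          (Within.seq (σ' := mem (m :: k :: 1 :: p.1 :: p.2 :: v.length :: (0 : ℕ) :: N :: f :: q' ::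
            q₂' :: 0 :: R) [encode v, [], []] I) ?_ i1)))
        simpa using hmove
      · rw [hcirc]
        simpa using i2.replaces
      · simp only [List.append_nil] at i3 hpo
        simp only [List.length_append, List.length_reverse, List.length_cons, List.length_nil]; omega
      · have h1 := i4.fst_nonpos
        rcases i8 hv' with h2 | h2
        · exact Or.inl fun p hp => ⟨h1 p hp, h2 p hp⟩
        · exact Or.inr ⟨h2, h1⟩

/-- Apply the rules around the circle. -/
def closeCircle : Program :=
  .seq (moveStack 1 6 2 11) (.seq insertAll (.seq (moveStack 0 5 2 11) (.seq (moveStack 1 6 2 11)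
    joinEnds)))

/-- The circle `S ++ A` is cut at the other place, as `A ++ S`, so that the `0`s meet the `1`s. In
the bound on `T`, `10` units of the factor `46` pay for the reductions. The rest pays for moving and
popping symbols, since the number of symbols is at most the potential. -/
theorem Within.close_circle {m k : ℕ} (hm : 1 ≤ m) {W : ℤ} (hW : 1 ≤ W) (S A : List Symbol)
    (a b N f q q₂ : ℤ) (R : List ℤ) (I : List Bool)
    (hS : JamShape S) (hA : ∀ p ∈ A, 0 < p.1 ∧ p.2 ≤ 0) (hN : 0 ≤ N) (hwt : weight m k (S ++ A) ≤ W)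
    (hpot : N + potential (S ++ A) ≤ W) :
    ∃ (u' : List Symbol) (g T : ℕ) (a' b' n' f' q' q₂' : ℤ),
      Within W closeCircle
        (mem (m :: k :: 1 :: a :: b :: S.length :: A.length :: N :: f :: q :: q₂ :: 0 :: R)
          [encode S, encode A, []] I) T
        (mem (m :: k :: 1 :: a' :: b' :: n' :: 0 :: (N + g) :: f' :: q' :: q₂' :: 0 :: R)
          [encode u', [], []] I) ∧
      Replaces m k ((S ++ A : List Symbol) : Cycle Symbol) g (u' : Cycle Symbol) ∧
      T ≤ 46 * potential (S ++ A) + 21 ∧ Settled u' := by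
  have hpc : potential (A ++ (S ++ [])) = potential (S ++ A) := by simp; ring
  have hwc : weight m k (A ++ (S ++ [])) = weight m k (S ++ A) := by simp; ring
  have hlen := length_le_potential (S ++ A)
  rw [List.length_append] at hlen
  obtain ⟨q₃, q₄, h₁⟩ := Within.move_free (W := W) (m := m) (k := k) (a := a) (b := b)
    (n := S.length) (N := N) (f := f) (q := q) (q₂ := q₂) (R := R) (S := encode S) (I := I)
    A [] (by simp only [List.length_nil]; push_cast; omega)
  obtain ⟨S', A', g₁, T₁, a₁, b₁, f₁, q₅, h₂, i2, i3, i4, i5, i6⟩ :=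
    Within.insert_all (k := k) hm hW A.reverse S [] a b N f q₃ q₄ R I (by simpa using hA) hS (by simp)
      (Or.inl rfl) hN (by rw [List.reverse_reverse]; omega) (by rw [List.reverse_reverse]; omega)
  rw [List.reverse_reverse] at i2 i3
  have hw₁ := i2.weight_le hm
  have hp₁ := i2.potential_add_le hm
  have hlen₁ := length_le_potential (S' ++ A')
  rw [List.length_append] at hlen₁
  obtain ⟨q₆, q₇, h₃⟩ := Within.move_jam (W := W) (m := m) (k := k) (a := a₁) (b := b₁)
    (l := A'.length) (N := N + g₁) (f := f₁) (q := q₅) (q₂ := q₄) (R := R) (A := encode A') (I := I)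
    S' [] (by simp only [List.length_nil]; push_cast; omega)
  obtain ⟨q₈, q₉, h₄⟩ := Within.move_free (W := W) (m := m) (k := k) (a := a₁) (b := b₁)
    (n := 0) (N := N + g₁) (f := f₁) (q := q₆) (q₂ := q₇) (R := R) (S := []) (I := I)
    A' (S'.reverse ++ []) (by simp only [List.append_nil, List.length_reverse]; omega)
  obtain ⟨u', g₂, T₂, a₂, b₂, n₂, f₂, q₁₀, q₁₁, h₅, j2, j3, j4⟩ :=
    Within.join_ends (k := k) hm hW (S' ++ A') a₁ b₁ (N + g₁) f₁ q₈ q₉ R I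
      (by rcases i6 with rfl | rfl
          · exact Or.inl (by simpa using i4)
          · exact Or.inr (by simpa using i5)) (by omega) (by omega) (by omega)
  refine ⟨u', g₁ + g₂, (7 * A.length + 1) + (T₁ + ((7 * S'.length + 1) + ((7 * A'.length + 1) + T₂))),
    a₂, b₂, n₂, f₂, q₁₀, q₁₁, ?_, ?_, ?_, j4⟩
  · rw [show N + ((g₁ + g₂ : ℕ) : ℤ) = N + g₁ + g₂ by push_cast; ring]
    refine Within.seq h₁ (Within.seq ?_ (Within.seq h₃ (Within.seq h₄ ?_)))
    · simpa using h₂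
    · simpa [add_comm] using h₅
  · rw [coe_append_comm]
    have := i2.replaces.trans j2
    simpa using this
  · rw [List.length_reverse] at i3
    rw [List.length_append] at j3
    omega

/-! ### Reading the road -/

def bit (v : Bool) : ℤ := if v then 1 else 0

def bits (w : List Bool) : List ℤ := w.map bit

/-- What register 14 holds when `w` is still to be processed. -/
def nextSite : List Bool → ℤ
  | [] => -1
  | v :: _ => bit v

/-- The store while the road is read; `P`, `Q` count the first sites `0^P 1^Q`, and `B` collects the
other ones. -/
def readStore (m k c q h P Q F : ℤ) (B : List ℤ) (I : List Bool) : Store :=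
  mem [m, k, 1, 0, 0, 0, 0, 0, 0, q, 0, h, 0, 0, c, P, Q, F] [[], [], B] I

def readNext : Program := .seq (.read 14) (.add 9 14 2)

/-- Register `14` holds the site, `15` and `16` count the leading `0^P 1^Q`, and `17` is positive
once a further site has been stored on stack 2. Register `10` is still zero here and serves as the
constant for an empty site. An empty site after some car ends the counted prefix. -/
def recordSite : Program :=
  .ifPos 14 (.ifPos 17 (.seq (.push 2 2) (.add 11 11 2)) (.add 16 16 2))
    (.ifPos 16 (.seq (.push 2 10) (.seq (.add 11 11 2) (.const 17 1))) (.add 15 15 2))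

section

variable {W m k c q h P Q F : ℤ} {B : List ℤ} {I : List Bool}

theorem Within.read_next (hW : 2 ≤ W) : Within W readNext (readStore m k c q h P Q F B I) 2
    (readStore m k (nextSite I) (nextSite I + 1) h P Q F B I.tail) := by
  rcases I with _ | ⟨v, I⟩
  · refine Within.seq (T := 1) (T' := 1) (Within.read_end 14) ?_
    simp only [List.set_cons_succ, List.set_cons_zero]
    exact Within.add 9 14 2 (by simp; omega)
  · refine Within.seq (T := 1) (T' := 1) (Within.read_site 14 v) ?_
    simp only [List.set_cons_succ, List.set_cons_zero]
    exact Within.add 9 14 2 (by cases v <;> simp <;> omega)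

theorem Within.record_first_zero (hQ : Q ≤ 0) (hP : |P + 1| ≤ W) : Within W recordSite
    (readStore m k 0 q h P Q F B I) 5 (readStore m k 0 q h (P + 1) Q F B I) := by
  refine Within.mono (T := 3) ?_ (by omega)
  refine Within.if_not (T := 2) (r := 14) le_rfl ?_
  refine Within.if_not (T := 1) (r := 16) hQ ?_
  exact Within.add 15 15 2 hP

theorem Within.record_zero (hQ : 0 < Q) (hW : 1 ≤ W) (hh : |h + 1| ≤ W) : Within W recordSite
    (readStore m k 0 q h P Q F B I) 5 (readStore m k 0 q (h + 1) P Q 1 (0 :: B) I) := by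
  rw [recordSite, readStore]
  refine Within.if_not (T := 4) (r := 14) le_rfl ?_
  refine Within.if_pos (T := 3) (r := 16) hQ ?_
  refine Within.seq (T := 1) (T' := 2) (Within.push 2 10) ?_
  simp only [List.set_cons_succ, List.set_cons_zero, List.getD_cons_succ, List.getD_cons_zero]
  refine Within.seq (T := 1) (T' := 1) (Within.add 11 11 2 hh) ?_
  simp only [List.set_cons_succ, List.set_cons_zero, List.getD_cons_succ, List.getD_cons_zero]
  exact Within.const 17 1 (by simpa using hW)

theorem Within.record_first_one (hF : F ≤ 0) (hQ : |Q + 1| ≤ W) : Within W recordSite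
    (readStore m k 1 q h P Q F B I) 5 (readStore m k 1 q h P (Q + 1) F B I) := by
  refine Within.mono (T := 3) ?_ (by omega)
  refine Within.if_pos (T := 2) (r := 14) one_pos ?_
  refine Within.if_not (T := 1) (r := 17) hF ?_
  exact Within.add 16 16 2 hQ

theorem Within.record_one (hF : 0 < F) (hh : |h + 1| ≤ W) : Within W recordSite
    (readStore m k 1 q h P Q F B I) 5 (readStore m k 1 q (h + 1) P Q F (1 :: B) I) := by
  rw [recordSite, readStore]
  refine Within.mono (T := 4) ?_ (by omega)
  refine Within.if_pos (T := 3) (r := 14) one_pos ?_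
  refine Within.if_pos (T := 2) (r := 17) hF ?_
  refine Within.seq (T := 1) (T' := 1) (Within.push 2 2) ?_
  simp only [List.set_cons_succ, List.set_cons_zero, List.getD_cons_succ, List.getD_cons_zero]
  exact Within.add 11 11 2 hh

end

def readRoad : Program := .whilePos 9 (.seq recordSite readNext)

/-- The input can be read only once, so the cut between groups must be found online. The prefix `0^P
1^Q` is held back as two counters, and the remaining word, if nonempty, starts with an empty site
behind a car. The loop runs on register `9`, the site plus one, which is zero exactly at the end of
the input. -/
theorem Within.read_road {W m k : ℤ} (w rest : List Bool) (P Q : ℕ) (F : ℤ)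
    (hW : (P : ℤ) + Q + rest.length + w.length + 2 ≤ W) (hF : 0 < F ↔ rest ≠ [])
    (hrest : rest ≠ [] → 0 < Q ∧ rest.head? = some false) :
    ∃ (P' Q' : ℕ) (F' : ℤ) (rest' : List Bool),
      Within W readRoad
        (readStore m k (nextSite w) (nextSite w + 1) (rest.length + 1) P Q F
          (bits rest.reverse ++ [1]) w.tail) (8 * w.length + 1)
        (readStore m k (-1) 0 (rest'.length + 1) P' Q' F' (bits rest'.reverse ++ [1]) []) ∧
      List.replicate P false ++ List.replicate Q true ++ rest ++ w =
        List.replicate P' false ++ List.replicate Q' true ++ rest' ∧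
      (rest' ≠ [] → 0 < Q' ∧ rest'.head? = some false) := by
  induction w generalizing rest P Q F with
  | nil => exact ⟨P, Q, F, rest, Within.while_not le_rfl, by simp, hrest⟩
  | cons v w ih =>
    have hnext : ∀ h P Q F : ℤ, ∀ B : List ℤ, Within W readNext
        (readStore m k (bit v) (bit v + 1) h P Q F B w) 2 _ :=
      fun h P Q F B => Within.read_next (by omega)
    simp only [List.length_cons] at hW ⊢
    push_cast at hW
    have hQ1 : |(Q : ℤ) + 1| ≤ W := by rw [abs_of_nonneg (by omega)]; omega
    have hP1 : |(P : ℤ) + 1| ≤ W := by rw [abs_of_nonneg (by omega)]; omega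
    have hh1 : |(rest.length : ℤ) + 1 + 1| ≤ W := by rw [abs_of_nonneg (by omega)]; omega
    have hstep : ∀ (rest₁ : List Bool) (P₁ Q₁ : ℕ) (F₁ : ℤ),
        (P₁ : ℤ) + Q₁ + rest₁.length + w.length + 2 ≤ W → (0 < F₁ ↔ rest₁ ≠ []) →
        (rest₁ ≠ [] → 0 < Q₁ ∧ rest₁.head? = some false) →
        List.replicate P false ++ List.replicate Q true ++ rest ++ v :: w =
          List.replicate P₁ false ++ List.replicate Q₁ true ++ rest₁ ++ w →
        Within W recordSite
          (readStore m k (bit v) (bit v + 1) (rest.length + 1) P Q F (bits rest.reverse ++ [1]) w) 5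
          (readStore m k (bit v) (bit v + 1) (rest₁.length + 1) P₁ Q₁ F₁
            (bits rest₁.reverse ++ [1]) w) →
        ∃ (P' Q' : ℕ) (F' : ℤ) (rest' : List Bool),
        Within W readRoad
          (readStore m k (nextSite (v :: w)) (nextSite (v :: w) + 1) (rest.length + 1) P Q F
            (bits rest.reverse ++ [1]) (v :: w).tail) (8 * (w.length + 1) + 1)
          (readStore m k (-1) 0 (rest'.length + 1) P' Q' F' (bits rest'.reverse ++ [1]) []) ∧
        List.replicate P false ++ List.replicate Q true ++ rest ++ v :: w =
          List.replicate P' false ++ List.replicate Q' true ++ rest' ∧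
        (rest' ≠ [] → 0 < Q' ∧ rest'.head? = some false) := by
      intro rest₁ P₁ Q₁ F₁ h₁ h₂ h₃ h₄ h₅
      obtain ⟨P', Q', F', rest', i1, i2, i3⟩ := ih rest₁ P₁ Q₁ F₁ h₁ h₂ h₃
      refine ⟨P', Q', F', rest', ?_, h₄.trans i2, i3⟩
      have hpos : 0 < bit v + 1 := by cases v <;> decide
      refine Within.mono (T := (5 + 2) + (8 * w.length + 1) + 1) ?_ (by omega)
      refine Within.while_pos (r := 9) (T := 5 + 2) ?_ (Within.seq h₅ (hnext _ _ _ _ _)) i1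
      exact hpos
    cases v with
    | false =>
      by_cases hQ : 0 < Q
      · refine hstep (rest ++ [false]) P Q 1 (by simp; omega) (by simp) (fun _ => ⟨hQ, ?_⟩)
          (by simp) ?_
        · rcases rest with _ | ⟨z, rest⟩
          · rfl
          · simpa using (hrest (by simp)).2
        · have := Within.record_zero (W := W) (m := m) (k := k) (q := bit false + 1)
            (h := rest.length + 1) (P := P) (Q := Q) (F := F) (B := bits rest.reverse ++ [1]) (I := w)
            (by omega) (by omega) hh1
          simpa [bit, bits] using this
      · obtain rfl : rest = [] := by by_contra h; exact hQ (hrest h).1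
        obtain rfl : Q = 0 := by omega
        refine hstep [] (P + 1) 0 F (by simp at hW ⊢; omega) hF (by simp) ?_ ?_
        · simp [List.replicate_succ']
        · have := Within.record_first_zero (W := W) (m := m) (k := k) (q := bit false + 1)
            (h := ([] : List Bool).length + 1) (P := P) (Q := (0 : ℕ)) (F := F) (B := bits [] ++ [1]) (I := w)
            (by omega) hP1
          simpa [bit, bits] using this
    | true =>
      by_cases hr : rest = []
      · subst hr
        refine hstep [] P (Q + 1) F (by simp at hW ⊢; omega) hF (by simp) ?_ ?_
        · simp [List.replicate_succ']
        · have := Within.record_first_one (W := W) (m := m) (k := k) (q := bit true + 1)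
            (h := ([] : List Bool).length + 1) (P := P) (Q := Q) (F := F) (B := bits [] ++ [1]) (I := w)
            (by simpa using hF) hQ1
          simpa [bit, bits] using this
      · refine hstep (rest ++ [true]) P Q F (by simp; omega) (by simp [hF, hr])
          (fun _ => ⟨(hrest hr).1, ?_⟩) (by simp) ?_
        · rw [List.head?_append, (hrest hr).2]; rfl
        · have := Within.record_one (W := W) (m := m) (k := k) (q := bit true + 1)
            (h := rest.length + 1) (P := P) (Q := Q) (F := F) (B := bits rest.reverse ++ [1]) (I := w)
            (hF.2 hr) hh1
          simpa [bit, bits] using this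

/-- Move the counted first zeros and then the counted first ones to stack 2. -/
def recordZeros : Program := .whilePos 15 (.seq (.push 2 10) (.seq (.add 11 11 2) (.sub 15 15 2)))

def recordOnes : Program := .whilePos 16 (.seq (.push 2 2) (.seq (.add 11 11 2) (.sub 16 16 2)))

theorem Within.record_zeros {W m k c q h Q F : ℤ} (P : ℕ) {B : List ℤ} {I : List Bool}
    (hh : 0 ≤ h) (hW : h + P ≤ W) : Within W recordZeros (readStore m k c q h P Q F B I) (4 * P + 1)
      (readStore m k c q (h + P) 0 Q F (List.replicate P 0 ++ B) I) := by
  induction P generalizing h B with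
  | zero => simpa [recordZeros, readStore] using Within.while_not le_rfl
  | succ P ih =>
    have hb : Within W (.seq (.push 2 10) (.seq (.add 11 11 2) (.sub 15 15 2)))
        (readStore m k c q h (P + 1 : ℕ) Q F B I) 3
        (readStore m k c q (h + 1) ((P + 1 : ℕ) - 1) Q F (0 :: B) I) := by
      refine Within.seq (T := 1) (T' := 2) (Within.push 2 10) ?_
      simp only [List.set_cons_succ, List.set_cons_zero, List.getD_cons_succ, List.getD_cons_zero]
      refine Within.seq (T := 1) (T' := 1) (Within.add 11 11 2 (abs_le.2 ?_)) ?_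
      · simp only [List.getD_cons_succ, List.getD_cons_zero]; omega
      · simp only [List.set_cons_succ, List.set_cons_zero, List.getD_cons_succ, List.getD_cons_zero]
        refine Within.sub 15 15 2 (abs_le.2 ?_)
        simp only [List.getD_cons_succ, List.getD_cons_zero]; omega
    have := Within.while_pos (r := 15) (by simp) hb
      (by simpa [recordZeros] using ih (h := h + 1) (B := 0 :: B) (by omega) (by omega))
    refine Within.mono ?_ (show 3 + (4 * P + 1) + 1 ≤ _ by omega)
    rw [List.replicate_succ', List.append_assoc, List.singleton_append,
      show h + ((P + 1 : ℕ) : ℤ) = h + 1 + P by push_cast; ring]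
    exact this

theorem Within.record_ones {W m k c q h P F : ℤ} (Q : ℕ) {B : List ℤ} {I : List Bool}
    (hh : 0 ≤ h) (hW : h + Q ≤ W) : Within W recordOnes (readStore m k c q h P Q F B I) (4 * Q + 1)
      (readStore m k c q (h + Q) P 0 F (List.replicate Q 1 ++ B) I) := by
  induction Q generalizing h B with
  | zero => simpa [recordOnes, readStore] using Within.while_not le_rfl
  | succ Q ih =>
    have hb : Within W (.seq (.push 2 2) (.seq (.add 11 11 2) (.sub 16 16 2)))
        (readStore m k c q h P (Q + 1 : ℕ) F B I) 3
        (readStore m k c q (h + 1) P ((Q + 1 : ℕ) - 1) F (1 :: B) I) := by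
      refine Within.seq (T := 1) (T' := 2) (Within.push 2 2) ?_
      simp only [List.set_cons_succ, List.set_cons_zero, List.getD_cons_succ, List.getD_cons_zero]
      refine Within.seq (T := 1) (T' := 1) (Within.add 11 11 2 (abs_le.2 ?_)) ?_
      · simp only [List.getD_cons_succ, List.getD_cons_zero]; omega
      · simp only [List.set_cons_succ, List.set_cons_zero, List.getD_cons_succ, List.getD_cons_zero]
        refine Within.sub 16 16 2 (abs_le.2 ?_)
        simp only [List.getD_cons_succ, List.getD_cons_zero]; omega
    have := Within.while_pos (r := 16) (by simp) hb
      (by simpa [recordOnes] using ih (h := h + 1) (B := 1 :: B) (by omega) (by omega))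
    refine Within.mono ?_ (show 3 + (4 * Q + 1) + 1 ≤ _ by omega)
    rw [List.replicate_succ', List.append_assoc, List.singleton_append,
      show h + ((Q + 1 : ℕ) : ℤ) = h + 1 + Q by push_cast; ring]
    exact this

/-! ### From sites to symbols -/

/-- The store while the sites on stack 2, the last site of the road first, are translated into
symbols; `x` cars and `y` empty sites of the current group have been seen. -/
def parseStore (m k a b n l N f q q₂ h x y c : ℤ) (R S A B : List ℤ) (I : List Bool) : Store :=
  mem (m :: k :: 1 :: a :: b :: n :: l :: N :: f :: q :: q₂ :: h :: x :: y :: c :: R) [S, A, B] I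

/-- Insert the symbol of the current group. -/
def emitSymbol : Program :=
  .seq (.sub 3 13 0) (.seq (.sub 4 12 1) (.seq (.add 7 7 2) (.seq insertSymbol
    (.seq (.const 12 0) (.const 13 0)))))

/-- Registers `12` and `13` count the cars and empty sites of the current group. In the order from
back to front a group shows its cars first, so it is complete when a car follows its empty sites. -/
def parseBody : Program :=
  .seq (.pop 2 14) (.seq (.sub 11 11 2) (.ifPos 14
    (.seq (.ifPos 13 (.ifPos 12 emitSymbol (.const 9 0)) (.const 9 0)) (.add 12 12 2))
    (.add 13 13 2)))

def parseAll : Program := .whilePos 11 parseBody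

section

variable {W m k a b n l N f q q₂ h x y c : ℤ} {R S A B : List ℤ} {I : List Bool}

theorem Within.parse_zero (h₁ : |h - 1| ≤ W) (h₂ : |y + 1| ≤ W) : Within W parseBody
    (parseStore m k a b n l N f q q₂ h x y c R S A (0 :: B) I) 4
    (parseStore m k a b n l N f q q₂ (h - 1) x (y + 1) 0 R S A B I) := by
  refine Within.seq (T := 1) (T' := 3) (Within.pop 2 14 _ _ rfl) ?_
  simp only [List.set_cons_succ, List.set_cons_zero, List.getD_cons_succ, List.getD_cons_zero]
  refine Within.seq (T := 1) (T' := 2) (Within.sub 11 11 2 h₁) ?_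
  simp only [List.set_cons_succ, List.set_cons_zero, List.getD_cons_succ, List.getD_cons_zero]
  refine Within.if_not (T := 1) (r := 14) le_rfl ?_
  exact Within.add 13 13 2 h₂

theorem Within.parse_one (hxy : x ≤ 0 ∨ y ≤ 0) (hW : 0 ≤ W) (h₁ : |h - 1| ≤ W) (h₂ : |x + 1| ≤ W) :
    Within W parseBody (parseStore m k a b n l N f q q₂ h x y c R S A (1 :: B) I) 7
    (parseStore m k a b n l N f 0 q₂ (h - 1) (x + 1) y 1 R S A B I) := by
  refine Within.seq (T := 1) (T' := 6) (Within.pop 2 14 _ _ rfl) ?_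
  simp only [List.set_cons_succ, List.set_cons_zero, List.getD_cons_succ, List.getD_cons_zero]
  refine Within.seq (T := 1) (T' := 5) (Within.sub 11 11 2 h₁) ?_
  simp only [List.set_cons_succ, List.set_cons_zero, List.getD_cons_succ, List.getD_cons_zero]
  refine Within.if_pos (T := 4) (r := 14) one_pos ?_
  refine Within.seq (T := 3) (T' := 1)
    (σ' := parseStore m k a b n l N f 0 q₂ (h - 1) x y 1 R S A B I) ?_ (Within.add 12 12 2 h₂)
  by_cases hy : y ≤ 0
  · refine Within.mono (T := 2) ?_ (by omega)
    refine Within.if_not (T := 1) (r := 13) hy ?_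
    exact Within.const 9 0 (by simpa using hW)
  · refine Within.if_pos (T := 2) (r := 13) (not_le.1 hy) ?_
    refine Within.if_not (T := 1) (r := 12) (hxy.resolve_right hy) ?_
    exact Within.const 9 0 (by simpa using hW)

end

/-- The execution of `parseAll` from `σ` passes after at most `T` operations through `σ'`. -/
def Passes (W : ℤ) (P : Program) (σ : Store) (T : ℕ) (σ' : Store) : Prop :=
  ∀ (T' : ℕ) (σ'' : Store), Within W P σ' T' σ'' → Within W P σ (T + T') σ''

section

variable {W : ℤ} {m k a b n l N f q₂ h x y : ℤ} {R S A : List ℤ} {I : List Bool}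

theorem passes_zeros (B : List ℤ) (j : ℕ) (q c : ℤ) (hh : (j : ℤ) ≤ h) (hhW : h ≤ W) (hy : 0 ≤ y)
    (hyW : y + j ≤ W) : ∃ c' : ℤ, Passes W parseAll
      (parseStore m k a b n l N f q q₂ h x y c R S A (List.replicate j 0 ++ B) I) (5 * j)
      (parseStore m k a b n l N f q q₂ (h - j) x (y + j) c' R S A B I) := by
  induction j generalizing h y c with
  | zero => exact ⟨c, fun T' σ'' hT => by simpa using hT⟩
  | succ j ih =>
    push_cast at hh hyW
    obtain ⟨c', hc⟩ := ih (h := h - 1) (y := y + 1) 0 (by omega) (by omega) (by omega) (by omega)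
    refine ⟨c', fun T' σ'' hT => ?_⟩
    have hb := Within.parse_zero (W := W) (m := m) (k := k) (a := a) (b := b) (n := n) (l := l) (N := N)
      (f := f) (q := q) (q₂ := q₂) (h := h) (x := x) (y := y) (c := c) (R := R) (S := S) (A := A)
      (B := List.replicate j 0 ++ B) (I := I) (abs_le.2 (by omega)) (abs_le.2 (by omega))
    have h2 := hc T' σ'' (by
      rwa [show h - 1 - (j : ℤ) = h - (j + 1 : ℕ) by push_cast; ring,
        show y + 1 + (j : ℤ) = y + (j + 1 : ℕ) by push_cast; ring])
    refine Within.mono (T := 4 + (5 * j + T') + 1) ?_ (by omega)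
    refine Within.while_pos (r := 11) ?_ hb h2
    show 0 < h
    omega

theorem passes_ones (B : List ℤ) (j : ℕ) (q c : ℤ) (hh : (j : ℤ) ≤ h) (hhW : h ≤ W) (hx : 0 ≤ x)
    (hxW : x + j ≤ W) (hy : y ≤ 0) : ∃ q' c' : ℤ, Passes W parseAll
      (parseStore m k a b n l N f q q₂ h x y c R S A (List.replicate j 1 ++ B) I) (8 * j)
      (parseStore m k a b n l N f q' q₂ (h - j) (x + j) y c' R S A B I) := by
  induction j generalizing h x q c with
  | zero => exact ⟨q, c, fun T' σ'' hT => by simpa using hT⟩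
  | succ j ih =>
    push_cast at hh hxW
    obtain ⟨q', c', hc⟩ := ih (h := h - 1) (x := x + 1) 0 1 (by omega) (by omega) (by omega) (by omega)
    refine ⟨q', c', fun T' σ'' hT => ?_⟩
    have hb := Within.parse_one (W := W) (m := m) (k := k) (a := a) (b := b) (n := n) (l := l) (N := N)
      (f := f) (q := q) (q₂ := q₂) (h := h) (x := x) (y := y) (c := c) (R := R) (S := S) (A := A)
      (B := List.replicate j 1 ++ B) (I := I) (Or.inr hy) (by omega) (abs_le.2 (by omega))
      (abs_le.2 (by omega))
    have h2 := hc T' σ'' (by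
      rwa [show h - 1 - (j : ℤ) = h - (j + 1 : ℕ) by push_cast; ring,
        show x + 1 + (j : ℤ) = x + (j + 1 : ℕ) by push_cast; ring])
    refine Within.mono (T := 7 + (8 * j + T') + 1) ?_ (by omega)
    refine Within.while_pos (r := 11) ?_ hb h2
    show 0 < h
    omega

end

theorem Within.parse_emit {m k : ℕ} (hm : 1 ≤ m) {W : ℤ} (hW : 1 ≤ W) (p : Symbol)
    (S A : List Symbol) (a b N f q q₂ h c : ℤ) (R : List ℤ) (B : List ℤ) (I : List Bool)
    (hp : Valid m k p) (hh : 0 < h) (hhW : h ≤ W)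
    (hS : JamShape S) (hA : ∀ p ∈ A, 0 < p.1 ∧ p.2 ≤ 0) (hN : 0 ≤ N)
    (hwt : weight m k (p :: (S ++ A)) ≤ W) (hpot : N + 1 + potential (p :: (S ++ A)) ≤ W) :
    ∃ (S' A' : List Symbol) (g T : ℕ) (a' b' q' : ℤ),
      Within W parseBody
        (parseStore m k a b S.length A.length N f q q₂ h (p.2 + k) (p.1 + m) c R (encode S)
          (encode A) (1 :: B) I) T
        (parseStore m k a' b' S'.length A'.length (N + 1 + g) 0 q' q₂ (h - 1) 1 0 1 R (encode S')
          (encode A') B I) ∧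
      LinearReplaces m k (p :: (S ++ A)) g (S' ++ A') ∧
      T + 10 * potential (S' ++ A') ≤ 10 * potential (p :: (S ++ A)) + 22 ∧
      JamShape S' ∧ (∀ p ∈ A', 0 < p.1 ∧ p.2 ≤ 0) := by
  have hw := abs_add_abs_le_symbolWeight m k p
  have hw' := weight_nonneg m k (S ++ A)
  rw [weight_cons] at hwt
  have h1 : |p.1| ≤ W := by have := abs_nonneg p.2; omega
  have h2 : |p.2| ≤ W := by have := abs_nonneg p.1; omega
  obtain ⟨S', A', g, T, a', b', q', i1, i2, i3, i4, i5, -⟩ :=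
    Within.insert (k := k) hm hW p S A (N + 1) f q
      (q₂ :: (h - 1) :: (p.2 + k) :: (p.1 + m) :: 1 :: R) B I hS hA (by omega)
      (by rw [weight_cons]; omega) (by omega)
  refine ⟨S', A', g, T + 11, a', b', q', ?_, i2,
    by omega, i4, i5⟩
  rw [parseStore, show T + 11 = 1 + (T + 10) by omega]
  refine Within.seq (T := 1) (T' := T + 10) (Within.pop 2 14 _ _ rfl) ?_
  simp only [List.set_cons_succ, List.set_cons_zero, List.getD_cons_succ, List.getD_cons_zero]
  rw [show T + 10 = 1 + (T + 9) by omega]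
  refine Within.seq (T := 1) (T' := T + 9) (Within.sub 11 11 2 (abs_le.2 ?_)) ?_
  · simp only [List.getD_cons_succ, List.getD_cons_zero]; omega
  simp only [List.set_cons_succ, List.set_cons_zero, List.getD_cons_succ, List.getD_cons_zero]
  refine Within.if_pos (T := T + 8) (r := 14) one_pos ?_
  refine Within.seq (T := T + 7) (T' := 1) (σ' := parseStore m k a' b' S'.length A'.length (N + 1 + g) 0 q' q₂ (h - 1) 0 0 1 R
    (encode S') (encode A') B I) ?_ ?_
  · refine Within.if_pos (T := T + 6) (r := 13) hp.1 ?_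
    refine Within.if_pos (T := T + 5) (r := 12) hp.2 ?_
    rw [show T + 5 = 1 + (T + 4) by omega]
    refine Within.seq (T := 1) (T' := T + 4) (Within.sub 3 13 0 ?_) ?_
    · simpa using h1
    simp only [List.set_cons_succ, List.set_cons_zero, List.getD_cons_succ, List.getD_cons_zero]
    rw [show T + 4 = 1 + (T + 3) by omega]
    refine Within.seq (T := 1) (T' := T + 3) (Within.sub 4 12 1 ?_) ?_
    · simpa using h2
    simp only [List.set_cons_succ, List.set_cons_zero, List.getD_cons_succ, List.getD_cons_zero]
    rw [show T + 3 = 1 + (T + 2) by omega]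
    refine Within.seq (T := 1) (T' := T + 2) (Within.add 7 7 2 (abs_le.2 ?_)) ?_
    · simp only [List.getD_cons_succ, List.getD_cons_zero]; omega
    simp only [List.set_cons_succ, List.set_cons_zero, List.getD_cons_succ, List.getD_cons_zero]
    rw [add_sub_cancel_right, add_sub_cancel_right]
    refine Within.seq (T := T) (T' := 2) i1 ?_
    refine Within.seq (T := 1) (T' := 1) (Within.const 12 0 (by simp; omega)) ?_
    simp only [List.set_cons_succ, List.set_cons_zero, List.getD_cons_succ, List.getD_cons_zero]
    exact Within.const 13 0 (by simp; omega)
  · rw [parseStore]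
    exact Within.add 12 12 2 (by simpa using hW)

/-- The sites of the groups of the symbols `u`, from the back to the front. -/
def siteStack (m k : ℕ) (u : List Symbol) : List ℤ :=
  u.flatMap fun p : Symbol => List.replicate (p.2 + k).toNat 1 ++ List.replicate (p.1 + m).toNat 0

/-- The group `p` has been counted completely but not yet inserted; the next car triggers this. The
extra car at the bottom of the stack triggers it for the last group. -/
theorem Within.parse_all_of_pending {m k : ℕ} (hm : 1 ≤ m) {W : ℤ} (hW : 1 ≤ W) (u : List Symbol)
    (p : Symbol) (S A : List Symbol) (a b N f q q₂ c : ℤ) (R : List ℤ) (I : List Bool)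
    (hu : ∀ p ∈ u, Valid m k p) (hp : Valid m k p)
    (hsize : p.1 + m + (p.2 + k) + (siteStack m k u).length + 1 ≤ W)
    (hS : JamShape S) (hA : ∀ p ∈ A, 0 < p.1 ∧ p.2 ≤ 0) (hN : 0 ≤ N)
    (hwt : weight m k (u.reverse ++ (p :: (S ++ A))) ≤ W)
    (hpot : N + u.length + 1 + potential (u.reverse ++ (p :: (S ++ A))) ≤ W) :
    ∃ (S' A' : List Symbol) (g T : ℕ) (a' b' f' q' x' y' c' : ℤ),
      Within W parseAll
        (parseStore m k a b S.length A.length N f q q₂ ((siteStack m k u).length + 1) (p.2 + k)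
          (p.1 + m) c R (encode S) (encode A) (siteStack m k u ++ [1]) I) T
        (parseStore m k a' b' S'.length A'.length (N + (u.length + 1 + g : ℕ)) f' q' q₂ 0 x' y' c' R
          (encode S') (encode A') [] I) ∧
      LinearReplaces m k (u.reverse ++ (p :: (S ++ A))) g (S' ++ A') ∧
      T + 10 * potential (S' ++ A') ≤ 10 * potential (u.reverse ++ (p :: (S ++ A))) +
        8 * (siteStack m k u).length + 24 * (u.length + 1) ∧
      JamShape S' ∧ (∀ p ∈ A', 0 < p.1 ∧ p.2 ≤ 0) := by
  induction u generalizing p S A a b N f q c with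
  | nil =>
    obtain ⟨S', A', g, T, a', b', q', i1, i2, i3, i4, i5⟩ :=
      Within.parse_emit (k := k) hm hW p S A a b N f q q₂ 1 c R [] I hp one_pos hW hS hA hN hwt
        (by simpa using hpot)
    refine ⟨S', A', g, T + 1 + 1, a', b', 0, q', 1, 0, 1, ?_, i2, ?_, i4, i5⟩
    · have h0 : Within W parseAll (parseStore m k a' b' S'.length A'.length (N + 1 + g) 0 q' q₂ (1 - 1)
          1 0 1 R (encode S') (encode A') [] I) 1 _ := Within.while_not (r := 11) le_rfl
      rw [show N + (([] : List Symbol).length + 1 + g : ℕ) = N + 1 + g by simp; ring]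
      exact Within.while_pos (r := 11) one_pos i1 h0
    · simp only [List.reverse_nil, List.nil_append, List.length_nil]; omega
  | cons r u ih =>
    obtain ⟨hr, hu⟩ := List.forall_mem_cons.1 hu
    have hr1 := hr.1
    have hr2 := hr.2
    have hp1 := hp.1
    have hp2 := hp.2
    -- The first car of `r` is consumed by the iteration that inserts `p`, so only `j` further cars
    -- follow.
    obtain ⟨j, hj⟩ : ∃ j : ℕ, r.2 + k = j + 1 := ⟨(r.2 + k - 1).toNat, by omega⟩
    obtain ⟨i, hi⟩ : ∃ i : ℕ, r.1 + m = i := ⟨(r.1 + m).toNat, by omega⟩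
    have hstack : siteStack m k (r :: u) =
        1 :: (List.replicate j 1 ++ (List.replicate i 0 ++ siteStack m k u)) := by
      simp only [siteStack, List.flatMap_cons, hj, hi]
      rw [show ((j : ℤ) + 1).toNat = j + 1 by omega, show (i : ℤ).toNat = i by omega]
      simp [List.replicate_succ]
    have hlen : (siteStack m k (r :: u)).length = j + 1 + i + (siteStack m k u).length := by
      rw [hstack]; simp; ring
    rw [List.reverse_cons, List.append_assoc, List.singleton_append] at hwt hpot ⊢
    have w1 := weight_nonneg m k (u.reverse ++ [r])
    have p1 : potential (u.reverse ++ r :: (p :: (S ++ A))) =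
        potential (u.reverse ++ [r]) + potential (p :: (S ++ A)) := by simp; ring
    have w2 : weight m k (u.reverse ++ r :: (p :: (S ++ A))) =
        weight m k (u.reverse ++ [r]) + weight m k (p :: (S ++ A)) := by simp; ring
    rw [hlen] at hsize ⊢
    simp only [List.length_cons] at hpot ⊢
    push_cast at hsize hpot
    obtain ⟨S₁, A₁, g₁, T₁, a₁, b₁, q₁, i1, i2, i3, i4, i5⟩ :=
      Within.parse_emit (k := k) hm hW p S A a b N f q q₂ (j + 1 + i + (siteStack m k u).length + 1) c R
        (List.replicate j 1 ++ (List.replicate i 0 ++ siteStack m k u) ++ [1]) I hp (by omega) (by omega)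
        hS hA hN (by omega) (by omega)
    have hw₁ := i2.weight_le hm
    have hp₁ := i2.potential_add_le hm
    have p2 : potential (u.reverse ++ r :: (S₁ ++ A₁)) =
        potential (u.reverse ++ [r]) + potential (S₁ ++ A₁) := by simp; ring
    have w3 : weight m k (u.reverse ++ r :: (S₁ ++ A₁)) =
        weight m k (u.reverse ++ [r]) + weight m k (S₁ ++ A₁) := by simp; ring
    obtain ⟨q₂', c₂, hpass₁⟩ := passes_ones (W := W) (m := m) (k := k) (a := a₁) (b := b₁)
      (n := S₁.length) (l := A₁.length) (N := N + 1 + g₁) (f := 0) (q₂ := q₂)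
      (h := j + i + (siteStack m k u).length + 1) (x := 1) (y := 0) (R := R) (S := encode S₁)
      (A := encode A₁) (I := I) (List.replicate i 0 ++ (siteStack m k u ++ [1])) j q₁ 1
      (by omega) (by omega) (by omega) (by omega) le_rfl
    obtain ⟨c₃, hpass₂⟩ := passes_zeros (W := W) (m := m) (k := k) (a := a₁) (b := b₁)
      (n := S₁.length) (l := A₁.length) (N := N + 1 + g₁) (f := 0) (q₂ := q₂)
      (h := i + (siteStack m k u).length + 1) (x := 1 + j) (y := 0) (R := R) (S := encode S₁)
      (A := encode A₁) (I := I) (siteStack m k u ++ [1]) i q₂' c₂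
      (by omega) (by omega) (by omega) (by omega)
    obtain ⟨S', A', g, T, a', b', f', q', x', y', c', j1, j2, j3, j4⟩ :=
      ih r S₁ A₁ a₁ b₁ (N + 1 + g₁) 0 q₂' c₃ hu hr (by omega) i4 i5 (by omega) (by omega) (by omega)
    refine ⟨S', A', g₁ + g, T₁ + (8 * j + (5 * i + T)) + 1, a', b', f', q', x', y', c', ?_,
      ?_, ?_, j4⟩
    · rw [show N + ((u.length + 1 + 1 + (g₁ + g) : ℕ) : ℤ) = N + 1 + g₁ + (u.length + 1 + g : ℕ) by
        push_cast; ring, hstack]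
      have e1 : ((j + 1 + i + (siteStack m k u).length : ℕ) : ℤ) + 1 =
        j + 1 + i + (siteStack m k u).length + 1 := by push_cast; ring
      rw [e1]
      refine Within.while_pos (r := 11) ?_ i1 ?_
      · show (0 : ℤ) < j + 1 + i + (siteStack m k u).length + 1
        omega
      · have h2 := hpass₂ T _ (by
          rw [show (i : ℤ) + (siteStack m k u).length + 1 - i = (siteStack m k u).length + 1 by ring,
            show (1 : ℤ) + j = r.2 + k by omega, show (0 : ℤ) + i = r.1 + m by omega]
          exact j1)
        have h3 := hpass₁ _ _ (by
          rw [show (j : ℤ) + i + (siteStack m k u).length + 1 - j = i + (siteStack m k u).length + 1 by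
            ring]
          exact h2)
        rw [show (j : ℤ) + 1 + i + (siteStack m k u).length + 1 - 1 =
          j + i + (siteStack m k u).length + 1 by ring]
        change Within W parseAll _ _ _
        simpa only [List.append_assoc] using h3
    · have := (i2.append_left (u.reverse ++ [r]))
      simp only [List.append_assoc, List.singleton_append] at this
      exact this.trans j2
    · omega

/-- Running `parseAll` on a road that starts with an empty site and ends with a car. -/
theorem Within.parse_all {m k : ℕ} (hm : 1 ≤ m) {W : ℤ} (hW : 1 ≤ W) (u : List Symbol)
    (q c : ℤ) (R : List ℤ) (I : List Bool) (hu : ∀ p ∈ u, Valid m k p)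
    (hsize : ((siteStack m k u.reverse).length : ℤ) + 1 ≤ W)
    (hwt : weight m k u ≤ W) (hpot : (u.length : ℤ) + 1 + potential u ≤ W) (hne : u ≠ []) :
    ∃ (S' A' : List Symbol) (g T : ℕ) (a' b' f' q' x' y' c' : ℤ),
      Within W parseAll
        (parseStore m k 0 0 0 0 0 0 q 0 ((siteStack m k u.reverse).length + 1) 0 0 c R [] []
          (siteStack m k u.reverse ++ [1]) I) T
        (parseStore m k a' b' S'.length A'.length (u.length + g : ℕ) f' q' 0 0 x' y' c' R
          (encode S') (encode A') [] I) ∧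
      LinearReplaces m k u g (S' ++ A') ∧
      T + 10 * potential (S' ++ A') ≤ 10 * potential u + 8 * (siteStack m k u.reverse).length +
        24 * u.length ∧
      JamShape S' ∧ (∀ p ∈ A', 0 < p.1 ∧ p.2 ≤ 0) := by
  rcases List.eq_nil_or_concat' u with rfl | ⟨u, r, rfl⟩
  · exact absurd rfl hne
  · have hr : Valid m k r := hu r (by simp)
    have hr1 := hr.1
    have hr2 := hr.2
    obtain ⟨j, hj⟩ : ∃ j : ℕ, r.2 + k = j := ⟨(r.2 + k).toNat, by omega⟩
    obtain ⟨i, hi⟩ : ∃ i : ℕ, r.1 + m = i := ⟨(r.1 + m).toNat, by omega⟩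
    have hstack : siteStack m k (u ++ [r]).reverse =
        List.replicate j 1 ++ (List.replicate i 0 ++ siteStack m k u.reverse) := by
      simp only [siteStack, List.reverse_append, List.reverse_singleton, List.singleton_append,
        List.flatMap_cons, hj, hi]
      simp
    have hlen : (siteStack m k (u ++ [r]).reverse).length =
        j + i + (siteStack m k u.reverse).length := by
      rw [hstack]; simp; ring
    rw [hlen] at hsize ⊢
    rw [List.length_append, List.length_singleton] at hpot ⊢
    push_cast at hsize hpot
    obtain ⟨q₂', c₂, hpass₁⟩ := passes_ones (W := W) (m := m) (k := k) (a := 0) (b := 0)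
      (n := 0) (l := 0) (N := 0) (f := 0) (q₂ := 0)
      (h := j + i + (siteStack m k u.reverse).length + 1) (x := 0) (y := 0) (R := R) (S := [])
      (A := []) (I := I) (List.replicate i 0 ++ (siteStack m k u.reverse ++ [1])) j q c
      (by omega) (by omega) (by omega) (by omega) le_rfl
    obtain ⟨c₃, hpass₂⟩ := passes_zeros (W := W) (m := m) (k := k) (a := 0) (b := 0)
      (n := 0) (l := 0) (N := 0) (f := 0) (q₂ := 0)
      (h := i + (siteStack m k u.reverse).length + 1) (x := 0 + j) (y := 0) (R := R) (S := [])
      (A := []) (I := I) (siteStack m k u.reverse ++ [1]) i q₂' c₂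
      (by omega) (by omega) (by omega) (by omega)
    obtain ⟨S', A', g, T, a', b', f', q', x', y', c', j1, j2, j3, j4⟩ :=
      Within.parse_all_of_pending (k := k) hm hW u.reverse r [] [] 0 0 0 0 q₂' 0 c₃ R I
        (fun p hp => hu p (by simp at hp; simp [hp])) hr (by omega) trivial (by simp) le_rfl
        (by simpa using hwt) (by simp at hpot ⊢; omega)
    simp only [List.reverse_reverse, List.append_nil, List.length_reverse] at j1 j2 j3
    refine ⟨S', A', g, 8 * j + (5 * i + T), a', b', f', q', x', y', c', ?_, j2, ?_, j4⟩
    · rw [zero_add] at j1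
      have h2 := hpass₂ T _ (by
        rw [show (i : ℤ) + (siteStack m k u.reverse).length + 1 - i =
            (siteStack m k u.reverse).length + 1 by ring,
          show (0 : ℤ) + j = r.2 + k by omega, show (0 : ℤ) + i = r.1 + m by omega]
        exact j1)
      have h3 := hpass₁ _ _ (by
        rw [show (j : ℤ) + i + (siteStack m k u.reverse).length + 1 - j =
          i + (siteStack m k u.reverse).length + 1 by ring]
        exact h2)
      rw [hstack, show ((j + i + (siteStack m k u.reverse).length : ℕ) : ℤ) + 1 =
        j + i + (siteStack m k u.reverse).length + 1 by push_cast; ring]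
      simpa only [List.append_assoc] using h3
    · omega

/-- Running `parseAll` on a road with all sites equal: no symbol is inserted. -/
theorem Within.parse_constant {W : ℤ} (hW : 1 ≤ W) {m k : ℤ} (L : ℕ) (v : Bool) (q c : ℤ) (R : List ℤ)
    (I : List Bool) (hL : (L : ℤ) + 1 ≤ W) : ∃ q' x' y' c' : ℤ,
      Within W parseAll
        (parseStore m k 0 0 0 0 0 0 q 0 (L + 1) 0 0 c R [] []
          (List.replicate L (bit v) ++ [1]) I) (8 * L + 9)
        (parseStore m k 0 0 0 0 0 0 q' 0 0 x' y' c' R [] [] [] I) := by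
  cases v with
  | false =>
    obtain ⟨c₁, hpass⟩ := passes_zeros (W := W) (m := m) (k := k) (a := 0) (b := 0)
      (n := 0) (l := 0) (N := 0) (f := 0) (q₂ := 0) (h := L + 1) (x := 0) (y := 0) (R := R) (S := [])
      (A := []) (I := I) [1] L q c (by omega) hL le_rfl (by omega)
    -- The extra car at the bottom follows `L` empty sites, but no car has been counted, so nothing
    -- is inserted.
    have h1 := Within.parse_one (W := W) (m := m) (k := k) (a := 0) (b := 0)
      (n := 0) (l := 0) (N := 0) (f := 0) (q := q) (q₂ := 0) (h := 1) (x := 0) (y := 0 + L) (c := c₁)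
      (R := R) (S := []) (A := []) (B := []) (I := I) (Or.inl le_rfl) (by omega) (by simp; omega)
      (by simpa using hW)
    have h0 : Within W parseAll (parseStore m k 0 0 0 0 0 0 0 0 (1 - 1) (0 + 1) (0 + L) 1 R [] [] [] I)
      1 _ := Within.while_not (r := 11) le_rfl
    refine ⟨0, 0 + 1, 0 + L, 1, Within.mono (hpass (7 + 1 + 1) _ ?_) (by omega)⟩
    rw [show (L : ℤ) + 1 - L = 1 by ring]
    exact Within.while_pos (r := 11) one_pos h1 h0
  | true =>
    -- The extra car is just one more car, hence `L + 1`; without an empty site no group is ever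
    -- complete.
    obtain ⟨q₁, c₁, hpass⟩ := passes_ones (W := W) (m := m) (k := k) (a := 0) (b := 0)
      (n := 0) (l := 0) (N := 0) (f := 0) (q₂ := 0) (h := L + 1) (x := 0) (y := 0) (R := R) (S := [])
      (A := []) (I := I) [] (L + 1) q c (by omega) hL le_rfl (by push_cast; omega) le_rfl
    have h0 : Within W parseAll (parseStore m k 0 0 0 0 0 0 q₁ 0 0 (0 + (L + 1 : ℕ)) 0 c₁ R [] [] [] I)
      1 _ := Within.while_not (r := 11) le_rfl
    refine ⟨q₁, 0 + (L + 1 : ℕ), 0, c₁, Within.mono ?_ (show 8 * (L + 1) + 1 ≤ _ by omega)⟩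
    have h2 := hpass _ _ (by
      rw [show (L : ℤ) + 1 - (L + 1 : ℕ) = 0 by push_cast; ring]
      exact h0)
    rw [List.append_nil, List.replicate_succ'] at h2
    exact h2

/-! ### The stack program -/

def setUp : Program := .seq (.const 2 1) (.seq (.push 2 2) (.seq (.add 11 11 2) readNext))

/-- Read the sites and put them on stack 2, rotated such that the road starts with an empty site and
ends with a car, above a further car. -/
def loadRoad : Program := .seq setUp (.seq readRoad (.seq recordZeros recordOnes))

/-- Translate the road into symbols and apply the rules to them. -/
def reduceRoad : Program :=
  .seq loadRoad (.seq parseAll (.seq closeCircle (.seq (.const 9 0) (.add 0 7 9))))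

theorem Within.set_up {W : ℤ} (hW : 2 ≤ W) {m k L : ℕ} (s : Road L) : Within W setUp (startStore m k s) 5
    (readStore m k (nextSite (readFrom s 0)) (nextSite (readFrom s 0) + 1) 1 0 0 0 [1]
      (readFrom s 0).tail) := by
  have h : startStore m k s = mem [m, k, 0, 0, 0, 0, 0, 0, 0, 0, 0, 0, 0, 0, 0, 0, 0, 0] [[], [], []]
      (readFrom s 0) := by
    simp only [startStore, mem, readFrom, zero_add, List.pure_def, List.bind_eq_flatMap,
      ← List.map_eq_flatMap, List.map_map]
    congr 1
    · funext r
      rcases r with _ | _ | r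
      · rfl
      · rfl
      · rw [if_neg (by omega), if_neg (by omega)]
        rcases Nat.lt_or_ge r 16 with hr | hr
        · interval_cases r <;> rfl
        · rw [List.getD_eq_default]
          simpa using hr
    · funext i
      rcases i with _ | _ | _ | i <;> rfl
  rw [h]
  refine Within.seq (T := 1) (T' := 4) (Within.const 2 1 (by simp; omega)) ?_
  simp only [List.set_cons_succ, List.set_cons_zero]
  refine Within.seq (T := 1) (T' := 3) (Within.push 2 2) ?_
  simp only [List.set_cons_succ, List.set_cons_zero, List.getD_cons_succ, List.getD_cons_zero]
  refine Within.seq (T := 1) (T' := 2) (Within.add 11 11 2 (by simp; omega)) ?_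
  simp only [List.set_cons_succ, List.set_cons_zero, List.getD_cons_succ, List.getD_cons_zero]
  exact Within.read_next hW

/-- Putting the prefix `0^P 1^Q` on top of the stored rest rotates the road to `rest 0^P 1^Q`.
Unless all sites are equal, this word starts with an empty site and ends with a car, so no group is
cut. -/
theorem Within.load_road {W : ℤ} {m k L : ℕ} [NeZero L] (s : Road L) (hW : 2 * (L : ℤ) + 2 ≤ W) :
    ∃ (r : ZMod L) (R : List ℤ), Within W loadRoad (startStore m k s) (12 * L + 8)
      (parseStore m k 0 0 0 0 0 0 0 0 (L + 1) 0 0 (-1) R [] []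
        (bits (readFrom s r).reverse ++ [1]) []) ∧
      ((¬ ∃ v, s = fun _ => v) →
        (readFrom s r).head? = some false ∧ (readFrom s r).getLast? = some true) := by
  have hlen : (readFrom s 0).length = L := length_readFrom s 0
  obtain ⟨P, Q, F, rest, h₂, i2, i3⟩ := Within.read_road (W := W) (m := m) (k := k) (readFrom s 0) []
    0 0 0 (by simp; omega) (by simp) (by simp)
  simp only [List.replicate_zero, List.nil_append] at i2
  have hL := congrArg List.length i2
  simp only [hlen, List.length_append, List.length_replicate] at hL
  have h₃ := Within.record_zeros (W := W) (m := m) (k := k) (c := -1) (q := 0) (h := rest.length + 1)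
    (Q := Q) (F := F) P (B := bits rest.reverse ++ [1]) (I := []) (by omega) (by omega)
  have h₄ := Within.record_ones (W := W) (m := m) (k := k) (c := -1) (q := 0)
    (h := rest.length + 1 + P) (P := 0) (F := F) Q
    (B := List.replicate P 0 ++ (bits rest.reverse ++ [1])) (I := []) (by omega) (by omega)
  have hr := readFrom_add_length (F := s) (r := 0) (x := List.replicate P false ++ List.replicate Q true)
    (y := rest) i2
  refine ⟨0 + ((List.replicate P false ++ List.replicate Q true).length : ZMod L), [0, 0, F], ?_, ?_⟩
  · rw [hr, show ((L : ℤ) + 1) = rest.length + 1 + P + Q by omega]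
    have hB : bits (rest ++ (List.replicate P false ++ List.replicate Q true)).reverse ++ [1] =
        List.replicate Q 1 ++ (List.replicate P 0 ++ (bits rest.reverse ++ [1])) := by
      simp [bits, bit]
    rw [hB]
    rw [hlen] at h₂
    exact (Within.seq (Within.set_up (by omega) s) (Within.seq (by simpa [bits] using h₂)
      (Within.seq h₃ h₄))).mono (by omega)
  · intro hs
    rw [hr]
    by_cases hrest : rest = []
    · subst hrest
      have hconst : ∀ v, readFrom s 0 ≠ List.replicate L v := by
        intro v hv
        refine hs ⟨v, funext fun i => ?_⟩
        have hi : i.val < L := ZMod.val_lt i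
        have := getElem_readFrom s 0 i.val (by rw [hlen]; exact hi)
        simp only [hv, List.getElem_replicate, zero_add, ZMod.natCast_zmod_val] at this
        exact this.symm
      simp only [List.append_nil, List.length_nil, add_zero] at i2 hL
      rcases Nat.eq_zero_or_pos P with rfl | hP
      · exact absurd (by simpa [hL] using i2) (hconst true)
      rcases Nat.eq_zero_or_pos Q with rfl | hQ
      · exact absurd (by simpa [hL] using i2) (hconst false)
      obtain ⟨P, rfl⟩ := Nat.exists_eq_succ_of_ne_zero hP.ne'
      obtain ⟨Q, rfl⟩ := Nat.exists_eq_succ_of_ne_zero hQ.ne'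
      refine ⟨by simp [List.replicate_succ], ?_⟩
      rw [List.replicate_succ' (n := Q), ← List.append_assoc, ← List.append_assoc, List.getLast?_concat]
    · obtain ⟨hQ, hh⟩ := i3 hrest
      obtain ⟨Q, rfl⟩ := Nat.exists_eq_succ_of_ne_zero hQ.ne'
      refine ⟨by rw [List.head?_append, hh]; rfl, ?_⟩
      rw [List.replicate_succ', ← List.append_assoc, ← List.append_assoc, List.getLast?_concat]

theorem bits_reverse_twoWord (m k : ℕ) (u : List Symbol) :
    bits (twoWord false (u.map (sizes m k))).reverse = siteStack m k u.reverse := by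
  induction u with
  | nil => rfl
  | cons p u ih =>
    have h : siteStack m k (p :: u).reverse = siteStack m k u.reverse ++
        (List.replicate (p.2 + k).toNat 1 ++ List.replicate (p.1 + m).toNat 0) := by
      simp [siteStack]
    rw [h, ← ih]
    simp [twoWord, twoBlock, bits, bit, sizes]

/-- Each group pays for itself: `max p.1 0 + 1` is at most its number of empty sites, and its
indices differ from its block lengths by `m` and `k` only. -/
theorem weight_le_and_potential_le {m k : ℕ} (hm : 1 ≤ m) (hk : 1 ≤ k) {u : List Symbol}
    (hu : ∀ p ∈ u, Valid m k p) : weight m k u ≤ 3 * ((siteStack m k u.reverse).length * (m + k)) ∧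
      potential u ≤ (siteStack m k u.reverse).length := by
  induction u with
  | nil => simp [siteStack]
  | cons p u ih =>
    obtain ⟨hp, hu⟩ := List.forall_mem_cons.1 hu
    obtain ⟨h1, h2⟩ := ih hu
    obtain ⟨hp1, hp2⟩ := hp
    have h : (siteStack m k (p :: u).reverse).length = (siteStack m k u.reverse).length +
        ((p.2 + k).toNat + (p.1 + m).toNat) := by
      simp [siteStack]
    have h' : ((siteStack m k (p :: u).reverse).length : ℤ) = (siteStack m k u.reverse).length +
        ((p.2 + k) + (p.1 + m)) := by rw [h]; push_cast; omega
    rw [h', weight_cons, potential_cons, h]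
    refine ⟨?_, by simp only [symbolPotential]; omega⟩
    have e1 : max p.1 0 + 1 ≤ p.1 + m := by omega
    have e2 := mul_le_mul_of_nonneg_right e1 (show 0 ≤ (m : ℤ) + k by positivity)
    have e3 : |p.1| ≤ p.1 + m + m := abs_le.2 (by omega)
    have e4 : |p.2| ≤ p.2 + k + k := abs_le.2 (by omega)
    have e5 : symbolWeight m k p ≤ 3 * ((p.2 + k + (p.1 + m)) * (m + k)) := by
      rw [symbolWeight]
      have hm' : (1 : ℤ) ≤ m := by exact_mod_cast hm
      have hk' : (1 : ℤ) ≤ k := by exact_mod_cast hk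
      nlinarith
    rw [add_mul]
    linarith

theorem Replaces.cyclePotential_add_le {m k g : ℕ} (hm : 1 ≤ m) {w w' : Cycle Symbol}
    (h : Replaces m k w g w') : cyclePotential w' + g ≤ cyclePotential w := by
  induction h with
  | refl => exact le_rfl
  | @tail w₁ w₂ g d h hr ih =>
    have h1 := hr.potential_lt hm
    have h2 : d ≤ 1 := by cases hr <;> omega
    omega

theorem reduceRoad_spec {m k : ℕ} (hm : 1 ≤ m) (hk : 1 ≤ k) (L : ℕ) [NeZero L] (s : Road L) :
    ∃ (t : ℕ) (σ : Store) (g : ℕ) (u : List Symbol),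
      Exec (((200 : ℕ) : ℤ) * ((L : ℤ) * ((m : ℤ) + (k : ℤ)))) reduceRoad (startStore m k s) t σ ∧
      t ≤ 200 * L ∧
      MaximalApplication m k (initialString m k s) g (u : Cycle Symbol) ∧
      σ.reg 0 = (((initialString m k s).length + g : ℕ) : ℤ) ∧
      σ.stack 0 = encode u := by
  have hL : 1 ≤ L := Nat.one_le_iff_ne_zero.2 (NeZero.ne L)
  have hm' : (1 : ℤ) ≤ m := by exact_mod_cast hm
  have hk' : (1 : ℤ) ≤ k := by exact_mod_cast hk
  have hL' : (1 : ℤ) ≤ L := by exact_mod_cast hL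
  have hmk : 2 * (L : ℤ) ≤ L * (m + k) := by nlinarith
  -- The four stages take at most `12 L + 8`, `42 L + 9`, `46 L + 21` and `2` operations, so `200 L`
  -- suffices for `L ≥ 1`. The same constant leaves room for the weight `3 L (m + k)` and, as `m + k
  -- ≥ 2`, for all counters.
  set W : ℤ := ((200 : ℕ) : ℤ) * ((L : ℤ) * ((m : ℤ) + (k : ℤ))) with hWdef
  have hWL : 400 * (L : ℤ) ≤ W := by rw [hWdef]; push_cast; omega
  have hWM : 3 * ((L : ℤ) * (m + k)) ≤ W := by rw [hWdef]; push_cast; omega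
  obtain ⟨r, R, hload, hends⟩ := Within.load_road (m := m) (k := k) (W := W) s (by omega)
  obtain ⟨u, S, A, g, T, a, b, f, q, x, y, c, hparse, hu, hred, hT, hS, hA, hw, hp, hlen⟩ :
      ∃ (u S A : List Symbol) (g T : ℕ) (a b f q x y c : ℤ),
      Within W parseAll
        (parseStore m k 0 0 0 0 0 0 0 0 (L + 1) 0 0 (-1) R [] [] (bits (readFrom s r).reverse ++ [1]) [])
        T (parseStore m k a b S.length A.length (u.length + g : ℕ) f q 0 0 x y c R
          (encode S) (encode A) [] []) ∧
      initialString m k s = (u : Cycle Symbol) ∧ LinearReplaces m k u g (S ++ A) ∧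
      T ≤ 42 * L + 9 ∧ JamShape S ∧ (∀ p ∈ A, 0 < p.1 ∧ p.2 ≤ 0) ∧
      weight m k u ≤ 3 * (L * (m + k)) ∧ potential u ≤ L ∧ u.length ≤ L := by
    by_cases hs : ∃ v, s = fun _ => v
    · obtain ⟨v, rfl⟩ := hs
      have hread : readFrom (fun _ => v : Road L) r = List.replicate L v := by
        simp [readFrom, List.map_const']
      rw [hread]
      obtain ⟨q, x, y, c, h⟩ := Within.parse_constant (W := W) (m := m) (k := k) (by omega) L v 0 (-1) R []
        (by omega)
      refine ⟨[], [], [], 0, 8 * L + 9, 0, 0, 0, q, x, y, c, ?_, by simp [initialString_constant],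
        LinearReplaces.refl _, by omega, trivial, by simp, by simp; positivity, by simp, by simp⟩
      simpa [bits] using h
    · obtain ⟨h1, h2⟩ := hends hs
      obtain ⟨u, hu⟩ := exists_presents_of_ends m k h1 h2
      have hsite : (siteStack m k u.reverse).length = L := by
        rw [← bits_reverse_twoWord, ← hu.1]; simp [bits]
      obtain ⟨hw, hp⟩ := weight_le_and_potential_le hm hk hu.2
      rw [hsite] at hw hp
      have hlen := (length_le_potential u).trans hp
      obtain ⟨S, A, g, T, a, b, f, q, x, y, c, i1, i2, i3, i4, i5⟩ :=
        Within.parse_all (k := k) (W := W) hm (by omega) u 0 (-1) R [] hu.2 (by rw [hsite]; omega)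
          (by omega) (by omega) hu.ne_nil
      refine ⟨u, S, A, g, T, a, b, f, q, x, y, c, ?_, hu.initialString_eq, i2, ?_, i4, i5, hw, hp, hlen⟩
      · rw [hu.1, bits_reverse_twoWord]
        rwa [hsite] at i1
      · rw [hsite] at i3; omega
  have hw' := hred.weight_le hm
  have hp' := hred.potential_add_le hm
  obtain ⟨u', g', T', a', b', n', f', q', q₂', hclose, hred', hT', hset⟩ :=
    Within.close_circle (k := k) (W := W) hm (by omega) S A a b (u.length + g : ℕ) f q 0 (x :: y :: c :: R)
      [] hS hA (by omega) (by omega) (by omega)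
  -- Every new group costs at least one unit of potential, so the number written to the output is at
  -- most `2 L`.
  have hbound : |((u.length + g : ℕ) : ℤ) + g' + 0| ≤ W := by
    have h := hred'.cyclePotential_add_le hm
    rw [cyclePotential_coe, cyclePotential_coe] at h
    rw [abs_of_nonneg (by omega)]
    omega
  have hend : Within W (.seq (.const 9 0) (.add 0 7 9))
      (mem (m :: k :: 1 :: a' :: b' :: n' :: 0 :: ((u.length + g : ℕ) + g') :: f' :: q' :: q₂' :: 0 ::
        x :: y :: c :: R) [encode u', [], []] []) 2
      (mem (((u.length + g : ℕ) + g' + 0) :: k :: 1 :: a' :: b' :: n' :: 0 :: ((u.length + g : ℕ) + g') ::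
        f' :: 0 :: q₂' :: 0 :: x :: y :: c :: R) [encode u', [], []] []) := by
    refine Within.seq (T := 1) (T' := 1) (Within.const 9 0 (by simp; omega)) ?_
    simp only [List.set_cons_succ, List.set_cons_zero, List.getD_cons_succ, List.getD_cons_zero]
    exact Within.add 0 7 9 hbound
  obtain ⟨t, ht, hrun⟩ := Within.seq hload (Within.seq hparse (Within.seq hclose hend))
  refine ⟨t, _, g + g', u', hrun, by omega, ?_, ?_, rfl⟩
  · rw [hu]
    exact ⟨hred.replaces.trans hred', fun _ _ => hset.not_replace⟩
  · rw [hu, Cycle.length_coe]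
    show ((u.length + g : ℕ) : ℤ) + g' + 0 = _
    push_cast; ring

end TrafficRule

theorem mainTheorem8 :
    -- the replacement rules give the final number of groups and the steady-state flow
    (∀ m k : ℕ, 1 ≤ m → 1 ≤ k → ∀ (L : ℕ) [NeZero L] (s : Road L),
      (∀ f : ℕ → Cycle Symbol, f 0 = initialString m k s →
        ¬ ∀ n, ∃ d, Replace m k (f n) d (f (n + 1))) ∧
      (∃ T : ℕ, IsCyclicState m k ((step m k)^[T] s)) ∧
      ∀ (g : ℕ) (w : Cycle Symbol), MaximalApplication m k (initialString m k s) g w →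
        ∀ T : ℕ, IsCyclicState m k ((step m k)^[T] s) →
          groups ((step m k)^[T] s) = (initialString m k s).length + g ∧
          cycleFlow m k ((step m k)^[T] s) =
            min ((m : ℝ) * density s)
              (min (density s * (1 - density s) /
                  ((((initialString m k s).length + g : ℕ) : ℝ) / (L : ℝ)))
                ((k : ℝ) * (1 - density s)))) ∧
    -- a stack program carries out a maximal application of the rules in time linear in `L`
    (∃ (P : Program) (C : ℕ), ∀ m k : ℕ, 1 ≤ m → 1 ≤ k → ∀ (L : ℕ) [NeZero L] (s : Road L),
      ∃ (t : ℕ) (σ : Store) (g : ℕ) (u : List Symbol),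
        Exec ((C : ℤ) * ((L : ℤ) * ((m : ℤ) + (k : ℤ)))) P (startStore m k s) t σ ∧
        t ≤ C * L ∧
        MaximalApplication m k (initialString m k s) g (u : Cycle Symbol) ∧
        σ.reg 0 = (((initialString m k s).length + g : ℕ) : ℤ) ∧
        σ.stack 0 = encode u) ∧
    -- the worst-case time of the direct simulation is at least quadratic in `L`
    (∀ m k : ℕ, 1 ≤ m → 1 ≤ k → ∃ c : ℝ, 0 < c ∧ ∃ L₀ : ℕ, ∀ (L : ℕ) [NeZero L], L₀ ≤ L →
      ∃ s : Road L, c * (L : ℝ) ^ 2 ≤ (directSimulationTime m k s : ℝ)) := by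
  exact ⟨fun m k hm hk L _ s => ⟨fun f _ => no_infinite_replacement hm f,
    exists_isCyclicState s, fun g w hw T hT => groups_and_cycleFlow hm hk s g w hw T hT⟩,
    ⟨reduceRoad, 200, fun m k hm hk L _ s => reduceRoad_spec hm hk L s⟩,
    fun m k hm hk => exists_quadratic_transient hm hk⟩
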